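/- Let $N\ge 1$ be an odd integer, $n\ge 2$ an integer, and $\boldsymbol{k}$ a field that contains a primitive $4nN$-th root of unity (so the characteristic of $\boldsymbol{k}$ does not divide $2nN$). For a Hopf algebra $A$ over $\boldsymbol{k}$, let $\mathrm{Rep}(A)$ be the Grothendieck ring of the semiring of isomorphism classes of finite-dimensional left $A$-modules with $[V]+[W]=[V\oplus W]$ and $[V][W]=[V\otimes W]$, equipped with the $\ast$-structure $[V]^{\ast}=[V^{\ast}]$, where $(a f)(v)=f(S(a)v)$ for $f\in V^\ast$ and $S$ is the antipode. Let $\lambda=1$ if $n$ is odd and $\lambda=-1$ if $n$ is even. Let $A_{Nn}$ be the Hopf algebra generated as an algebra by $x_{ij}$ $(i,j\in\{1,2\})$ subject to the relations $x_{11}^2=x_{22}^2$, $x_{12}^2=x_{21}^2$, $x_{ij}x_{lm}=0$ for $i-j\not\equiv l-m \pmod 2$, $x_{11}^{2N}+x_{12}^{2N}=1$, $x_{11}x_{22}x_{11}\cdots=x_{22}x_{11}x_{22}\cdots$ and $x_{21}x_{12}x_{21}\cdots=\lambda\, x_{12}x_{21}x_{12}\cdots$ ($n$ factors in each product), with $\Delta(x_{ij})=x_{i1}\otimes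 x_{1j}+x_{i2}\otimes x_{2j}$, $\varepsilon(x_{ij})=\delta_{ij}$, $S(x_{ij})=x_{ji}^{2N-1}$. Let $$G_{Nn}=\langle h,t,w \mid t^2=h^{2N}=1,\ w^n=h^N,\ tw=w^{-1}t,\ ht=th,\ hw=wh\rangle .$$ Then $\mathrm{Rep}(A_{Nn})$ and $\mathrm{Rep}(\boldsymbol{k}[G_{Nn}])$ are isomorphic as rings with $\ast$-structure. Moreover: (1) If $n$ is even, both are isomorphic, as rings with $\ast$-structure, to the commutative ring generated by $a,b,c,x_1,\dots,x_{n-1}$ subject to the relations $$a^2=b^2=c^N=1,\qquad ax_i=x_i,\qquad bx_i=x_{n-i}\qquad(1\le i\le n-1),$$ $$x_ix_j=c^{\frac{1-(-1)^{ij}}{2}}(x_{|i-j|}+x_{i+j})\qquad(1\le i,j\le n-1),$$ where on the right-hand side $x_0=1+a$, $x_n=b(1+a)$ and $x_{n+i}=x_{n-i}$ $(1\le i\le n-1)$, with the $\ast$-structure given by $$a^\ast=a,\quad b^\ast=b,\quad c^\ast=c^{-1},\quad x_i^\ast=c^{\frac{(-1)^i-1}{2}}x_i\qquad(1\le i\le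 n-1).$$ (2) If $n$ is odd, both are isomorphic, as rings with $\ast$-structure, to the commutative ring generated by $a,b,x_1,\dots,x_{n-1}$ subject to the relations $$a^2=b^{2N}=1,\qquad ax_i=x_i\quad(1\le i\le n-1),\qquad bx_i=x_{n-i}\quad(i=2,4,\dots,n-1),$$ $$x_ix_j=b^{1-(-1)^{ij}}(x_{|i-j|}+x_{i+j})\qquad(1\le i,j\le n-1),$$ where on the right-hand side $x_0=1+a$, $x_n=b(1+a)$ and $x_{n+i}=x_{n-i}$ $(1\le i\le n-1)$, with the $\ast$-structure given by $$a^\ast=a,\quad b^\ast=b^{-1},\quad x_i^\ast=b^{(-1)^i-1}x_i\qquad(1\le i\le n-1).$$ -/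

import Mathlib

open scoped TensorProduct

universe u v w

noncomputable section

/-! ### Grothendieck ring of a (not necessarily commutative) semiring -/

/-- The Grothendieck (enveloping) group of the additive monoid of a semiring, with the
multiplication extended biadditively. -/
def GrothendieckRing (S : Type w) [Semiring S] : Type w := Algebra.GrothendieckAddGroup S

namespace GrothendieckRing

variable {S : Type w} [Semiring S]

instance : AddCommGroup (GrothendieckRing S) :=
  inferInstanceAs (AddCommGroup (Algebra.GrothendieckAddGroup S))

/-- The class of an element of the semiring. -/
def of : S →+ GrothendieckRing S := Algebra.GrothendieckAddGroup.of

/-- Additive maps from `S` to an additive group extend to the Grothendieck ring. -/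
def lift {H : Type*} [AddCommGroup H] (f : S →+ H) : GrothendieckRing S →+ H :=
  Algebra.GrothendieckAddGroup.lift f

@[simp] theorem lift_of {H : Type*} [AddCommGroup H] (f : S →+ H) (s : S) :
    lift f (of s) = f s :=
  DFunLike.congr_fun (Algebra.GrothendieckAddGroup.lift.symm_apply_apply f) s

theorem exists_sub (x : GrothendieckRing S) : ∃ s t : S, x = of s - of t := by
  induction x using AddLocalization.ind with
  | H y =>
    refine ⟨y.1, y.2, ?_⟩
    have h : (of (S := S) y.1 - of (y.2 : S)) =
        (AddLocalization.mk y.1 0 - AddLocalization.mk (y.2 : S) 0 :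
          Algebra.GrothendieckAddGroup S) := rfl
    rw [h, Algebra.GrothendieckAddGroup.mk_sub_mk]
    congr 1 <;> simp

/-- The biadditive extension of the multiplication of `S`. -/
def mulHom : GrothendieckRing S →+ GrothendieckRing S →+ GrothendieckRing S :=
  lift
    { toFun := fun s => lift (of.comp (AddMonoidHom.mulLeft s))
      map_zero' := by
        ext x
        obtain ⟨p, q, rfl⟩ := exists_sub x
        simp
      map_add' := fun s t => by
        ext x
        obtain ⟨p, q, rfl⟩ := exists_sub x
        simp [add_mul]
        abel }

instance : Mul (GrothendieckRing S) := ⟨fun x y => mulHom x y⟩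

instance : One (GrothendieckRing S) := ⟨of 1⟩

theorem mul_def (x y : GrothendieckRing S) : x * y = mulHom x y := rfl

@[simp] theorem of_mul_of (s t : S) : of s * of t = of (s * t) := by
  simp [mul_def, mulHom]

theorem one_def : (1 : GrothendieckRing S) = of 1 := rfl

theorem mul_add' (x y z : GrothendieckRing S) : x * (y + z) = x * y + x * z := by
  simp [mul_def]

theorem add_mul' (x y z : GrothendieckRing S) : (x + y) * z = x * z + y * z := by
  simp [mul_def]

theorem mul_sub' (x y z : GrothendieckRing S) : x * (y - z) = x * y - x * z := by
  simp [mul_def]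

theorem sub_mul' (x y z : GrothendieckRing S) : (x - y) * z = x * z - y * z := by
  simp [mul_def]

instance : Ring (GrothendieckRing S) where
  left_distrib := mul_add'
  right_distrib := add_mul'
  zero_mul x := by simp [mul_def]
  mul_zero x := by simp [mul_def]
  one_mul x := by
    obtain ⟨p, q, rfl⟩ := exists_sub x
    simp [one_def, mul_sub']
  mul_one x := by
    obtain ⟨p, q, rfl⟩ := exists_sub x
    simp [one_def, sub_mul']
  mul_assoc x y z := by
    obtain ⟨p, q, rfl⟩ := exists_sub x
    obtain ⟨r, s, rfl⟩ := exists_sub y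
    obtain ⟨t, u, rfl⟩ := exists_sub z
    simp only [mul_sub', sub_mul', of_mul_of, mul_assoc]
  zsmul := (· • ·)
  zsmul_zero' := zero_zsmul
  zsmul_succ' n x := by
    simp [add_zsmul]
  zsmul_neg' n x := by
    simp only [Int.negSucc_eq, neg_smul]; congr 1
  neg_add_cancel := neg_add_cancel

end GrothendieckRing

/-! ### Representations of algebras, bialgebras and Hopf algebras

A left module over a `k`-algebra `A` is given as a `k`-vector space `V` with an algebra
homomorphism `A → End_k(V)`. -/

section Reps

variable {k : Type u} {A : Type v} [Field k] [Ring A]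
variable {U V W V' W' : Type*} [AddCommGroup U] [Module k U] [AddCommGroup V] [Module k V]
  [AddCommGroup W] [Module k W] [AddCommGroup V'] [Module k V'] [AddCommGroup W'] [Module k W']

/-- The direct sum, with `a (v, w) = (a v, a w)`. -/
def directSumRep [Algebra k A] (ρ : A →ₐ[k] Module.End k V) (σ : A →ₐ[k] Module.End k W) :
    A →ₐ[k] Module.End k (V × W) :=
  (LinearMap.prodMapAlgHom k V W).comp (ρ.prod σ)

/-- The zero module. -/
def zeroRep [Algebra k A] [Subsingleton V] : A →ₐ[k] Module.End k V where
  toFun := fun _ => 0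
  map_one' := Subsingleton.elim _ _
  map_mul' := fun _ _ => Subsingleton.elim _ _
  map_zero' := rfl
  map_add' := fun _ _ => Subsingleton.elim _ _
  commutes' := fun _ => Subsingleton.elim _ _

@[simp] theorem directSumRep_apply [Algebra k A] (ρ : A →ₐ[k] Module.End k V)
    (σ : A →ₐ[k] Module.End k W) (a : A) (x : V × W) :
    directSumRep ρ σ a x = (ρ a x.1, σ a x.2) := rfl

section Bialgebra

variable [Bialgebra k A]

/-- The trivial module `k`, on which `A` acts through the counit. -/
def trivialRep (k : Type u) (A : Type v) [Field k] [Ring A] [Bialgebra k A] :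
    A →ₐ[k] Module.End k k :=
  (Algebra.lmul k k).comp (Bialgebra.counitAlgHom k A)

@[simp] theorem trivialRep_apply (a : A) (r : k) :
    trivialRep k A a r = Coalgebra.counit (R := k) a * r := rfl

/-- The action of `A ⊗ A` on `V ⊗ W` by `(a ⊗ b) (v ⊗ w) = a v ⊗ b w`. -/
def tensorAct (ρ : A →ₐ[k] Module.End k V) (σ : A →ₐ[k] Module.End k W) :
    A ⊗[k] A →ₐ[k] Module.End k (V ⊗[k] W) :=
  (Module.endTensorEndAlgHom (R := k) (S := k) (A := k)).comp
    (Algebra.TensorProduct.map ρ σ)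

@[simp] theorem tensorAct_tmul (ρ : A →ₐ[k] Module.End k V) (σ : A →ₐ[k] Module.End k W)
    (a b : A) (v : V) (w : W) : tensorAct ρ σ (a ⊗ₜ b) (v ⊗ₜ w) = ρ a v ⊗ₜ σ b w := rfl

/-- The tensor product `V ⊗ W`, on which `A` acts through the comultiplication. -/
def tensorRep (ρ : A →ₐ[k] Module.End k V) (σ : A →ₐ[k] Module.End k W) :
    A →ₐ[k] Module.End k (V ⊗[k] W) :=
  (tensorAct ρ σ).comp (Bialgebra.comulAlgHom k A)

theorem tensorRep_apply (ρ : A →ₐ[k] Module.End k V) (σ : A →ₐ[k] Module.End k W) (a : A) :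
    tensorRep ρ σ a = tensorAct ρ σ (Coalgebra.comul (R := k) a) := rfl

theorem tensorRep_congr {ρ : A →ₐ[k] Module.End k V} {σ : A →ₐ[k] Module.End k W}
    {ρ' : A →ₐ[k] Module.End k V'} {σ' : A →ₐ[k] Module.End k W'}
    (e : V ≃ₗ[k] V') (he : ∀ a v, e (ρ a v) = ρ' a (e v))
    (f : W ≃ₗ[k] W') (hf : ∀ a v, f (σ a v) = σ' a (f v)) (a : A) (t : V ⊗[k] W) :
    TensorProduct.congr e f (tensorRep ρ σ a t) =
      tensorRep ρ' σ' a (TensorProduct.congr e f t) := by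
  rw [tensorRep_apply, tensorRep_apply]
  generalize (Coalgebra.comul (R := k) a) = x
  induction x with
  | zero => simp
  | add x y hx hy => simp only [map_add, LinearMap.add_apply, hx, hy]
  | tmul a b =>
    induction t with
    | zero => simp
    | add x y hx hy => simp only [map_add, hx, hy]
    | tmul v w => simp [he, hf]

theorem tensorRep_assoc (ρ : A →ₐ[k] Module.End k U) (σ : A →ₐ[k] Module.End k V)
    (τ : A →ₐ[k] Module.End k W) (a : A) (t : (U ⊗[k] V) ⊗[k] W) :
    TensorProduct.assoc k U V W (tensorRep (tensorRep ρ σ) τ a t) =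
      tensorRep ρ (tensorRep σ τ) a (TensorProduct.assoc k U V W t) := by
  let Φ : A ⊗[k] (A ⊗[k] A) →ₐ[k] Module.End k (U ⊗[k] (V ⊗[k] W)) :=
    (Module.endTensorEndAlgHom (R := k) (S := k) (A := k)).comp
      (Algebra.TensorProduct.map ρ (tensorAct σ τ))
  have hΦ (a : A) (y : A ⊗[k] A) (u : U) (s : V ⊗[k] W) :
      Φ (a ⊗ₜ y) (u ⊗ₜ s) = ρ a u ⊗ₜ tensorAct σ τ y s := rfl
  have h1 (x : A ⊗[k] A) (t : (U ⊗[k] V) ⊗[k] W) :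
      TensorProduct.assoc k U V W (tensorAct (tensorRep ρ σ) τ x t) =
        Φ (TensorProduct.assoc k A A A ((Coalgebra.comul (R := k)).rTensor A x))
          (TensorProduct.assoc k U V W t) := by
    induction x with
    | zero => simp
    | add x y hx hy => simp only [map_add, LinearMap.add_apply, hx, hy]
    | tmul a b =>
      induction t with
      | zero => simp
      | add x y hx hy => simp only [map_add, hx, hy]
      | tmul s w =>
        rw [LinearMap.rTensor_tmul, tensorAct_tmul, tensorRep_apply]
        generalize (Coalgebra.comul (R := k) a) = y
        induction y with
        | zero => simp
        | add x y hx hy =>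
          simp only [map_add, LinearMap.add_apply, TensorProduct.add_tmul, hx, hy]
        | tmul c d =>
          induction s with
          | zero => simp
          | add x y hx hy => simp only [map_add, TensorProduct.add_tmul, hx, hy]
          | tmul u v => simp [hΦ]
  have h2 (x : A ⊗[k] A) (t : U ⊗[k] (V ⊗[k] W)) :
      tensorAct ρ (tensorRep σ τ) x t = Φ ((Coalgebra.comul (R := k)).lTensor A x) t := by
    induction x with
    | zero => simp
    | add x y hx hy => simp only [map_add, LinearMap.add_apply, hx, hy]
    | tmul a b =>
      induction t with
      | zero => simp
      | add x y hx hy => simp only [map_add, hx, hy]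
      | tmul u s => simp [hΦ, tensorRep_apply]
  rw [tensorRep_apply, tensorRep_apply, h1, h2, Coalgebra.coassoc_apply]

theorem trivialRep_tensorRep (ρ : A →ₐ[k] Module.End k V) (a : A) (t : k ⊗[k] V) :
    TensorProduct.lid k V (tensorRep (trivialRep k A) ρ a t) =
      ρ a (TensorProduct.lid k V t) := by
  have h (x : A ⊗[k] A) : TensorProduct.lid k V (tensorAct (trivialRep k A) ρ x t) =
      ρ (TensorProduct.lid k A ((Coalgebra.counit (R := k)).rTensor A x))
        (TensorProduct.lid k V t) := by
    induction x with
    | zero => simp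
    | add x y hx hy => simp only [map_add, LinearMap.add_apply, hx, hy]
    | tmul a b =>
      induction t with
      | zero => simp
      | add x y hx hy => simp only [map_add, hx, hy]
      | tmul r v => simp [mul_smul, smul_comm r]
  rw [tensorRep_apply, h]
  simp

theorem tensorRep_trivialRep (ρ : A →ₐ[k] Module.End k V) (a : A) (t : V ⊗[k] k) :
    TensorProduct.rid k V (tensorRep ρ (trivialRep k A) a t) =
      ρ a (TensorProduct.rid k V t) := by
  have h (x : A ⊗[k] A) : TensorProduct.rid k V (tensorAct ρ (trivialRep k A) x t) =
      ρ (TensorProduct.rid k A ((Coalgebra.counit (R := k)).lTensor A x))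
        (TensorProduct.rid k V t) := by
    induction x with
    | zero => simp
    | add x y hx hy => simp only [map_add, LinearMap.add_apply, hx, hy]
    | tmul a b =>
      induction t with
      | zero => simp
      | add x y hx hy => simp only [map_add, hx, hy]
      | tmul v r => simp [mul_smul, smul_comm r]
  rw [tensorRep_apply, h]
  simp

theorem tensorRep_directSumRep (ρ : A →ₐ[k] Module.End k U) (σ : A →ₐ[k] Module.End k V)
    (τ : A →ₐ[k] Module.End k W) (a : A) (t : U ⊗[k] (V × W)) :
    TensorProduct.prodRight k k U V W (tensorRep ρ (directSumRep σ τ) a t) =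
      directSumRep (tensorRep ρ σ) (tensorRep ρ τ) a (TensorProduct.prodRight k k U V W t) := by
  rw [directSumRep_apply, tensorRep_apply, tensorRep_apply, tensorRep_apply]
  generalize (Coalgebra.comul (R := k) a) = x
  induction x with
  | zero => simp [Prod.zero_eq_mk]
  | add x y hx hy => simp [map_add, LinearMap.add_apply, hx, hy]
  | tmul a b =>
    induction t with
    | zero => simp [Prod.zero_eq_mk]
    | add x y hx hy => simp [map_add, hx, hy]
    | tmul u s => simp

theorem directSumRep_tensorRep (ρ : A →ₐ[k] Module.End k U) (σ : A →ₐ[k] Module.End k V)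
    (τ : A →ₐ[k] Module.End k W) (a : A) (t : (U × V) ⊗[k] W) :
    TensorProduct.prodLeft k k U V W (tensorRep (directSumRep ρ σ) τ a t) =
      directSumRep (tensorRep ρ τ) (tensorRep σ τ) a (TensorProduct.prodLeft k k U V W t) := by
  rw [directSumRep_apply, tensorRep_apply, tensorRep_apply, tensorRep_apply]
  generalize (Coalgebra.comul (R := k) a) = x
  induction x with
  | zero => simp [Prod.zero_eq_mk]
  | add x y hx hy => simp [map_add, LinearMap.add_apply, hx, hy]
  | tmul a b =>
    induction t with
    | zero => simp [Prod.zero_eq_mk]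
    | add x y hx hy => simp [map_add, hx, hy]
    | tmul u s => rfl

end Bialgebra

/-- The dual module `V*`, with `(a f)(v) = f (S(a) v)`. -/
def dualRep [HopfAlgebra k A] (ρ : A →ₐ[k] Module.End k V) :
    A →ₐ[k] Module.End k (Module.Dual k V) :=
  AlgHom.ofLinearMap
    { toFun := fun a => (ρ (HopfAlgebra.antipode k a)).dualMap
      map_add' := fun a b => by ext; simp
      map_smul' := fun r a => by ext; simp }
    (by ext; simp)
    (fun a b => by ext; simp [HopfAlgebra.antipode_mul_antidistrib])

@[simp] theorem dualRep_apply [HopfAlgebra k A] (ρ : A →ₐ[k] Module.End k V) (a : A)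
    (f : Module.Dual k V) (v : V) :
    dualRep ρ a f v = f (ρ (HopfAlgebra.antipode k a) v) := rfl

end Reps

/-! ### Finite-dimensional modules -/

/-- A finite-dimensional left module over the `k`-algebra `A`. -/
structure FDModule (k : Type u) (A : Type v) [Field k] [Ring A] [Algebra k A] where
  /-- the underlying vector space -/
  carrier : Type u
  [addCommGroup : AddCommGroup carrier]
  [module : Module k carrier]
  [finite : Module.Finite k carrier]
  /-- the action of `A` -/
  act : A →ₐ[k] Module.End k carrier

namespace FDModule

attribute [instance] addCommGroup module finite

section Algebra

variable {k : Type u} {A : Type v} [Field k] [Ring A] [Algebra k A]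

/-- `V` and `W` are isomorphic as left `A`-modules. -/
def IsIso (V W : FDModule k A) : Prop :=
  ∃ e : V.carrier ≃ₗ[k] W.carrier, ∀ a v, e (V.act a v) = W.act a (e v)

theorem IsIso.refl (V : FDModule k A) : IsIso V V := ⟨LinearEquiv.refl k _, fun _ _ => rfl⟩

theorem IsIso.symm {V W : FDModule k A} : IsIso V W → IsIso W V := by
  rintro ⟨e, he⟩
  exact ⟨e.symm, fun a v => by rw [LinearEquiv.symm_apply_eq, he, LinearEquiv.apply_symm_apply]⟩

theorem IsIso.trans {U V W : FDModule k A} : IsIso U V → IsIso V W → IsIso U W := by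
  rintro ⟨e, he⟩ ⟨f, hf⟩
  exact ⟨e.trans f, fun a v => by simp [he, hf]⟩

instance isoSetoid : Setoid (FDModule k A) := ⟨IsIso, IsIso.refl, IsIso.symm, IsIso.trans⟩

/-- The zero module. -/
abbrev zeroModule (k : Type u) (A : Type v) [Field k] [Ring A] [Algebra k A] : FDModule k A where
  carrier := PUnit.{u + 1}
  act := zeroRep

/-- The direct sum `V ⊕ W`. -/
abbrev directSum (V W : FDModule k A) : FDModule k A where
  carrier := V.carrier × W.carrier
  act := directSumRep V.act W.act

theorem isIso_of_subsingleton (V W : FDModule k A) (_ : Subsingleton V.carrier)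
    (_ : Subsingleton W.carrier) : IsIso V W :=
  ⟨{ toFun := fun _ => 0
     invFun := fun _ => 0
     map_add' := fun _ _ => Subsingleton.elim _ _
     map_smul' := fun _ _ => Subsingleton.elim _ _
     left_inv := fun _ => Subsingleton.elim _ _
     right_inv := fun _ => Subsingleton.elim _ _ }, fun _ _ => Subsingleton.elim _ _⟩

theorem directSum_congr {V V' W W' : FDModule k A} (h₁ : IsIso V V') (h₂ : IsIso W W') :
    IsIso (directSum V W) (directSum V' W') := by
  obtain ⟨e, he⟩ := h₁
  obtain ⟨f, hf⟩ := h₂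
  exact ⟨LinearEquiv.prodCongr e f, fun a v => Prod.ext (he _ _) (hf _ _)⟩

theorem zero_directSum (V : FDModule k A) : IsIso (directSum (zeroModule k A) V) V :=
  ⟨(LinearEquiv.uniqueProd : (PUnit.{u + 1} × V.carrier) ≃ₗ[k] V.carrier), fun _ _ => rfl⟩

theorem directSum_zero (V : FDModule k A) : IsIso (directSum V (zeroModule k A)) V :=
  ⟨(LinearEquiv.prodUnique : (V.carrier × PUnit.{u + 1}) ≃ₗ[k] V.carrier), fun _ _ => rfl⟩

end Algebra

section Bialgebra

variable {k : Type u} {A : Type v} [Field k] [Ring A] [Bialgebra k A]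

/-- The trivial module `k`. -/
abbrev trivialModule (k : Type u) (A : Type v) [Field k] [Ring A] [Bialgebra k A] :
    FDModule k A where
  carrier := k
  act := trivialRep k A

/-- The tensor product `V ⊗ W`. -/
abbrev tensor (V W : FDModule k A) : FDModule k A where
  carrier := V.carrier ⊗[k] W.carrier
  act := tensorRep V.act W.act

theorem tensor_congr {V V' W W' : FDModule k A} (h₁ : IsIso V V') (h₂ : IsIso W W') :
    IsIso (tensor V W) (tensor V' W') := by
  obtain ⟨e, he⟩ := h₁
  obtain ⟨f, hf⟩ := h₂
  exact ⟨TensorProduct.congr e f, tensorRep_congr e he f hf⟩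

theorem zero_tensor (V : FDModule k A) : IsIso (tensor (zeroModule k A) V) (zeroModule k A) :=
  isIso_of_subsingleton _ _
    (inferInstanceAs (Subsingleton (PUnit.{u + 1} ⊗[k] V.carrier)))
    (inferInstanceAs (Subsingleton PUnit.{u + 1}))

theorem tensor_zero (V : FDModule k A) : IsIso (tensor V (zeroModule k A)) (zeroModule k A) :=
  isIso_of_subsingleton _ _
    (inferInstanceAs (Subsingleton (V.carrier ⊗[k] PUnit.{u + 1})))
    (inferInstanceAs (Subsingleton PUnit.{u + 1}))

end Bialgebra

section HopfAlgebra

variable {k : Type u} {A : Type v} [Field k] [Ring A] [HopfAlgebra k A]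

/-- The dual module `V*`. -/
abbrev dual (V : FDModule k A) : FDModule k A where
  carrier := Module.Dual k V.carrier
  act := dualRep V.act

theorem dual_congr {V W : FDModule k A} (h : IsIso V W) : IsIso (dual V) (dual W) := by
  obtain ⟨e, he⟩ := h.symm
  refine ⟨e.dualMap, fun a f => LinearMap.ext fun v => ?_⟩
  change f (V.act (HopfAlgebra.antipode k a) (e v)) = f (e (W.act (HopfAlgebra.antipode k a) v))
  rw [he]

theorem dual_zero : IsIso (dual (zeroModule k A)) (zeroModule k A) :=
  isIso_of_subsingleton _ _
    (inferInstanceAs (Subsingleton (Module.Dual k PUnit.{u + 1})))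
    (inferInstanceAs (Subsingleton PUnit.{u + 1}))

theorem dual_directSum (V W : FDModule k A) :
    IsIso (dual (directSum V W)) (directSum (dual V) (dual W)) :=
  IsIso.symm ⟨Module.dualProdDualEquivDual k V.carrier W.carrier,
    fun _ _ => LinearMap.ext fun _ => rfl⟩

end HopfAlgebra

end FDModule

/-! ### The representation ring -/

/-- Isomorphism classes of finite-dimensional left `A`-modules. -/
def IsoClass (k : Type u) (A : Type v) [Field k] [Ring A] [Algebra k A] : Type (max (u + 1) v) :=
  Quotient (FDModule.isoSetoid (k := k) (A := A))

namespace IsoClass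

open FDModule

/-- The isomorphism class `[V]`. -/
def mk {k : Type u} {A : Type v} [Field k] [Ring A] [Algebra k A] (V : FDModule k A) :
    IsoClass k A :=
  Quotient.mk _ V

section Bialgebra

variable {k : Type u} {A : Type v} [Field k] [Ring A] [Bialgebra k A]

/-- `[V] + [W] = [V ⊕ W]`, `[V] [W] = [V ⊗ W]`, `0 = [0]`, `1 = [k]`. -/
instance : Semiring (IsoClass k A) where
  add := Quotient.map₂ directSum fun _ _ h₁ _ _ h₂ => directSum_congr h₁ h₂
  mul := Quotient.map₂ tensor fun _ _ h₁ _ _ h₂ => tensor_congr h₁ h₂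
  zero := Quotient.mk _ (zeroModule k A)
  one := Quotient.mk _ (trivialModule k A)
  add_assoc := by
    rintro ⟨U⟩ ⟨V⟩ ⟨W⟩
    exact Quotient.sound
      ⟨LinearEquiv.prodAssoc k U.carrier V.carrier W.carrier, fun _ _ => rfl⟩
  zero_add := by
    rintro ⟨V⟩
    exact Quotient.sound (zero_directSum V)
  add_zero := by
    rintro ⟨V⟩
    exact Quotient.sound (directSum_zero V)
  add_comm := by
    rintro ⟨V⟩ ⟨W⟩
    exact Quotient.sound ⟨LinearEquiv.prodComm k V.carrier W.carrier, fun _ _ => rfl⟩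
  left_distrib := by
    rintro ⟨U⟩ ⟨V⟩ ⟨W⟩
    exact Quotient.sound ⟨TensorProduct.prodRight k k U.carrier V.carrier W.carrier,
      tensorRep_directSumRep U.act V.act W.act⟩
  right_distrib := by
    rintro ⟨U⟩ ⟨V⟩ ⟨W⟩
    exact Quotient.sound ⟨TensorProduct.prodLeft k k U.carrier V.carrier W.carrier,
      directSumRep_tensorRep U.act V.act W.act⟩
  zero_mul := by
    rintro ⟨V⟩
    exact Quotient.sound (zero_tensor V)
  mul_zero := by
    rintro ⟨V⟩
    exact Quotient.sound (tensor_zero V)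
  mul_assoc := by
    rintro ⟨U⟩ ⟨V⟩ ⟨W⟩
    exact Quotient.sound ⟨TensorProduct.assoc k U.carrier V.carrier W.carrier,
      tensorRep_assoc U.act V.act W.act⟩
  one_mul := by
    rintro ⟨V⟩
    exact Quotient.sound ⟨TensorProduct.lid k V.carrier, trivialRep_tensorRep V.act⟩
  mul_one := by
    rintro ⟨V⟩
    exact Quotient.sound ⟨TensorProduct.rid k V.carrier, tensorRep_trivialRep V.act⟩
  nsmul := @nsmulRec _ ⟨Quotient.mk _ (zeroModule k A)⟩
    ⟨Quotient.map₂ directSum fun _ _ h₁ _ _ h₂ => directSum_congr h₁ h₂⟩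

end Bialgebra

section HopfAlgebra

variable {k : Type u} {A : Type v} [Field k] [Ring A] [HopfAlgebra k A]

/-- `[V] ↦ [V*]`. -/
def dualHom : IsoClass k A →+ IsoClass k A where
  toFun := Quotient.map dual fun _ _ h => dual_congr h
  map_zero' := Quotient.sound dual_zero
  map_add' := by
    rintro ⟨V⟩ ⟨W⟩
    exact Quotient.sound (dual_directSum V W)

end HopfAlgebra

end IsoClass

/-- The representation ring `Rep(A)`. -/
abbrev RepRing (k : Type u) (A : Type v) [Field k] [Ring A] [Bialgebra k A] :
    Type (max (u + 1) v) :=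
  GrothendieckRing (IsoClass k A)

/-- The `∗`-structure of `Rep(A)`: the additive map with `[V]∗ = [V*]`. -/
def RepRing.star {k : Type u} {A : Type v} [Field k] [Ring A] [HopfAlgebra k A] :
    RepRing k A →+ RepRing k A :=
  GrothendieckRing.lift (GrothendieckRing.of.comp IsoClass.dualHom)

/-! ### The Hopf algebras `A_{Nn}^{+λ}` -/

/-- The alternating product `p q p ⋯` with `m` factors. -/
def altWord {B : Type*} [Monoid B] (p q : B) : ℕ → B
  | 0 => 1
  | m + 1 => p * altWord q p m

/-- The defining relations of `A_{Nn}^{+λ}` for a `2 × 2` family of elements `x i j` (indices are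
in `{0, 1}` instead of `{1, 2}`, and `i - j` is taken in `Fin 2`, that is modulo `2`). -/
structure IsSuzukiFamily {B : Type*} [Ring B] (N n : ℕ) (lam : ℤˣ) (x : Fin 2 → Fin 2 → B) :
    Prop where
  sq_diag : x 0 0 ^ 2 = x 1 1 ^ 2
  sq_off : x 0 1 ^ 2 = x 1 0 ^ 2
  mixed : ∀ i j l m : Fin 2, i - j ≠ l - m → x i j * x l m = 0
  unit : x 0 0 ^ (2 * N) + x 0 1 ^ (2 * N) = 1
  alt_diag : altWord (x 0 0) (x 1 1) n = altWord (x 1 1) (x 0 0) n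
  alt_off : altWord (x 1 0) (x 0 1) n = (lam : ℤ) • altWord (x 0 1) (x 1 0) n

/-- The generators `X i j` of the free algebra. -/
def suzukiX (k : Type u) [Field k] (i j : Fin 2) : FreeAlgebra k (Fin 2 × Fin 2) :=
  FreeAlgebra.ι k (i, j)

/-- The defining relations of `A_{Nn}^{+λ}`, in the free algebra on the `X i j`. -/
inductive SuzukiRel (k : Type u) [Field k] (N n : ℕ) (lam : ℤˣ) :
    FreeAlgebra k (Fin 2 × Fin 2) → FreeAlgebra k (Fin 2 × Fin 2) → Prop
  | sq_diag : SuzukiRel k N n lam (suzukiX k 0 0 ^ 2) (suzukiX k 1 1 ^ 2)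
  | sq_off : SuzukiRel k N n lam (suzukiX k 0 1 ^ 2) (suzukiX k 1 0 ^ 2)
  | mixed (i j l m : Fin 2) (h : i - j ≠ l - m) :
      SuzukiRel k N n lam (suzukiX k i j * suzukiX k l m) 0
  | unit : SuzukiRel k N n lam (suzukiX k 0 0 ^ (2 * N) + suzukiX k 0 1 ^ (2 * N)) 1
  | alt_diag : SuzukiRel k N n lam (altWord (suzukiX k 0 0) (suzukiX k 1 1) n)
      (altWord (suzukiX k 1 1) (suzukiX k 0 0) n)
  | alt_off : SuzukiRel k N n lam (altWord (suzukiX k 1 0) (suzukiX k 0 1) n)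
      ((lam : ℤ) • altWord (suzukiX k 0 1) (suzukiX k 1 0) n)

/-- The algebra `A_{Nn}^{+λ}`, `λ = ±1`. -/
def SuzukiAlgebra (k : Type u) [Field k] (N n : ℕ) (lam : ℤˣ) : Type u :=
  RingQuot (SuzukiRel k N n lam)

theorem map_altWord {B C F : Type*} [Monoid B] [Monoid C] [FunLike F B C] [MonoidHomClass F B C]
    (f : F) (p q : B) (m : ℕ) : f (altWord p q m) = altWord (f p) (f q) m := by
  induction m generalizing p q with
  | zero => simp [altWord]
  | succ m ih => simp [altWord, ih]

namespace SuzukiAlgebra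

variable {k : Type u} [Field k] {N n : ℕ} {lam : ℤˣ}

instance : Ring (SuzukiAlgebra k N n lam) := inferInstanceAs (Ring (RingQuot _))

instance : Algebra k (SuzukiAlgebra k N n lam) := inferInstanceAs (Algebra k (RingQuot _))

/-- The quotient map from the free algebra. -/
def mk : FreeAlgebra k (Fin 2 × Fin 2) →ₐ[k] SuzukiAlgebra k N n lam :=
  RingQuot.mkAlgHom k (SuzukiRel k N n lam)

/-- The generators `x i j` of `A_{Nn}^{+λ}`. -/
def x (i j : Fin 2) : SuzukiAlgebra k N n lam := mk (suzukiX k i j)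

theorem mk_rel {p q : FreeAlgebra k (Fin 2 × Fin 2)} (h : SuzukiRel k N n lam p q) :
    (mk p : SuzukiAlgebra k N n lam) = mk q :=
  RingQuot.mkAlgHom_rel k h

theorem isSuzukiFamily_x :
    IsSuzukiFamily N n lam (x : Fin 2 → Fin 2 → SuzukiAlgebra k N n lam) where
  sq_diag := by simpa [x] using mk_rel (k := k) (N := N) (n := n) (lam := lam) .sq_diag
  sq_off := by simpa [x] using mk_rel (k := k) (N := N) (n := n) (lam := lam) .sq_off
  mixed i j l m h := by
    simpa [x] using mk_rel (k := k) (N := N) (n := n) (lam := lam) (.mixed i j l m h)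
  unit := by simpa [x] using mk_rel (k := k) (N := N) (n := n) (lam := lam) .unit
  alt_diag := by
    simpa [x, map_altWord] using mk_rel (k := k) (N := N) (n := n) (lam := lam) .alt_diag
  alt_off := by
    simpa only [x, map_altWord, map_zsmul] using
      mk_rel (k := k) (N := N) (n := n) (lam := lam) .alt_off

/-- The algebra homomorphism determined by a family that satisfies the relations. -/
def lift {B : Type*} [Ring B] [Algebra k B] (y : Fin 2 → Fin 2 → B)
    (hy : IsSuzukiFamily N n lam y) : SuzukiAlgebra k N n lam →ₐ[k] B :=
  RingQuot.liftAlgHom k ⟨FreeAlgebra.lift k fun p => y p.1 p.2, by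
    intro p q h
    cases h with
    | sq_diag => simpa [suzukiX] using hy.sq_diag
    | sq_off => simpa [suzukiX] using hy.sq_off
    | mixed i j l m h => simpa [suzukiX] using hy.mixed i j l m h
    | unit => simpa [suzukiX] using hy.unit
    | alt_diag => simpa [suzukiX, map_altWord] using hy.alt_diag
    | alt_off => simpa only [suzukiX, map_altWord, map_zsmul, FreeAlgebra.lift_ι_apply]
        using hy.alt_off⟩

@[simp] theorem lift_x {B : Type*} [Ring B] [Algebra k B] (y : Fin 2 → Fin 2 → B)
    (hy : IsSuzukiFamily N n lam y) (i j : Fin 2) : lift (k := k) y hy (x i j) = y i j := by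
  refine (RingQuot.liftAlgHom_mkAlgHom_apply k _ _ _).trans ?_
  simp [suzukiX]

theorem mk_surjective : Function.Surjective (mk : _ → SuzukiAlgebra k N n lam) :=
  RingQuot.mkAlgHom_surjective k _

theorem induction {P : SuzukiAlgebra k N n lam → Prop} (hx : ∀ i j, P (x i j))
    (hr : ∀ r : k, P (algebraMap k _ r)) (hadd : ∀ a b, P a → P b → P (a + b))
    (hmul : ∀ a b, P a → P b → P (a * b)) (a : SuzukiAlgebra k N n lam) : P a := by
  obtain ⟨a, rfl⟩ := mk_surjective a
  induction a using FreeAlgebra.induction with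
  | grade0 r => rw [AlgHom.commutes]; exact hr r
  | grade1 p => exact hx p.1 p.2
  | mul a b ha hb => rw [map_mul]; exact hmul _ _ ha hb
  | add a b ha hb => rw [map_add]; exact hadd _ _ ha hb

theorem algHom_ext {B : Type*} [Semiring B] [Algebra k B] {f g : SuzukiAlgebra k N n lam →ₐ[k] B}
    (h : ∀ i j, f (x i j) = g (x i j)) : f = g := by
  refine AlgHom.ext fun a => ?_
  induction a using induction with
  | hx i j => exact h i j
  | hr r => simp
  | hadd a b ha hb => simp [ha, hb]
  | hmul a b ha hb => simp [ha, hb]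

end SuzukiAlgebra

theorem IsSuzukiFamily.counit {B : Type*} [Ring B] (N n : ℕ) [NeZero N] [NeZero n] (lam : ℤˣ) :
    IsSuzukiFamily N n lam fun i j => if i = j then (1 : B) else 0 where
  sq_diag := by simp
  sq_off := by simp
  mixed i j l m h := by
    by_cases h1 : i = j <;> by_cases h2 : l = m <;> simp_all
  unit := by simp [NeZero.ne N]
  alt_diag := by simp
  alt_off := by
    obtain ⟨m, rfl⟩ := Nat.exists_eq_succ_of_ne_zero (NeZero.ne n)
    simp [altWord]

/-- Products of alternating words that never mix. -/
theorem altWord_tmul_add {k B C : Type*} [Field k] [Ring B] [Algebra k B] [Ring C] [Algebra k C]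
    {p q r s : B} {p' q' r' s' : C} (h1 : p * s = 0) (h2 : r * q = 0) (h3 : q * r = 0)
    (h4 : s * p = 0) (m : ℕ) :
    altWord (p ⊗ₜ[k] p' + r ⊗ₜ[k] r') (q ⊗ₜ[k] q' + s ⊗ₜ[k] s') (m + 1) =
      altWord p q (m + 1) ⊗ₜ[k] altWord p' q' (m + 1) +
        altWord r s (m + 1) ⊗ₜ[k] altWord r' s' (m + 1) := by
  induction m generalizing p q r s p' q' r' s' with
  | zero => simp [altWord]
  | succ m ih =>
    rw [altWord, ih h3 h4 h1 h2]
    have e1 : p * altWord s r (m + 1) = 0 := by rw [altWord, ← mul_assoc, h1, zero_mul]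
    have e2 : r * altWord q p (m + 1) = 0 := by rw [altWord, ← mul_assoc, h2, zero_mul]
    rw [altWord.eq_2 p q (m + 1), altWord.eq_2 r s (m + 1), altWord.eq_2 p' q' (m + 1),
      altWord.eq_2 r' s' (m + 1)]
    simp [add_mul, mul_add, e1, e2]

theorem altWord_self {B : Type*} [Monoid B] (p : B) (m : ℕ) : altWord p p m = p ^ m := by
  induction m with
  | zero => simp [altWord]
  | succ m ih => rw [altWord, ih, pow_succ']

namespace IsSuzukiFamily

variable {B : Type*} [Ring B] {N n : ℕ} {lam : ℤˣ} {x : Fin 2 → Fin 2 → B}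

theorem pow_x11 (hx : IsSuzukiFamily N n lam x) (m : ℕ) : x 1 1 ^ (2 * m) = x 0 0 ^ (2 * m) := by
  rw [pow_mul, pow_mul, hx.sq_diag]

theorem pow_x10 (hx : IsSuzukiFamily N n lam x) (m : ℕ) : x 1 0 ^ (2 * m) = x 0 1 ^ (2 * m) := by
  rw [pow_mul, pow_mul, hx.sq_off]

theorem lam_smul_lam_smul (lam : ℤˣ) (b : B) : (lam : ℤ) • (lam : ℤ) • b = b := by
  rw [smul_smul]
  rcases Int.units_eq_one_or lam with rfl | rfl <;> simp

theorem comul {k C : Type*} [Field k] [Algebra k B] [Ring C] [Algebra k C] [NeZero N] [NeZero n]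
    (hx : IsSuzukiFamily N n lam x)
    {y : Fin 2 → Fin 2 → C} (hy : IsSuzukiFamily N n lam y) :
    IsSuzukiFamily N n lam fun i j => x i 0 ⊗ₜ[k] y 0 j + x i 1 ⊗ₜ[k] y 1 j := by
  obtain ⟨m, rfl⟩ := Nat.exists_eq_succ_of_ne_zero (NeZero.ne n)
  have e (i : Fin 2) : x i 0 * x i 1 = 0 := hx.mixed _ _ _ _ (by revert i; decide)
  have e' (i : Fin 2) : x i 1 * x i 0 = 0 := hx.mixed _ _ _ _ (by revert i; decide)
  have e2 (i : Fin 2) : x i 0 * x (1 - i) 0 = 0 := hx.mixed _ _ _ _ (by revert i; decide)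
  have e2' (i : Fin 2) : x i 1 * x (1 - i) 1 = 0 := hx.mixed _ _ _ _ (by revert i; decide)
  refine ⟨?_, ?_, ?_, ?_, ?_, ?_⟩
  · have h (i j : Fin 2) : (x i 0 ⊗ₜ[k] y 0 j + x i 1 ⊗ₜ[k] y 1 j) ^ 2 =
        (x i 0 ^ 2) ⊗ₜ[k] (y 0 j ^ 2) + (x i 1 ^ 2) ⊗ₜ[k] (y 1 j ^ 2) := by
      simp only [sq, add_mul, mul_add, Algebra.TensorProduct.tmul_mul_tmul, e, e',
        TensorProduct.zero_tmul, add_zero, zero_add]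
    simp only [h, hx.sq_diag, hx.sq_off, hy.sq_diag, hy.sq_off]
    rw [add_comm]
  · have h (i j : Fin 2) : (x i 0 ⊗ₜ[k] y 0 j + x i 1 ⊗ₜ[k] y 1 j) ^ 2 =
        (x i 0 ^ 2) ⊗ₜ[k] (y 0 j ^ 2) + (x i 1 ^ 2) ⊗ₜ[k] (y 1 j ^ 2) := by
      simp only [sq, add_mul, mul_add, Algebra.TensorProduct.tmul_mul_tmul, e, e',
        TensorProduct.zero_tmul, add_zero, zero_add]
    simp only [h, hx.sq_diag, hx.sq_off, hy.sq_diag, hy.sq_off]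
    rw [add_comm]
  · intro i j l m' h
    simp only [add_mul, mul_add, Algebra.TensorProduct.tmul_mul_tmul]
    have key (s t : Fin 2) : (x i s * x l t) ⊗ₜ[k] (y s j * y t m') = 0 := by
      by_cases h1 : i - s = l - t
      · rw [hy.mixed s j t m' ?_, TensorProduct.tmul_zero]
        intro h2
        apply h
        rw [show i - j = (i - s) + (s - j) by abel, h1, h2]
        abel
      · rw [hx.mixed _ _ _ _ h1, TensorProduct.zero_tmul]
    simp [key]
  · obtain ⟨M, hM⟩ : ∃ M, 2 * N = M + 1 := 
      Nat.exists_eq_succ_of_ne_zero (by have := NeZero.ne N; omega)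
    have h (j : Fin 2) : (x 0 0 ⊗ₜ[k] y 0 j + x 0 1 ⊗ₜ[k] y 1 j) ^ (2 * N) =
        (x 0 0 ^ (2 * N)) ⊗ₜ[k] (y 0 j ^ (2 * N)) + (x 0 1 ^ (2 * N)) ⊗ₜ[k] (y 1 j ^ (2 * N)) := by
      rw [hM, ← altWord_self, altWord_tmul_add (e 0) (e' 0) (e 0) (e' 0)]
      simp only [altWord_self]
    rw [h, h, hy.pow_x11, hy.pow_x10, add_add_add_comm, ← TensorProduct.tmul_add,
      ← TensorProduct.tmul_add, hy.unit, add_comm (y 0 1 ^ (2 * N)), hy.unit,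
      ← TensorProduct.add_tmul, hx.unit, Algebra.TensorProduct.one_def]
  · have a1 : x 0 0 * x 1 0 = 0 := e2 0
    have a2 : x 1 0 * x 0 0 = 0 := e2 1
    have a3 : x 0 1 * x 1 1 = 0 := e2' 0
    have a4 : x 1 1 * x 0 1 = 0 := e2' 1
    have hx1 := hx.alt_diag
    have hx2 := hx.alt_off
    have hy1 := hy.alt_diag
    have hy2 := hy.alt_off
    rw [add_comm (x 1 0 ⊗ₜ[k] y 0 1), altWord_tmul_add a1 a3 a4 a2, altWord_tmul_add a4 a2 a1 a3,
      hx1, hx2, hy1, hy2, TensorProduct.smul_tmul]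
  · have a1 : x 0 0 * x 1 0 = 0 := e2 0
    have a2 : x 1 0 * x 0 0 = 0 := e2 1
    have a3 : x 0 1 * x 1 1 = 0 := e2' 0
    have a4 : x 1 1 * x 0 1 = 0 := e2' 1
    have hx1 := hx.alt_diag
    have hx2 := hx.alt_off
    have hy1 := hy.alt_diag
    have hy2 := hy.alt_off
    rw [add_comm (x 0 0 ⊗ₜ[k] y 0 1), altWord_tmul_add a2 a4 a3 a1, altWord_tmul_add a3 a1 a2 a4,
      hx1, hx2, hy1, hy2, smul_add, TensorProduct.smul_tmul', TensorProduct.smul_tmul',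
      ← TensorProduct.smul_tmul, add_comm]

theorem _root_.altWord_snoc {B : Type*} [Monoid B] (p q : B) (m : ℕ) :
    altWord p q (m + 1) = altWord p q m * (if Even m then p else q) := by
  induction m generalizing p q with
  | zero => simp [altWord]
  | succ m ih =>
    rw [altWord, ih, altWord, mul_assoc]
    by_cases h : Even m <;> simp [h, Nat.even_add_one]

theorem _root_.altWord_op {B : Type*} [Monoid B] (p q : B) (m : ℕ) :
    altWord (MulOpposite.op p) (MulOpposite.op q) m =
      MulOpposite.op (if Even m then altWord q p m else altWord p q m) := by
  induction m generalizing p q with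
  | zero => simp [altWord]
  | succ m ih =>
    rw [altWord, ih, ← MulOpposite.op_mul]
    by_cases h : Even m
    · rw [if_pos h, if_neg (by simpa [Nat.even_add_one] using h), altWord_snoc, if_pos h]
    · rw [if_neg h, if_pos (by simpa [Nat.even_add_one] using h), altWord_snoc, if_neg h]

theorem _root_.altWord_pow_odd {B : Type*} [Monoid B] (p q : B) (h : p ^ 2 = q ^ 2) (M m : ℕ) :
    altWord (p ^ (2 * M + 1)) (q ^ (2 * M + 1)) m = altWord p q m * (p ^ 2) ^ (M * m) := by
  induction m generalizing p q with
  | zero => simp [altWord]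
  | succ m ih =>
    have hc (r s : B) (h : r ^ 2 = s ^ 2) (m : ℕ) : Commute (r ^ 2) (altWord r s m) := by
      induction m generalizing r s with
      | zero => exact Commute.one_right _
      | succ m ih' =>
        refine (Commute.pow_self r 2).mul_right ?_
        rw [h]
        exact ih' s r h.symm
    rw [altWord, ih q p h.symm, altWord, ← h, pow_succ', pow_mul, Nat.mul_succ, pow_add, mul_assoc,
      mul_assoc]
    congr 1
    rw [← mul_assoc, h, ((hc q p h.symm m).pow_left M).eq, mul_assoc, ← pow_add, ← pow_add,
      add_comm M]

theorem antipode [NeZero N] (hx : IsSuzukiFamily N n lam x) :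
    IsSuzukiFamily N n lam fun i j => MulOpposite.op (x j i ^ (2 * N - 1)) := by
  obtain ⟨M, rfl⟩ := Nat.exists_eq_succ_of_ne_zero (NeZero.ne N)
  have hM : 2 * M.succ - 1 = 2 * M + 1 := by omega
  rw [hM]
  refine ⟨?_, ?_, ?_, ?_, ?_, ?_⟩
  · simp only [← MulOpposite.op_pow, ← pow_mul, mul_comm (2 * M + 1) 2]
    rw [pow_mul, hx.sq_diag, ← pow_mul]
  · simp only [← MulOpposite.op_pow, ← pow_mul, mul_comm (2 * M + 1) 2]
    rw [pow_mul, ← hx.sq_off, ← pow_mul]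
  · intro i j l m h
    have h0 : x m l * x j i = 0 := hx.mixed _ _ _ _ (by revert i j l m; decide)
    rw [← MulOpposite.op_mul, pow_succ, pow_succ', mul_assoc, ← mul_assoc (x m l), h0]
    simp
  · simp only [← MulOpposite.op_pow, ← MulOpposite.op_add]
    rw [← MulOpposite.op_one]
    congr 1
    rw [← pow_mul, ← pow_mul, mul_comm (2 * M + 1), pow_mul, pow_mul (x 1 0),
      hx.pow_x10]
    have hid (p q : B) (hpq : p + q = 1) (h0 : p * q = 0) (m : ℕ) : p ^ (m + 1) = p := by
      induction m with
      | zero => simp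
      | succ m ih =>
        rw [pow_succ, ih]
        calc p * p = p * (p + q) := by rw [mul_add, h0, add_zero]
          _ = p := by rw [hpq, mul_one]
    have h01 : x 0 0 ^ (2 * M.succ) * x 0 1 ^ (2 * M.succ) = 0 := by
      rw [show 2 * M.succ = 2 * M + 1 + 1 by omega, pow_succ, pow_succ' (x 0 1), mul_assoc,
        ← mul_assoc (x 0 0), hx.mixed 0 0 0 1 (by decide)]
      simp
    have h10 : x 0 1 ^ (2 * M.succ) * x 0 0 ^ (2 * M.succ) = 0 := by
      rw [show 2 * M.succ = 2 * M + 1 + 1 by omega, pow_succ, pow_succ' (x 0 0), mul_assoc,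
        ← mul_assoc (x 0 1), hx.mixed 0 1 0 0 (by decide)]
      simp
    rw [hid _ _ hx.unit h01, hid _ _ ((add_comm _ _).trans hx.unit) h10, hx.unit]
  · simp only [MulOpposite.op_pow]
    rw [altWord_pow_odd _ _ (by simp [← MulOpposite.op_pow, hx.sq_diag]),
      altWord_pow_odd _ _ (by simp [← MulOpposite.op_pow, hx.sq_diag]), altWord_op, altWord_op,
      hx.alt_diag, ← MulOpposite.op_pow (x 0 0) 2, ← MulOpposite.op_pow (x 1 1) 2, hx.sq_diag]
  · simp only [MulOpposite.op_pow]
    rw [altWord_pow_odd _ _ (by simp [← MulOpposite.op_pow, hx.sq_off]),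
      altWord_pow_odd _ _ (by simp [← MulOpposite.op_pow, hx.sq_off]), altWord_op, altWord_op,
      ← MulOpposite.op_pow, ← MulOpposite.op_pow, hx.sq_off, ← smul_mul_assoc,
      ← MulOpposite.op_smul]
    congr 2
    by_cases h : Even n
    · rw [if_pos h, if_pos h, hx.alt_off]
    · rw [if_neg h, if_neg h, hx.alt_off, lam_smul_lam_smul]

end IsSuzukiFamily

namespace SuzukiAlgebra

variable {k : Type u} [Field k] {N n : ℕ} [NeZero N] [NeZero n] {lam : ℤˣ}

/-- `Δ(x_{ij}) = x_{i1} ⊗ x_{1j} + x_{i2} ⊗ x_{2j}`. -/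
def comulHom : SuzukiAlgebra k N n lam →ₐ[k]
    SuzukiAlgebra k N n lam ⊗[k] SuzukiAlgebra k N n lam :=
  lift (fun i j => x i 0 ⊗ₜ[k] x 0 j + x i 1 ⊗ₜ[k] x 1 j) (isSuzukiFamily_x.comul isSuzukiFamily_x)

/-- `ε(x_{ij}) = δ_{ij}`. -/
def counitHom : SuzukiAlgebra k N n lam →ₐ[k] k :=
  lift (fun i j => if i = j then 1 else 0) (IsSuzukiFamily.counit N n lam)

/-- The anti-homomorphism with `S(x_{ij}) = x_{ji}^{2N-1}`. -/
def antipodeHom : SuzukiAlgebra k N n lam →ₐ[k] (SuzukiAlgebra k N n lam)ᵐᵒᵖ :=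
  lift (fun i j => MulOpposite.op (x j i ^ (2 * N - 1))) isSuzukiFamily_x.antipode

theorem comulHom_x (i j : Fin 2) : comulHom (k := k) (N := N) (n := n) (lam := lam) (x i j) =
    x i 0 ⊗ₜ[k] x 0 j + x i 1 ⊗ₜ[k] x 1 j := lift_x _ _ _ _

theorem counitHom_x (i j : Fin 2) : counitHom (k := k) (N := N) (n := n) (lam := lam) (x i j) =
    if i = j then 1 else 0 := lift_x _ _ _ _

theorem antipodeHom_x (i j : Fin 2) :
    antipodeHom (k := k) (N := N) (n := n) (lam := lam) (x i j) =
      MulOpposite.op (x j i ^ (2 * N - 1)) := lift_x _ _ _ _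

instance : Bialgebra k (SuzukiAlgebra k N n lam) :=
  Bialgebra.ofAlgHom comulHom counitHom
    (by
      refine algHom_ext fun i j => ?_
      simp [comulHom_x, TensorProduct.add_tmul, TensorProduct.tmul_add]
      abel)
    (by
      refine algHom_ext fun i j => ?_
      fin_cases i <;> simp [comulHom_x, counitHom_x])
    (by
      refine algHom_ext fun i j => ?_
      fin_cases j <;> simp [comulHom_x, counitHom_x])

theorem comul_eq (a : SuzukiAlgebra k N n lam) : Coalgebra.comul (R := k) a = comulHom a := rfl

theorem counit_eq (a : SuzukiAlgebra k N n lam) : Coalgebra.counit (R := k) a = counitHom a := rfl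

/-- The antipode as a linear map. -/
def antipodeLin : SuzukiAlgebra k N n lam →ₗ[k] SuzukiAlgebra k N n lam :=
  (MulOpposite.opLinearEquiv k).symm.toLinearMap ∘ₗ antipodeHom.toLinearMap

theorem antipodeLin_x (i j : Fin 2) :
    antipodeLin (k := k) (N := N) (n := n) (lam := lam) (x i j) = x j i ^ (2 * N - 1) := by
  simp [antipodeLin, antipodeHom_x]

theorem antipodeLin_mul (a b : SuzukiAlgebra k N n lam) :
    antipodeLin (k := k) (a * b) = antipodeLin (k := k) b * antipodeLin (k := k) a := by
  simp [antipodeLin]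

theorem antipodeLin_algebraMap (r : k) :
    antipodeLin (k := k) (N := N) (n := n) (lam := lam) (algebraMap k _ r) =
      algebraMap k _ r := by
  simp [antipodeLin]

theorem antipode_left_mul (t s : SuzukiAlgebra k N n lam ⊗[k] SuzukiAlgebra k N n lam) (r : k)
    (ht : LinearMap.mul' k _ (antipodeLin.rTensor _ t) = algebraMap k _ r) :
    LinearMap.mul' k _ (antipodeLin.rTensor _ (t * s)) =
      algebraMap k _ r * LinearMap.mul' k _ (antipodeLin.rTensor _ s) := by
  induction s with
  | zero => simp
  | add s s' h h' => simp only [mul_add, map_add, h, h']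
  | tmul b c =>
    have h : LinearMap.mul' k _ (antipodeLin.rTensor _ (t * b ⊗ₜ[k] c)) =
        antipodeLin (k := k) b * LinearMap.mul' k _ (antipodeLin.rTensor _ t) * c := by
      clear ht
      induction t with
      | zero => simp
      | add s s' h h' => simp only [add_mul, mul_add, map_add, h, h']
      | tmul p q => simp [antipodeLin_mul, mul_assoc]
    rw [h, ht, ← Algebra.commutes]
    simp [mul_assoc]

theorem antipode_right_mul (t s : SuzukiAlgebra k N n lam ⊗[k] SuzukiAlgebra k N n lam) (r : k)
    (hs : LinearMap.mul' k _ (antipodeLin.lTensor _ s) = algebraMap k _ r) :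
    LinearMap.mul' k _ (antipodeLin.lTensor _ (t * s)) =
      LinearMap.mul' k _ (antipodeLin.lTensor _ t) * algebraMap k _ r := by
  induction t with
  | zero => simp
  | add s s' h h' => simp only [add_mul, map_add, h, h']
  | tmul b c =>
    have h : LinearMap.mul' k _ (antipodeLin.lTensor _ (b ⊗ₜ[k] c * s)) =
        b * LinearMap.mul' k _ (antipodeLin.lTensor _ s) * antipodeLin (k := k) c := by
      clear hs
      induction s with
      | zero => simp
      | add s s' h h' => simp only [add_mul, mul_add, map_add, h, h']
      | tmul p q => simp [antipodeLin_mul, mul_assoc]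
    rw [h, hs, mul_assoc, Algebra.commutes]
    simp [mul_assoc]

theorem antipode_left (a : SuzukiAlgebra k N n lam) :
    LinearMap.mul' k _ (antipodeLin.rTensor _ (comulHom a)) =
      algebraMap k _ (counitHom a) := by
  induction a using induction with
  | hx i j =>
    have hx := isSuzukiFamily_x (k := k) (N := N) (n := n) (lam := lam)
    obtain ⟨M, hM⟩ : ∃ M, 2 * N = M + 1 + 1 := ⟨2 * N - 2, by have := NeZero.ne N; omega⟩
    have h1 := hx.unit
    have h2 := hx.pow_x10 N
    have h3 := hx.pow_x11 N
    have h4 := hx.mixed 0 0 0 1 (by decide)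
    have h5 := hx.mixed 1 0 1 1 (by decide)
    have h6 := hx.mixed 0 1 0 0 (by decide)
    have h7 := hx.mixed 1 1 1 0 (by decide)
    rw [hM] at h1 h2 h3
    fin_cases i <;> fin_cases j <;>
      simp [comulHom_x, counitHom_x, antipodeLin_x, hM, ← pow_succ]
    · rw [h2, h1]
    · simp [pow_succ, mul_assoc, h4, h5]
    · simp [pow_succ, mul_assoc, h6, h7]
    · rw [h3, add_comm, h1]
  | hr r =>
    simp [Algebra.TensorProduct.algebraMap_apply, antipodeLin_algebraMap]
  | hadd a b ha hb => simp only [map_add, ha, hb]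
  | hmul a b ha hb => rw [map_mul, antipode_left_mul _ _ _ ha, hb, map_mul, map_mul]

theorem antipode_right (a : SuzukiAlgebra k N n lam) :
    LinearMap.mul' k _ (antipodeLin.lTensor _ (comulHom a)) =
      algebraMap k _ (counitHom a) := by
  induction a using induction with
  | hx i j =>
    have hx := isSuzukiFamily_x (k := k) (N := N) (n := n) (lam := lam)
    obtain ⟨M, hM⟩ : ∃ M, 2 * N = M + 1 + 1 := ⟨2 * N - 2, by have := NeZero.ne N; omega⟩
    have h1 := hx.unit
    have h2 := hx.pow_x10 N
    have h3 := hx.pow_x11 N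
    have h4 := hx.mixed 0 0 1 0 (by decide)
    have h5 := hx.mixed 0 1 1 1 (by decide)
    have h6 := hx.mixed 1 0 0 0 (by decide)
    have h7 := hx.mixed 1 1 0 1 (by decide)
    rw [hM] at h1 h2 h3
    fin_cases i <;> fin_cases j <;>
      simp [comulHom_x, counitHom_x, antipodeLin_x, hM, ← pow_succ']
    · rw [h1]
    · simp [pow_succ', ← mul_assoc, h4, h5]
    · simp [pow_succ', ← mul_assoc, h6, h7]
    · rw [h2, h3, add_comm, h1]
  | hr r =>
    have h1 : antipodeLin (k := k) (N := N) (n := n) (lam := lam) 1 = 1 := by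
      simpa using antipodeLin_algebraMap (k := k) (N := N) (n := n) (lam := lam) 1
    simp [Algebra.TensorProduct.algebraMap_apply, h1]
  | hadd a b ha hb => simp only [map_add, ha, hb]
  | hmul a b ha hb => rw [map_mul, antipode_right_mul _ _ _ hb, ha, map_mul, map_mul]

instance : HopfAlgebra k (SuzukiAlgebra k N n lam) where
  antipode := antipodeLin
  mul_antipode_rTensor_comul := LinearMap.ext antipode_left
  mul_antipode_lTensor_comul := LinearMap.ext antipode_right

end SuzukiAlgebra

/-- The Hopf algebra `A_{Nn}`: `A_{Nn}^{++}` if `n` is odd and `A_{Nn}^{+-}` if `n` is even. -/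
abbrev ANn (k : Type u) [Field k] (N n : ℕ) : Type u :=
  SuzukiAlgebra k N n (if Odd n then 1 else -1)

/-! ### The group `G_{Nn}` -/

/-- The names of the generators of `G_{Nn}`. -/
inductive GNnGen
  | h | t | w

/-- The relators of `G_{Nn} = ⟨h, t, w | t² = h^{2N} = 1, wⁿ = h^N, tw = w⁻¹t, ht = th, hw = wh⟩`. -/
def gNnRels (N n : ℕ) : Set (FreeGroup GNnGen) :=
  let h := FreeGroup.of GNnGen.h
  let t := FreeGroup.of GNnGen.t
  let w := FreeGroup.of GNnGen.w
  {t ^ 2, h ^ (2 * N), w ^ n * (h ^ N)⁻¹, t * w * (w⁻¹ * t)⁻¹, h * t * (t * h)⁻¹,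
    h * w * (w * h)⁻¹}

/-- The group `G_{Nn}`. -/
abbrev GNn (N n : ℕ) : Type := PresentedGroup (gNnRels N n)

/-! ### The rings given by generators and relations -/

/-- Given `a`, `b` and `x_1, …, x_{n-1}`, the elements `x_m` for `0 ≤ m ≤ 2n - 1` under the rules
`x_0 = 1 + a`, `x_n = b (1 + a)`, `x_{n+i} = x_{n-i}`. -/
def extendX {B : Type*} [CommRing B] (n : ℕ) (a b : B) (x : ℕ → B) (m : ℕ) : B :=
  if m = 0 then 1 + a else if m < n then x m else if m = n then b * (1 + a) else x (2 * n - m)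

/-- The generators `a, b, c, x_1, …, x_{n-1}`. -/
inductive EvenGen (n : ℕ)
  | a | b | c
  | x (i : ℕ) (h₁ : 1 ≤ i) (h₂ : i < n)

namespace EvenGen

open MvPolynomial

/-- The variable `x_i` for `1 ≤ i ≤ n - 1` (and `0` for other `i`, which do not occur). -/
def varX (n i : ℕ) : MvPolynomial (EvenGen n) ℤ :=
  if h : 1 ≤ i ∧ i < n then X (.x i h.1 h.2) else 0

/-- The defining relations. The exponent `(1 - (-1)^{ij}) / 2` is `ij mod 2`. -/
inductive Rel (N n : ℕ) : MvPolynomial (EvenGen n) ℤ → MvPolynomial (EvenGen n) ℤ → Prop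
  | a_sq : Rel N n (X a ^ 2) 1
  | b_sq : Rel N n (X b ^ 2) 1
  | c_pow : Rel N n (X c ^ N) 1
  | a_mul (i : ℕ) (h₁ : 1 ≤ i) (h₂ : i < n) : Rel N n (X a * varX n i) (varX n i)
  | b_mul (i : ℕ) (h₁ : 1 ≤ i) (h₂ : i < n) : Rel N n (X b * varX n i) (varX n (n - i))
  | x_mul (i j : ℕ) (h₁ : 1 ≤ i) (h₂ : i < n) (h₃ : 1 ≤ j) (h₄ : j < n) :
      Rel N n (varX n i * varX n j)
        (X c ^ (i * j % 2) * (extendX n (X a) (X b) (varX n) ((i : ℤ) - j).natAbs +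
          extendX n (X a) (X b) (varX n) (i + j)))

end EvenGen

/-- The commutative ring presented by `a, b, c, x_1, …, x_{n-1}` (for even `n`). -/
abbrev EvenRing (N n : ℕ) : Type := RingQuot (EvenGen.Rel N n)

namespace EvenRing

variable {N n : ℕ}

/-- The class of a polynomial in the generators. -/
def mk : MvPolynomial (EvenGen n) ℤ →+* EvenRing N n := RingQuot.mkRingHom _

/-- The generator `a`. -/
def a : EvenRing N n := mk (.X .a)

/-- The generator `b`. -/
def b : EvenRing N n := mk (.X .b)

/-- The generator `c`, which is a unit since `c^N = 1`. -/
def c [NeZero N] : (EvenRing N n)ˣ :=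
  Units.ofPowEqOne (mk (.X .c)) N
    (by simpa using! RingQuot.mkRingHom_rel (EvenGen.Rel.c_pow (N := N) (n := n))) (NeZero.ne N)

/-- The generators `x_i`. -/
def x (i : ℕ) : EvenRing N n := mk (EvenGen.varX n i)

end EvenRing

/-- The generators `a, b, x_1, …, x_{n-1}`. -/
inductive OddGen (n : ℕ)
  | a | b
  | x (i : ℕ) (h₁ : 1 ≤ i) (h₂ : i < n)

namespace OddGen

open MvPolynomial

/-- The variable `x_i` for `1 ≤ i ≤ n - 1` (and `0` for other `i`, which do not occur). -/
def varX (n i : ℕ) : MvPolynomial (OddGen n) ℤ :=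
  if h : 1 ≤ i ∧ i < n then X (.x i h.1 h.2) else 0

/-- The defining relations. The exponent `1 - (-1)^{ij}` is `2 (ij mod 2)`. -/
inductive Rel (N n : ℕ) : MvPolynomial (OddGen n) ℤ → MvPolynomial (OddGen n) ℤ → Prop
  | a_sq : Rel N n (X a ^ 2) 1
  | b_pow : Rel N n (X b ^ (2 * N)) 1
  | a_mul (i : ℕ) (h₁ : 1 ≤ i) (h₂ : i < n) : Rel N n (X a * varX n i) (varX n i)
  | b_mul (i : ℕ) (h₁ : 1 ≤ i) (h₂ : i < n) (h₃ : Even i) :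
      Rel N n (X b * varX n i) (varX n (n - i))
  | x_mul (i j : ℕ) (h₁ : 1 ≤ i) (h₂ : i < n) (h₃ : 1 ≤ j) (h₄ : j < n) :
      Rel N n (varX n i * varX n j)
        (X b ^ (2 * (i * j % 2)) * (extendX n (X a) (X b) (varX n) ((i : ℤ) - j).natAbs +
          extendX n (X a) (X b) (varX n) (i + j)))

end OddGen

/-- The commutative ring presented by `a, b, x_1, …, x_{n-1}` (for odd `n`). -/
abbrev OddRing (N n : ℕ) : Type := RingQuot (OddGen.Rel N n)

namespace OddRing

variable {N n : ℕ}

/-- The class of a polynomial in the generators. -/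
def mk : MvPolynomial (OddGen n) ℤ →+* OddRing N n := RingQuot.mkRingHom _

/-- The generator `a`. -/
def a : OddRing N n := mk (.X .a)

/-- The generator `b`, which is a unit since `b^{2N} = 1`. -/
def b [NeZero N] : (OddRing N n)ˣ :=
  Units.ofPowEqOne (mk (.X .b)) (2 * N)
    (by simpa using! RingQuot.mkRingHom_rel (OddGen.Rel.b_pow (N := N) (n := n)))
    (mul_ne_zero two_ne_zero (NeZero.ne N))

/-- The generators `x_i`. -/
def x (i : ℕ) : OddRing N n := mk (OddGen.varX n i)

end OddRing

end

/-! As algebras, A_{Nn} and k[G_{Nn}] have the same presentation: a central element h, an involution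
t and an element w with h^{2N} = 1, wⁿ = h^N and wtw = t (`DihedralPresentation`). Inside A_{Nn} put
p = x₁₁ + x₁₂, q = x₂₂ + x₂₁ and g = x₁₁^{2N} − x₁₂^{2N}. Then p² = q², g is a central involution,
and since λ = (−1)^{n+1} the alternating relations amount to (qp⁻¹)ⁿ = g^{n+1}. As N is odd, h =
gp^{N+1}, t = p^N, w = gⁿqp⁻¹ satisfy the dihedral relations (`IsSuzukiFamily.exists_units`,
`isDihedralTriple_of_sq_eq_sq`). Conversely, a dihedral triple gives back the x_{ij} by cutting p
and q with the idempotents (1 ± h^N)/2 (`IsDihedralTriple.isSuzukiFamily`).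

The roots of unity in k diagonalise h and w simultaneously. Every module is therefore a direct sum
of 4N characters and N(n − 1) planes on which t exchanges the eigenlines of w, and their classes
form a ℤ-basis of the representation ring (`DihedralPresentation.exists_basis`).

The comultiplication and the antipode enter only through the products and duals of these modules.
For the group they are read off from eigenvectors (`GNn.fusionRules`). For A_{Nn} they follow from
the action of the x_{ij} (`ANn.fusionRules`), of which only one per row is nonzero on a given
irreducible module. The outcome is the same list for both (`FusionRules`): a cyclic group generated
by c with c^N = 1, signs a and b, and classes X_i with i ∈ ℤ such that X_iX_j = X_{i+j} + X_{i−j},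
X_{−i} = X_i and bX_i = X_{i+n} (`DihedralFusionRing`).

The powers of c or b in the relations of the theorem come from a rescaling. Since N is odd, c has a
square root u, and x_i = u^{i mod 2}X_i together with bu^{n mod 2} satisfy the stated relations. The
presented ring therefore maps onto the representation ring. Its relations show that it is additively
generated by N(n + 3) monomials, which is the rank of the target, so the map is bijective
(`DihedralFusionRing.exists_ringEquiv`). The star inverts c, and u⁻¹ = uc⁻¹ produces the powers in
the stated ∗-structure. -/

noncomputable section

/-! ### Homomorphisms between finite-dimensional modules -/

namespace FDModule

section Algebra

variable {k : Type u} {A : Type v} [Field k] [Ring A] [Algebra k A]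

/-- The space of module homomorphisms `L → M`. -/
def homs (L M : FDModule k A) : Submodule k (L.carrier →ₗ[k] M.carrier) where
  carrier := {f | ∀ a v, f (L.act a v) = M.act a (f v)}
  add_mem' {f g} hf hg a v := by simp [hf a v, hg a v]
  zero_mem' a v := by simp
  smul_mem' r f hf a v := by simp [hf a v]

/-- A linear map that commutes with generators of `A` commutes with all of `A`. -/
theorem mem_homs_of_adjoin {L M : FDModule k A} {f : L.carrier →ₗ[k] M.carrier} {S : Set A}
    (hS : Algebra.adjoin k S = ⊤) (h : ∀ a ∈ S, ∀ v, f (L.act a v) = M.act a (f v)) :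
    f ∈ homs L M := by
  intro a
  have ha : a ∈ Algebra.adjoin k S := hS ▸ Algebra.mem_top
  induction ha using Algebra.adjoin_induction with
  | mem a ha => exact h a ha
  | algebraMap r => intro v; simp [Module.algebraMap_end_apply]
  | add a b _ _ ha hb => intro v; simp [ha, hb]
  | mul a b _ _ ha hb => intro v; simp [ha, hb]

theorem isIso_of_bijective {L M : FDModule k A} {f : L.carrier →ₗ[k] M.carrier}
    (hf : f ∈ homs L M) (hb : Function.Bijective f) : IsIso L M :=
  ⟨LinearEquiv.ofBijective f hb, hf⟩

theorem isIso_of_surjective {L M : FDModule k A} {f : L.carrier →ₗ[k] M.carrier}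
    (hf : f ∈ homs L M) (hs : Function.Surjective f)
    (hd : Module.finrank k L.carrier = Module.finrank k M.carrier) : IsIso L M :=
  isIso_of_bijective hf
    ⟨(LinearMap.injective_iff_surjective_of_finrank_eq_finrank hd).2 hs, hs⟩

/-- The homomorphism `L ⊕ L' → M` with the given restrictions. -/
theorem coprod_mem_homs {L L' M : FDModule k A} {f : L.carrier →ₗ[k] M.carrier}
    {g : L'.carrier →ₗ[k] M.carrier} (hf : f ∈ homs L M) (hg : g ∈ homs L' M) :
    f.coprod g ∈ homs (directSum L L') M := by
  intro a v
  simp [hf a v.1, hg a v.2]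

/-- `Hom(L, M ⊕ M') = Hom(L, M) × Hom(L, M')`. -/
def homsDirectSum (L M M' : FDModule k A) :
    homs L (directSum M M') ≃ₗ[k] homs L M × homs L M' where
  toFun f := (⟨LinearMap.fst k _ _ ∘ₗ f.1, fun a v => congrArg Prod.fst (f.2 a v)⟩,
    ⟨LinearMap.snd k _ _ ∘ₗ f.1, fun a v => congrArg Prod.snd (f.2 a v)⟩)
  invFun g := ⟨LinearMap.prod g.1.1 g.2.1, fun a v => Prod.ext (g.1.2 a v) (g.2.2 a v)⟩
  map_add' _ _ := rfl
  map_smul' _ _ := rfl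
  left_inv _ := rfl
  right_inv _ := rfl

/-- Isomorphic targets have isomorphic spaces of homomorphisms. -/
def homsCongr (L : FDModule k A) {M M' : FDModule k A} (e : M.carrier ≃ₗ[k] M'.carrier)
    (he : ∀ a v, e (M.act a v) = M'.act a (e v)) : homs L M ≃ₗ[k] homs L M' where
  toFun f := ⟨e.toLinearMap ∘ₗ f.1, fun a v => by simp [f.2 a v, he]⟩
  invFun f := ⟨e.symm.toLinearMap ∘ₗ f.1, fun a v => by
    have h := he a (e.symm (f.1 v))
    simp only [LinearEquiv.apply_symm_apply] at h
    simp [f.2 a v, ← h]⟩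
  map_add' f g := by ext; simp
  map_smul' r f := by ext; simp
  left_inv f := by ext; simp
  right_inv f := by ext; simp

/-- An element of `A` that acts by different scalars separates two modules. -/
theorem homs_eq_bot_of_scalar {L M : FDModule k A} (z : A) {r s : k} (hrs : r ≠ s)
    (hL : ∀ v, L.act z v = r • v) (hM : ∀ v, M.act z v = s • v) : homs L M = ⊥ := by
  rw [eq_bot_iff]
  intro f hf
  rw [Submodule.mem_bot]
  ext v
  have h := hf z v
  rw [hL, hM, map_smul] at h
  have h' : (r - s) • f v = 0 := by rw [sub_smul, h, sub_self]
  simpa [sub_ne_zero.2 hrs] using h'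

/-- A module without proper nonzero invariant subspaces. -/
def IsSimple (L : FDModule k A) : Prop :=
  ∀ W : Submodule k L.carrier, (∀ a, ∀ v ∈ W, L.act a v ∈ W) → W = ⊥ ∨ W = ⊤

end Algebra

section Bialgebra

variable {k : Type u} {A : Type v} [Field k] [Ring A] [Bialgebra k A]

/-- The multiplicity `dim Hom(L, M)`, as an additive function of `M`. -/
def homRank (L : FDModule k A) : IsoClass k A →+ ℤ where
  toFun := Quotient.lift (fun M => (Module.finrank k (homs L M) : ℤ)) (by
    rintro M M' ⟨e, he⟩
    exact congrArg _ (homsCongr L e he).finrank_eq)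
  map_zero' := by
    have : Subsingleton (homs L (zeroModule k A)) :=
      ⟨fun f g => Subtype.ext (LinearMap.ext fun _ => Subsingleton.elim (α := PUnit) _ _)⟩
    exact congrArg _ (Module.finrank_zero_of_subsingleton (M := homs L (zeroModule k A)))
  map_add' := by
    rintro ⟨M⟩ ⟨M'⟩
    have := (homsDirectSum L M M').finrank_eq
    rw [Module.finrank_prod] at this
    exact (congrArg (Nat.cast (R := ℤ)) this).trans (Nat.cast_add _ _)

theorem homRank_mk (L M : FDModule k A) :
    homRank L (IsoClass.mk M) = (Module.finrank k (homs L M) : ℤ) := rfl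

theorem mk_directSum (V W : FDModule k A) :
    IsoClass.mk (directSum V W) = IsoClass.mk V + IsoClass.mk W := rfl

theorem mk_tensor (V W : FDModule k A) :
    IsoClass.mk (tensor V W) = IsoClass.mk V * IsoClass.mk W := rfl

theorem mk_eq {V W : FDModule k A} (h : IsIso V W) : IsoClass.mk V = IsoClass.mk W :=
  Quotient.sound h

/-- A module that is spanned by images of simple modules `L i` is a direct sum of modules `L i`. -/
theorem mk_mem_closure {ι : Type*} {L : ι → FDModule k A} (hL : ∀ i, (L i).IsSimple)
    {M : FDModule k A} (hM : ⨆ (i) (f : homs (L i) M), LinearMap.range f.1 = ⊤) :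
    IsoClass.mk M ∈ AddSubmonoid.closure (Set.range fun i => IsoClass.mk (L i)) := by
  -- Induction on a bound `d` for the codimension of a direct sum `F` of modules `L i` embedded in
  -- `M`, starting from `F = 0`.
  suffices H : ∀ d, ∀ F : FDModule k A,
      IsoClass.mk F ∈ AddSubmonoid.closure (Set.range fun i => IsoClass.mk (L i)) →
      ∀ g ∈ homs F M, Function.Injective g →
      Module.finrank k M.carrier ≤ Module.finrank k F.carrier + d →
      IsoClass.mk M ∈ AddSubmonoid.closure (Set.range fun i => IsoClass.mk (L i)) by
    refine H (Module.finrank k M.carrier) (zeroModule k A) (zero_mem _) 0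
      (Submodule.zero_mem _) (fun x y _ => Subsingleton.elim (α := PUnit) x y) (by omega)
  intro d
  induction d with
  | zero =>
    intro F hF g hg hgi hd
    have hd' := LinearMap.finrank_le_finrank_of_injective hgi
    have e : Module.finrank k F.carrier = Module.finrank k M.carrier := by omega
    rwa [← mk_eq (isIso_of_bijective hg
      ⟨hgi, (LinearMap.injective_iff_surjective_of_finrank_eq_finrank e).1 hgi⟩)]
  | succ d ih =>
    intro F hF g hg hgi hd
    by_cases hs : LinearMap.range g = ⊤
    · rwa [← mk_eq (isIso_of_bijective hg ⟨hgi, LinearMap.range_eq_top.1 hs⟩)]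
    obtain ⟨i, f, hf⟩ : ∃ (i : ι) (f : homs (L i) M),
        ¬ LinearMap.range f.1 ≤ LinearMap.range g := by
      by_contra! h
      exact hs (eq_top_iff.2 (hM ▸ iSup_le fun i => iSup_le fun f => h i f))
    -- The preimage of `range g` under `f` is invariant. Either it is zero and `F ⊕ L i` embeds in
    -- `M`, or the image of `f` lies in `range g`, against the choice of `f`.
    rcases hL i ((LinearMap.range g).comap f.1) (by
      rintro a v ⟨y, hy⟩
      exact ⟨F.act a y, by rw [hg, hy, f.2]⟩) with h | h
    · have hfg : ∀ y x, g y + f.1 x = 0 → y = 0 ∧ x = 0 := by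
        intro y x hyx
        have hx : x ∈ (LinearMap.range g).comap f.1 :=
          ⟨-y, by rw [map_neg]; exact neg_eq_of_add_eq_zero_right hyx⟩
        rw [h, Submodule.mem_bot] at hx
        subst hx
        rw [map_zero, add_zero] at hyx
        exact ⟨hgi (hyx.trans (map_zero g).symm), rfl⟩
      -- `IsSimple` admits the zero module, but its image lies in `range g`. Hence the codimension
      -- really drops.
      have hpos : 0 < Module.finrank k (L i).carrier := by
        rw [Nat.pos_iff_ne_zero]
        intro h0
        have := Module.finrank_zero_iff.1 h0
        apply hf
        rintro _ ⟨x, rfl⟩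
        rw [Subsingleton.elim x 0, map_zero]
        exact zero_mem _
      refine ih (directSum F (L i)) ?_ (g.coprod f.1) (coprod_mem_homs hg f.2) ?_ ?_
      · rw [mk_directSum]
        exact add_mem hF (AddSubmonoid.subset_closure ⟨i, rfl⟩)
      · rw [injective_iff_map_eq_zero]
        rintro ⟨y, x⟩ hyx
        obtain ⟨h1, h2⟩ := hfg y x hyx
        rw [h1, h2]
        rfl
      · change _ ≤ Module.finrank k (F.carrier × (L i).carrier) + d
        rw [Module.finrank_prod]
        omega
    · refine absurd ?_ hf
      rintro _ ⟨x, rfl⟩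
      exact h.ge (Submodule.mem_top (x := x))

end Bialgebra

end FDModule

/-- The class in the representation ring of a finite-dimensional module. -/
def RepRing.cls {k : Type u} {A : Type v} [Field k] [Ring A] [Bialgebra k A]
    (V : FDModule k A) : RepRing k A := GrothendieckRing.of (IsoClass.mk V)

namespace RepRing

open FDModule

variable {k : Type u} {A : Type v} [Field k] [Ring A] [Bialgebra k A]

theorem cls_congr {V W : FDModule k A} (h : IsIso V W) : cls V = cls W :=
  congrArg GrothendieckRing.of (mk_eq h)

theorem cls_directSum (V W : FDModule k A) : cls (directSum V W) = cls V + cls W :=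
  (congrArg GrothendieckRing.of (mk_directSum V W)).trans (map_add _ _ _)

theorem cls_tensor (V W : FDModule k A) : cls (tensor V W) = cls V * cls W :=
  (congrArg GrothendieckRing.of (mk_tensor V W)).trans (GrothendieckRing.of_mul_of _ _).symm

theorem cls_trivial : cls (trivialModule k A) = 1 := rfl

theorem star_cls {A : Type v} [Ring A] [HopfAlgebra k A] (V : FDModule k A) :
    RepRing.star (cls V) = cls (dual V) :=
  GrothendieckRing.lift_of _ _

/-- The classes of pairwise inequivalent modules that generate all modules form a basis. -/
theorem exists_basis {ι : Type*} [Finite ι] {L : ι → FDModule k A}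
    (h0 : ∀ i, Nontrivial (L i).carrier) (hL : ∀ i j, i ≠ j → homs (L i) (L j) = ⊥)
    (hspan : ∀ M : FDModule k A,
      IsoClass.mk M ∈ AddSubmonoid.closure (Set.range fun i => IsoClass.mk (L i))) :
    ∃ b : Module.Basis ι ℤ (RepRing k A), ∀ i, b i = cls (L i) := by
  have : Fintype ι := Fintype.ofFinite ι
  have hli : LinearIndependent ℤ fun i => cls (L i) := by
    rw [Fintype.linearIndependent_iff]
    intro g hg i
    -- The functional dim Hom(L i, ·) kills all terms but the `i`-th and leaves `g i` times dim
    -- End(L i). The latter is nonzero because of the identity; it need not be known to equal 1.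
    have h := congrArg (GrothendieckRing.lift (homRank (L i))) hg
    rw [map_sum, map_zero, Finset.sum_eq_single i] at h
    · rw [map_zsmul, cls, GrothendieckRing.lift_of, homRank_mk, smul_eq_mul] at h
      refine (mul_eq_zero.1 h).resolve_right ?_
      intro hr
      rw [Nat.cast_eq_zero] at hr
      have hsub := Module.finrank_zero_iff.1 hr
      obtain ⟨v, hv⟩ := exists_ne (0 : (L i).carrier)
      exact hv (LinearMap.congr_fun (congrArg Subtype.val (Subsingleton.elim
        (⟨LinearMap.id, fun _ _ => rfl⟩ : homs (L i) (L i)) 0)) v)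
    · intro j _ hj
      rw [map_zsmul, cls, GrothendieckRing.lift_of, homRank_mk, hL i j hj.symm]
      simp
    · simp
  refine ⟨Module.Basis.mk hli ?_, fun i => Module.Basis.mk_apply _ _ _⟩
  have hof : ∀ s : IsoClass k A, GrothendieckRing.of s ∈
      Submodule.span ℤ (Set.range fun i => cls (L i)) := by
    rintro ⟨M⟩
    have hle : AddSubmonoid.closure (Set.range fun i => IsoClass.mk (L i)) ≤
        (Submodule.span ℤ (Set.range fun i => cls (L i))).toAddSubmonoid.comap
          (GrothendieckRing.of (S := IsoClass k A)) := by
      rw [AddSubmonoid.closure_le]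
      rintro _ ⟨i, rfl⟩
      exact Submodule.subset_span ⟨i, rfl⟩
    exact hle (hspan M)
  intro x _
  obtain ⟨s, t, rfl⟩ := GrothendieckRing.exists_sub x
  exact sub_mem (hof s) (hof t)

end RepRing

end

noncomputable section

/-! ### Algebras presented by a central element and a dihedral pair -/

/-- The relations `t² = h^{2N} = 1`, `wⁿ = h^N`, `wtw = t` with `h` commuting with `t` and `w`. -/
structure IsDihedralTriple {B : Type*} [Monoid B] (N n : ℕ) (h t w : B) : Prop where
  t_sq : t ^ 2 = 1
  h_pow : h ^ (2 * N) = 1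
  w_pow : w ^ n = h ^ N
  w_t_w : w * t * w = t
  h_t : h * t = t * h
  h_w : h * w = w * h

/-- A presentation of an algebra by the relations of `IsDihedralTriple`. -/
structure DihedralPresentation (k : Type u) (A : Type v) [Field k] [Ring A] [Algebra k A]
    (N n : ℕ) where
  /-- the central generator -/
  h : A
  /-- the reflection -/
  t : A
  /-- the rotation -/
  w : A
  rel : IsDihedralTriple N n h t w
  adjoin_eq_top : Algebra.adjoin k {h, t, w} = ⊤
  /-- the universal property -/
  lift : ∀ {V : Type u} [AddCommGroup V] [Module k V] {h' t' w' : Module.End k V},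
    IsDihedralTriple N n h' t' w' → (A →ₐ[k] Module.End k V)
  lift_h : ∀ {V : Type u} [AddCommGroup V] [Module k V] {h' t' w' : Module.End k V}
    (H : IsDihedralTriple N n h' t' w'), lift H h = h'
  lift_t : ∀ {V : Type u} [AddCommGroup V] [Module k V] {h' t' w' : Module.End k V}
    (H : IsDihedralTriple N n h' t' w'), lift H t = t'
  lift_w : ∀ {V : Type u} [AddCommGroup V] [Module k V] {h' t' w' : Module.End k V}
    (H : IsDihedralTriple N n h' t' w'), lift H w = w'

/-- The signs as units of a field. -/
def sgn (k : Type u) [Field k] : ℤˣ →* kˣ := Units.map (Int.castRingHom k).toMonoidHom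

@[simp] theorem sgn_neg_one (k : Type u) [Field k] : sgn k (-1) = -1 := by
  ext; simp [sgn]

theorem sgn_sq (k : Type u) [Field k] (β : ℤˣ) : sgn k β ^ 2 = 1 := by
  rw [← map_pow, Int.units_sq, map_one]

/-- The data on which the families of modules depend: an `N`-th root of unity `ζ` and `ω` with
`ωⁿ = -1`. -/
structure DihedralRoots (k : Type u) [Field k] (N n : ℕ) where
  /-- an `N`-th root of unity -/
  ζ : kˣ
  /-- a `2n`-th root of unity -/
  ω : kˣ
  odd : Odd N
  ζ_pow : ζ ^ N = 1
  ω_pow : ω ^ n = -1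

namespace DihedralRoots

variable {k : Type u} [Field k] {N n : ℕ} (E : DihedralRoots k N n)

theorem zpow_ζ_pow (j : ℤ) : (E.ζ ^ j) ^ N = 1 := by
  rw [← zpow_natCast, zpow_comm, zpow_natCast, E.ζ_pow, one_zpow]

/-- `N` is odd. This makes the `N`-th power forget ζ but keep the sign in an eigenvalue of `h`, as
`wⁿ = h^N` demands. -/
theorem pow_of_sq_eq_one (E : DihedralRoots k N n) (x : kˣ) (hx : x ^ 2 = 1) : x ^ N = x := by
  obtain ⟨m, hm⟩ := E.odd
  rw [hm, pow_succ, pow_mul, hx, one_pow, one_mul]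

/-- The eigenvalue of the central generator on a one-dimensional module. -/
def hChar (j : ℤ) (β : ℤˣ) : kˣ := E.ζ ^ j * sgn k β ^ n

/-- The eigenvalue of the central generator on a two-dimensional module. -/
def hPlane (j i : ℤ) : kˣ := E.ζ ^ j * (-1) ^ i

theorem hChar_pow (j : ℤ) (β : ℤˣ) : E.hChar j β ^ N = sgn k β ^ n := by
  rw [hChar, mul_pow, zpow_ζ_pow, one_mul, E.pow_of_sq_eq_one]
  rw [← pow_mul, mul_comm, pow_mul, sgn_sq, one_pow]

theorem neg_one_zpow_sq (i : ℤ) : (((-1 : kˣ)) ^ i) ^ 2 = 1 := by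
  rw [← zpow_natCast, zpow_comm]; simp

theorem hPlane_pow (j i : ℤ) : E.hPlane j i ^ N = (-1) ^ i := by
  rw [hPlane, mul_pow, zpow_ζ_pow, one_mul, E.pow_of_sq_eq_one _ (neg_one_zpow_sq i)]

theorem ω_zpow_pow (i : ℤ) : (E.ω ^ i) ^ n = (-1) ^ i := by
  rw [← zpow_natCast, zpow_comm, zpow_natCast, E.ω_pow]

theorem isDihedralTriple_char (j : ℤ) (β τ : ℤˣ) :
    IsDihedralTriple N n (E.hChar j β) (sgn k τ) (sgn k β) where
  t_sq := sgn_sq k τ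
  h_pow := by rw [mul_comm, pow_mul, hChar_pow, ← pow_mul, mul_comm, pow_mul, sgn_sq, one_pow]
  w_pow := (E.hChar_pow j β).symm
  w_t_w := by rw [mul_right_comm, ← sq, sgn_sq, one_mul]
  h_t := mul_comm _ _
  h_w := mul_comm _ _

end DihedralRoots

theorem IsDihedralTriple.map {B C : Type*} [Monoid B] [Monoid C] {N n : ℕ} {h t w : B}
    (H : IsDihedralTriple N n h t w) (f : B →* C) : IsDihedralTriple N n (f h) (f t) (f w) where
  t_sq := by rw [← map_pow, H.t_sq, map_one]
  h_pow := by rw [← map_pow, H.h_pow, map_one]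
  w_pow := by rw [← map_pow, H.w_pow, map_pow]
  w_t_w := by rw [← map_mul, ← map_mul, H.w_t_w]
  h_t := by rw [← map_mul, H.h_t, map_mul]
  h_w := by rw [← map_mul, H.h_w, map_mul]

/-- The diagonal endomorphism of `k × k`. -/
abbrev diagEnd {k : Type u} [Field k] (x y : k) : Module.End k (k × k) := Algebra.lmul k (k × k) (x, y)

theorem diagEnd_apply {k : Type u} [Field k] (x y : k) (v : k × k) :
    diagEnd x y v = (x * v.1, y * v.2) := rfl

/-- The exchange of the coordinates of `k × k`. -/
def swapEnd (k : Type u) [Field k] : Module.End k (k × k) := (LinearEquiv.prodComm k k k).toLinearMap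

theorem swapEnd_apply {k : Type u} [Field k] (v : k × k) : swapEnd k v = (v.2, v.1) := rfl

theorem diagEnd_pow {k : Type u} [Field k] (x y : k) (m : ℕ) :
    diagEnd x y ^ m = diagEnd (x ^ m) (y ^ m) := by
  rw [diagEnd, ← map_pow, Prod.pow_mk]

theorem diagEnd_one {k : Type u} [Field k] : diagEnd (1 : k) 1 = 1 :=
  map_one (Algebra.lmul k (k × k))

theorem DihedralRoots.isDihedralTriple_plane {k : Type u} [Field k] {N n : ℕ}
    (E : DihedralRoots k N n) (j i : ℤ) :
    IsDihedralTriple N n (diagEnd (E.hPlane j i : k) (E.hPlane j i : k)) (swapEnd k)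
      (diagEnd ((E.ω ^ i : kˣ) : k) ((E.ω ^ (-i) : kˣ) : k)) where
  t_sq := rfl
  h_pow := by
    rw [diagEnd_pow, ← Units.val_pow_eq_pow_val, mul_comm, pow_mul, hPlane_pow, neg_one_zpow_sq,
      Units.val_one, diagEnd_one]
  w_pow := by
    rw [diagEnd_pow, diagEnd_pow, ← Units.val_pow_eq_pow_val, ← Units.val_pow_eq_pow_val,
      ω_zpow_pow, ω_zpow_pow, ← Units.val_pow_eq_pow_val, hPlane_pow, zpow_neg, ← inv_zpow,
      inv_neg, inv_one]
  w_t_w := by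
    refine LinearMap.ext fun v => ?_
    have h : ((E.ω ^ i : kˣ) : k) * ((E.ω ^ (-i) : kˣ) : k) = 1 := by
      rw [← Units.val_mul, ← zpow_add, add_neg_cancel, zpow_zero, Units.val_one]
    rw [Module.End.mul_apply, Module.End.mul_apply, diagEnd_apply, swapEnd_apply, diagEnd_apply,
      swapEnd_apply, ← mul_assoc, ← mul_assoc, h, mul_comm (Units.val _), h, one_mul, one_mul]
  h_t := rfl
  h_w := by rw [diagEnd, diagEnd, ← map_mul, mul_comm, map_mul]

/-- The linear map `k × k → M` with given values on the standard basis. -/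
def pairMap {k : Type u} [Field k] {M : Type*} [AddCommGroup M] [Module k M] (v v' : M) :
    k × k →ₗ[k] M :=
  (LinearMap.toSpanSingleton k M v).coprod (LinearMap.toSpanSingleton k M v')

@[simp] theorem pairMap_apply {k : Type u} [Field k] {M : Type*} [AddCommGroup M] [Module k M]
    (v v' : M) (x : k × k) : pairMap v v' x = x.1 • v + x.2 • v' := rfl

/-- If `T^m = 1` and `k` contains the `m`-th roots of unity, then an invariant subspace is spanned
by eigenvectors of `T`. -/
theorem le_of_forall_eigenvector {k : Type u} [Field k] {M : Type*} [AddCommGroup M] [Module k M]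
    {m : ℕ} [NeZero m] {ξ : k} (hξ : IsPrimitiveRoot ξ m) {T : Module.End k M} (hT : T ^ m = 1)
    {C U : Submodule k M} (hC : ∀ v ∈ C, T v ∈ C)
    (hU : ∀ v ∈ C, ∀ i < m, T v = ξ ^ i • v → v ∈ U) : C ≤ U := by
  intro v hv
  have hξ0 : ξ ≠ 0 := hξ.ne_zero (NeZero.ne m)
  have hη := hξ.inv
  have hCp : ∀ j, (T ^ j) v ∈ C := by
    intro j
    induction j with
    | zero => simpa using hv
    | succ j ih => rw [pow_succ', Module.End.mul_apply]; exact hC _ ih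
  -- Up to the factor `m`, this sum is the projection of `v` to the `ξ^i`-eigenspace of `T`. By
  -- orthogonality of the powers of `ξ` the projections add up to `m • v`.
  have key : ∀ i < m, ∑ j ∈ Finset.range m, (ξ⁻¹ ^ i) ^ j • (T ^ j) v ∈ U := by
    intro i hi
    refine hU _ (sum_mem fun j _ => C.smul_mem _ (hCp j)) i hi ?_
    have hshift : ∑ j ∈ Finset.range m, (ξ⁻¹ ^ i) ^ (j + 1) • (T ^ (j + 1)) v =
        ∑ j ∈ Finset.range m, (ξ⁻¹ ^ i) ^ j • (T ^ j) v := by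
      have h1 := Finset.sum_range_succ (fun j => (ξ⁻¹ ^ i) ^ j • (T ^ j) v) m
      have h2 := Finset.sum_range_succ' (fun j => (ξ⁻¹ ^ i) ^ j • (T ^ j) v) m
      have h3 : (ξ⁻¹ ^ i) ^ m = 1 := by rw [← pow_mul, mul_comm, pow_mul, hη.pow_eq_one, one_pow]
      rw [h1, h3, hT, pow_zero, pow_zero] at h2
      exact (add_right_cancel h2).symm
    conv_rhs => rw [← hshift]
    rw [map_sum, Finset.smul_sum]
    refine Finset.sum_congr rfl fun j _ => ?_
    rw [map_smul, smul_smul, pow_succ (ξ⁻¹ ^ i), mul_left_comm, inv_pow ξ i,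
      mul_inv_cancel₀ (pow_ne_zero i hξ0), mul_one, pow_succ', Module.End.mul_apply]
  -- A primitive `m`-th root of unity exists only if the characteristic does not divide `m`.
  have hm : (m : k) ≠ 0 := by
    have := hξ.neZero'
    exact NeZero.ne _
  have hsum : ∑ i ∈ Finset.range m, ∑ j ∈ Finset.range m, (ξ⁻¹ ^ i) ^ j • (T ^ j) v =
      (m : k) • v := by
    rw [Finset.sum_comm, Finset.sum_eq_single 0]
    · simp [Nat.cast_smul_eq_nsmul]
    · intro j hj hj0
      rw [← Finset.sum_smul]
      have : ∑ i ∈ Finset.range m, (ξ⁻¹ ^ i) ^ j = 0 := by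
        have h1 : ξ⁻¹ ^ j ≠ 1 := hη.pow_ne_one_of_pos_of_lt hj0 (Finset.mem_range.1 hj)
        have h2 := mul_neg_geom_sum (ξ⁻¹ ^ j) m
        rw [← pow_mul, mul_comm j, pow_mul, hη.pow_eq_one, one_pow, sub_self] at h2
        rw [← (mul_eq_zero.1 h2).resolve_left (sub_ne_zero.2 h1.symm)]
        exact Finset.sum_congr rfl fun i _ => by rw [← pow_mul, mul_comm, pow_mul]
      rw [this, zero_smul]
    · intro h; exact absurd (Finset.mem_range.2 (NeZero.pos m)) h
  have := U.smul_mem (m : k)⁻¹ (hsum ▸ sum_mem fun i hi => key i (Finset.mem_range.1 hi))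
  rwa [smul_smul, inv_mul_cancel₀ hm, one_smul] at this

namespace DihedralPresentation

open FDModule

variable {k : Type u} {A : Type v} [Field k] [Ring A] [Algebra k A] {N n : ℕ}
  (D : DihedralPresentation k A N n) (E : DihedralRoots k N n)

/-- The one-dimensional representation with `w = β`, `t = τ` and `h = ζ^j βⁿ`. -/
def charRep (j : ℤ) (β τ : ℤˣ) : A →ₐ[k] Module.End k k :=
  D.lift (((E.isDihedralTriple_char j β τ).map (Units.coeHom k)).map
    (Algebra.lmul k k : k →* Module.End k k))

/-- The two-dimensional representation with `t` exchanging the basis vectors,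
`w = diag(ω^i, ω^{-i})` and `h = (-1)^i ζ^j`. -/
def planeRep (j i : ℤ) : A →ₐ[k] Module.End k (k × k) := D.lift (E.isDihedralTriple_plane j i)

/-- The module of `charRep`. -/
abbrev char (j : ℤ) (β τ : ℤˣ) : FDModule k A where
  carrier := k
  act := D.charRep E j β τ

/-- The module of `planeRep`. -/
abbrev plane (j i : ℤ) : FDModule k A where
  carrier := k × k
  act := D.planeRep E j i

theorem charRep_h (j : ℤ) (β τ : ℤˣ) (x : k) :
    D.charRep E j β τ D.h x = (E.hChar j β : k) * x :=
  LinearMap.congr_fun (D.lift_h _) x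

theorem charRep_t (j : ℤ) (β τ : ℤˣ) (x : k) : D.charRep E j β τ D.t x = (sgn k τ : k) * x :=
  LinearMap.congr_fun (D.lift_t _) x

theorem charRep_w (j : ℤ) (β τ : ℤˣ) (x : k) : D.charRep E j β τ D.w x = (sgn k β : k) * x :=
  LinearMap.congr_fun (D.lift_w _) x

theorem planeRep_h (j i : ℤ) (x : k × k) :
    D.planeRep E j i D.h x = ((E.hPlane j i : k) * x.1, (E.hPlane j i : k) * x.2) :=
  LinearMap.congr_fun (D.lift_h _) x

theorem planeRep_t (j i : ℤ) (x : k × k) : D.planeRep E j i D.t x = (x.2, x.1) :=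
  LinearMap.congr_fun (D.lift_t _) x

theorem planeRep_w (j i : ℤ) (x : k × k) :
    D.planeRep E j i D.w x = (((E.ω ^ i : kˣ) : k) * x.1, ((E.ω ^ (-i) : kˣ) : k) * x.2) :=
  LinearMap.congr_fun (D.lift_w _) x

/-- The generating set is left free: `{h, t, w}` serves for the classification and for the group
algebra, the `x_{ij}` for the fusion rules of A_{Nn}, where their comultiplication is explicit. -/
theorem pairMap_mem_homs {j i : ℤ} {M : FDModule k A} {v v' : M.carrier}
    {S : Set A} (hS : Algebra.adjoin k S = ⊤)
    (H : ∀ a ∈ S, pairMap v v' (D.planeRep E j i a (1, 0)) = M.act a v ∧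
      pairMap v v' (D.planeRep E j i a (0, 1)) = M.act a v') :
    pairMap v v' ∈ homs (D.plane E j i) M := by
  refine mem_homs_of_adjoin hS fun a ha x => ?_
  obtain ⟨h1, h2⟩ := H a ha
  have hx : x = x.1 • (1, 0) + x.2 • (0, 1) := by simp
  change pairMap v v' (D.planeRep E j i a x) = M.act a (x.1 • v + x.2 • v')
  rw [map_add (M.act a), map_smul, map_smul, ← h1, ← h2, ← map_smul, ← map_smul, ← map_smul,
    ← map_smul, ← map_add, ← map_add, ← hx]

theorem toSpanSingleton_mem_homs {j : ℤ} {β τ : ℤˣ} {M : FDModule k A} {v : M.carrier}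
    {S : Set A} (hS : Algebra.adjoin k S = ⊤)
    (H : ∀ a ∈ S, D.charRep E j β τ a 1 • v = M.act a v) :
    LinearMap.toSpanSingleton k M.carrier v ∈ homs (D.char E j β τ) M := by
  refine mem_homs_of_adjoin hS fun a ha x => ?_
  have hx : x = x • (1 : k) := by simp
  change D.charRep E j β τ a x • v = M.act a (x • v)
  rw [map_smul (M.act a), ← H a ha, smul_smul, ← smul_eq_mul, ← map_smul, ← hx]

/-- The homomorphism from a two-dimensional module given by an eigenvector of `h` and `w`. -/
theorem pairMap_mem_homs_of_eigenvector {j i : ℤ} {M : FDModule k A} {v : M.carrier}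
    (hh : M.act D.h v = (E.hPlane j i : k) • v) (hw : M.act D.w v = ((E.ω ^ i : kˣ) : k) • v) :
    pairMap v (M.act D.t v) ∈ homs (D.plane E j i) M := by
  refine D.pairMap_mem_homs E D.adjoin_eq_top fun a ha => ?_
  have mul (a b : A) (v : M.carrier) : M.act a (M.act b v) = M.act (a * b) v := by
    rw [map_mul]; rfl
  have hi : ((E.ω ^ i : kˣ) : k) * ((E.ω ^ (-i) : kˣ) : k) = 1 := by
    rw [← Units.val_mul, ← zpow_add, add_neg_cancel, zpow_zero, Units.val_one]
  rcases ha with rfl | rfl | rfl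
  · rw [planeRep_h, planeRep_h, mul, D.rel.h_t, ← mul, hh]
    simp
  · rw [planeRep_t, planeRep_t, mul, ← sq, D.rel.t_sq]
    simp
  · rw [planeRep_w, planeRep_w]
    refine ⟨by simp [hw], ?_⟩
    -- From `wtw = t` it follows that `w` acts on `tv` by the inverse of its eigenvalue on `v`.
    have h1 : M.act D.w (M.act D.t (M.act D.w v)) = M.act D.t v := by
      rw [mul, mul, D.rel.w_t_w]
    rw [hw, map_smul, map_smul] at h1
    have h2 : ((E.ω ^ (-i) : kˣ) : k) • M.act D.t v = M.act D.w (M.act D.t v) := by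
      conv_lhs => rw [← h1]
      rw [smul_smul, mul_comm, hi, one_smul]
    simpa using h2

theorem toSpanSingleton_mem_homs_of_eigenvector {j : ℤ} {β τ : ℤˣ} {M : FDModule k A}
    {v : M.carrier} (hh : M.act D.h v = (E.hChar j β : k) • v)
    (hw : M.act D.w v = (sgn k β : k) • v) (ht : M.act D.t v = (sgn k τ : k) • v) :
    LinearMap.toSpanSingleton k M.carrier v ∈ homs (D.char E j β τ) M := by
  refine D.toSpanSingleton_mem_homs E D.adjoin_eq_top fun a ha => ?_
  rcases ha with rfl | rfl | rfl
  · rw [charRep_h, hh, mul_one]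
  · rw [charRep_t, ht, mul_one]
  · rw [charRep_w, hw, mul_one]

end DihedralPresentation

end

/-! ### Classification of the irreducible modules -/

noncomputable section

/-- The index set of the irreducible modules: an `N`-th root of unity together with either the
signs `w`, `t` of a one-dimensional module or the number of a two-dimensional module. -/
abbrev DihedralIndex (N n : ℕ) : Type := Fin N × ((ℤˣ × ℤˣ) ⊕ Fin (n - 1))

theorem sgn_injective {k : Type u} [Field k] (h2 : (2 : k) ≠ 0) :
    Function.Injective (sgn k) := by
  intro β β' h
  have h1 : (-1 : kˣ) ≠ 1 := by
    intro h
    have h' := congrArg Units.val h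
    simp only [Units.val_neg, Units.val_one] at h'
    exact h2 (by linear_combination -h')
  rcases Int.units_eq_one_or β with rfl | rfl <;> rcases Int.units_eq_one_or β' with rfl | rfl <;>
    simp_all [eq_comm]

/-- The difference of the two sides is (x − y)(xy − 1)/(xy). -/
theorem eq_or_mul_eq_one_of_add_inv {k : Type u} [Field k] {x y : kˣ}
    (h : (x : k) + (x⁻¹ : kˣ) = y + (y⁻¹ : kˣ)) : x = y ∨ x * y = 1 := by
  have h1 : ((x : k) - y) * (x * y - 1) = 0 := by
    have hx : (x : k) * (x⁻¹ : kˣ) = 1 := x.mul_inv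
    have hy : (y : k) * (y⁻¹ : kˣ) = 1 := y.mul_inv
    linear_combination (x : k) * y * h - y * hx + x * hy
  rcases mul_eq_zero.1 h1 with h | h
  · exact Or.inl (Units.ext (sub_eq_zero.1 h))
  · exact Or.inr (Units.ext (by simpa using sub_eq_zero.1 h))

namespace DihedralPresentation

open FDModule

variable {k : Type u} {A : Type v} [Field k] [Ring A] [Algebra k A] {N n : ℕ}
  (D : DihedralPresentation k A N n) (E : DihedralRoots k N n)

/-- The irreducible modules. -/
def irr : DihedralIndex N n → FDModule k A
  | (j, .inl (β, τ)) => D.char E (j : ℕ) β τ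
  | (j, .inr i) => D.plane E (j : ℕ) ((i : ℕ) + 1 : ℕ)

theorem isSimple_char (j : ℤ) (β τ : ℤˣ) : (D.char E j β τ).IsSimple :=
  fun W _ => eq_bot_or_eq_top (α := Submodule k k) W

/-- The two eigenvalues of `w` differ, so an invariant subspace contains the coordinate components
of its vectors. As `t` exchanges the coordinate lines, containing one of them means containing both.
-/
theorem isSimple_plane (j : ℤ) {i : ℤ} (hi : E.ω ^ i ≠ E.ω ^ (-i)) : (D.plane E j i).IsSimple := by
  intro W hW
  have hne : ((E.ω ^ i : kˣ) : k) - ((E.ω ^ (-i) : kˣ) : k) ≠ 0 := by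
    rw [sub_ne_zero]; exact fun h => hi (Units.ext h)
  have ht : ∀ x y : k, (x, y) ∈ W → (y, x) ∈ W := fun x y h => by
    simpa only [planeRep_t] using hW D.t _ h
  have hl : ∀ x y : k, (x, y) ∈ W → (x, 0) ∈ W := by
    intro x y h
    have h1 := W.smul_mem (((E.ω ^ i : kˣ) : k) - ((E.ω ^ (-i) : kˣ) : k))⁻¹
      (W.sub_mem (hW D.w _ h) (W.smul_mem ((E.ω ^ (-i) : kˣ) : k) h))
    rw [planeRep_w] at h1
    convert h1 using 1
    refine Prod.ext ?_ ?_
    · change x = (((E.ω ^ i : kˣ) : k) - ((E.ω ^ (-i) : kˣ) : k))⁻¹ *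
        (((E.ω ^ i : kˣ) : k) * x - ((E.ω ^ (-i) : kˣ) : k) * x)
      rw [← sub_mul, inv_mul_cancel_left₀ hne]
    · change 0 = (((E.ω ^ i : kˣ) : k) - ((E.ω ^ (-i) : kˣ) : k))⁻¹ *
        (((E.ω ^ (-i) : kˣ) : k) * y - ((E.ω ^ (-i) : kˣ) : k) * y)
      rw [sub_self, mul_zero]
  by_cases h : ∃ x : k, x ≠ 0 ∧ (x, (0 : k)) ∈ W
  · right
    obtain ⟨x, hx0, hx⟩ := h
    have hx' : ∀ y : k, (y, (0 : k)) ∈ W := fun y => by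
      simpa [hx0] using W.smul_mem (y * x⁻¹) hx
    refine eq_top_iff.2 fun v _ => ?_
    simpa using W.add_mem (hx' v.1) (ht _ _ (hx' v.2))
  · left
    push Not at h
    refine eq_bot_iff.2 fun v hv => ?_
    have h1 : v.1 = 0 := by
      by_contra h0
      exact h _ h0 (hl _ _ hv)
    have h2 : v.2 = 0 := by
      by_contra h0
      exact h _ h0 (hl _ _ (ht _ _ hv))
    exact (Submodule.mem_bot k).2 (Prod.ext h1 h2)

variable {E}

theorem ω_zpow_ne [NeZero n] (hω : IsPrimitiveRoot E.ω (2 * n)) {a b : ℤ} (hab : a < b)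
    (hba : b < a + 2 * n) : E.ω ^ a ≠ E.ω ^ b := by
  intro h
  have h1 : E.ω ^ (b - a) = 1 := by rw [zpow_sub, h, mul_inv_cancel]
  rw [hω.zpow_eq_one_iff_dvd] at h1
  have := Int.le_of_dvd (by omega) h1
  push_cast at this
  omega

variable (hζ : IsPrimitiveRoot E.ζ N) (hω : IsPrimitiveRoot E.ω (2 * n))
  (h2 : (2 : k) ≠ 0)

include hω in
theorem isSimple_irr [NeZero n] (i : DihedralIndex N n) : (D.irr E i).IsSimple := by
  obtain ⟨j, ⟨β, τ⟩ | i⟩ := i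
  · exact D.isSimple_char E _ _ _
  · exact D.isSimple_plane E _ (ω_zpow_ne hω (by omega) (by omega)).symm

theorem nontrivial_irr (i : DihedralIndex N n) : Nontrivial (D.irr E i).carrier := by
  obtain ⟨j, ⟨β, τ⟩ | i⟩ := i
  · exact inferInstanceAs (Nontrivial k)
  · exact inferInstanceAs (Nontrivial (k × k))

/-- The scalar by which `w + w⁻¹` acts on an irreducible module. -/
def trace (E : DihedralRoots k N n) : (ℤˣ × ℤˣ) ⊕ Fin (n - 1) → k
  | .inl (β, _) => (sgn k β : k) + ((sgn k β)⁻¹ : kˣ)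
  | .inr i => ((E.ω ^ (((i : ℕ) + 1 : ℕ) : ℤ) : kˣ) : k) +
      ((E.ω ^ (((i : ℕ) + 1 : ℕ) : ℤ))⁻¹ : kˣ)

/-- Squaring removes the sign from the eigenvalue of `h` and leaves a scalar that depends on the
cyclic index only. No information about that index is lost, since `N` is odd and ζ² is again
primitive. -/
theorem irr_h_sq (i : DihedralIndex N n) (v : (D.irr E i).carrier) :
    (D.irr E i).act (D.h ^ 2) v = (((E.ζ ^ 2) ^ (i.1 : ℕ) : kˣ) : k) • v := by
  have hc (j : ℕ) (x : kˣ) (hx : x ^ 2 = 1) :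
      (((E.ζ ^ 2) ^ j : kˣ) : k) = (E.ζ ^ (j : ℤ) * x : kˣ) * (E.ζ ^ (j : ℤ) * x : kˣ) := by
    rw [← Units.val_mul, mul_mul_mul_comm, ← sq x, hx, mul_one, zpow_natCast, ← sq, ← pow_mul,
      ← pow_mul, mul_comm]
  rw [map_pow, sq, Module.End.mul_apply]
  obtain ⟨j, ⟨β, τ⟩ | i⟩ := i
  · change k at v
    change D.charRep E _ _ _ _ (D.charRep E _ _ _ _ _) = _
    rw [charRep_h, charRep_h, hc j (sgn k β ^ n) (by rw [← pow_mul, mul_comm, pow_mul, sgn_sq,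
      one_pow]), ← mul_assoc]
    rfl
  · change k × k at v
    change D.planeRep E _ _ _ (D.planeRep E _ _ _ _) = _
    rw [planeRep_h, planeRep_h, hc j _ (DihedralRoots.neg_one_zpow_sq (((i : ℕ) + 1 : ℕ) : ℤ)), ← mul_assoc,
      ← mul_assoc]
    rfl

/-- Since `twt = w⁻¹`, the element is `w + w⁻¹`, which acts by a scalar also on the planes. -/
theorem irr_trace (i : DihedralIndex N n) (v : (D.irr E i).carrier) :
    (D.irr E i).act (D.w + D.t * D.w * D.t) v = trace E i.2 • v := by
  rw [map_add, map_mul, map_mul, LinearMap.add_apply, Module.End.mul_apply, Module.End.mul_apply]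
  obtain ⟨j, ⟨β, τ⟩ | i⟩ := i
  · change k at v
    change D.charRep E _ _ _ _ _ + D.charRep E _ _ _ _ (D.charRep E _ _ _ _
      (D.charRep E _ _ _ _ _)) = _
    have h1 : (sgn k τ : k) * sgn k τ = 1 := by rw [← Units.val_mul, ← sq, sgn_sq, Units.val_one]
    have h2 : (sgn k β)⁻¹ = sgn k β := inv_eq_of_mul_eq_one_left (by rw [← sq, sgn_sq])
    rw [charRep_w, charRep_t, charRep_t, charRep_w, trace, h2]
    change (_ : k) = (_ : k) * _
    linear_combination (sgn k β : k) * v * h1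
  · change k × k at v
    change D.planeRep E _ _ _ _ + D.planeRep E _ _ _ (D.planeRep E _ _ _
      (D.planeRep E _ _ _ _)) = _
    rw [planeRep_w, planeRep_t, planeRep_t, planeRep_w, trace, ← zpow_neg, Prod.mk_add_mk,
      ← add_mul, ← add_mul, add_comm (((E.ω ^ (-(((i : ℕ) + 1 : ℕ) : ℤ)) : kˣ) : k))]
    rfl

-- Three elements of the algebra separate the irreducible modules: `h²` detects the cyclic index, `w
-- + w⁻¹` detects the eigenvalues of `w` up to inversion, and `t` distinguishes the two characters
-- that remain.
include hζ hω h2 in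
theorem homs_irr_eq_bot [NeZero n] (i j : DihedralIndex N n) (hij : i ≠ j) :
    homs (D.irr E i) (D.irr E j) = ⊥ := by
  by_cases h1 : i.1 = j.1
  · have hd : ∀ (i : Fin (n - 1)) (β : ℤˣ),
        E.ω ^ (((i : ℕ) + 1 : ℕ) : ℤ) = (sgn k β)⁻¹ → False := by
      intro i β h
      have h1 : E.ω ^ (2 * (((i : ℕ) + 1 : ℕ) : ℤ)) = E.ω ^ (0 : ℤ) := by
        rw [mul_comm, zpow_mul, h, inv_zpow, zpow_ofNat, sgn_sq, inv_one, zpow_zero]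
      exact ω_zpow_ne hω (by omega) (by omega) h1.symm
    by_cases h3 : trace E i.2 = trace E j.2
    · obtain ⟨i1, ⟨β, τ⟩ | i⟩ := i <;> obtain ⟨j1, ⟨β', τ'⟩ | j⟩ := j
      · have hτ : β = β' → τ ≠ τ' := by rintro rfl rfl; exact hij (by rw [show i1 = j1 from h1])
        have hβ : β = β' := by
          rcases eq_or_mul_eq_one_of_add_inv h3 with h | h
          · exact sgn_injective h2 h
          · refine sgn_injective h2 ((mul_eq_one_iff_eq_inv.1 h).trans ?_)
            exact inv_eq_of_mul_eq_one_left (by rw [← sq, sgn_sq])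
        refine homs_eq_bot_of_scalar D.t (r := sgn k τ) (s := sgn k τ') (fun h => hτ hβ
          (sgn_injective h2 (Units.ext h))) (fun v => D.charRep_t E _ _ _ _)
          (fun v => D.charRep_t E _ _ _ _)
      · exfalso
        rcases eq_or_mul_eq_one_of_add_inv h3 with h | h
        · exact hd j β (h.symm.trans (inv_eq_of_mul_eq_one_left (by rw [← sq, sgn_sq])).symm)
        · exact hd j β (eq_inv_of_mul_eq_one_right h)
      · exfalso
        rcases eq_or_mul_eq_one_of_add_inv h3 with h | h
        · exact hd i β' (h.trans (inv_eq_of_mul_eq_one_left (by rw [← sq, sgn_sq])).symm)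
        · exact hd i β' (eq_inv_of_mul_eq_one_left h)
      · exfalso
        rcases eq_or_mul_eq_one_of_add_inv h3 with h | h
        · rcases lt_trichotomy i j with hl | hl | hl
          · exact ω_zpow_ne hω (by have : i.1 < j.1 := hl; omega) (by omega) h
          · exact hij (by rw [show i1 = j1 from h1, hl])
          · exact ω_zpow_ne hω (by have : j.1 < i.1 := hl; omega) (by omega) h.symm
        · rw [← zpow_add, ← zpow_zero E.ω] at h
          exact ω_zpow_ne hω (by omega) (by omega) h.symm
    · exact homs_eq_bot_of_scalar _ h3 (D.irr_trace i) (D.irr_trace j)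
  · refine homs_eq_bot_of_scalar _ (fun h => h1 ?_) (D.irr_h_sq i) (D.irr_h_sq j)
    have hp : IsPrimitiveRoot (E.ζ ^ 2) N := hζ.pow_of_coprime 2 (Nat.coprime_two_left.2 E.odd)
    exact Fin.ext (hp.pow_inj i.1.2 j.1.2 (Units.ext h))

-- The commuting operators `h` and `w` have finite order and `k` contains the relevant roots of
-- unity, so `M` is spanned by common eigenvectors `v`. Each such `v` lies in the sum of the images:
-- the span of `v` and `tv` is the image of a plane or splits into eigenlines of `t`, according to
-- the eigenvalue of `w`.
include hζ hω h2 in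
theorem iSup_range_eq_top [NeZero N] [NeZero n] (hξ : ∃ ξ : k, IsPrimitiveRoot ξ (2 * N)) (M : FDModule k A) :
    ⨆ (i) (f : homs (D.irr E i) M), LinearMap.range f.1 = ⊤ := by
  obtain ⟨ξ, hξ⟩ := hξ
  set U := ⨆ (i) (f : homs (D.irr E i) M), LinearMap.range f.1 with hU
  have hle : ∀ i, ∀ f ∈ homs (D.irr E i) M, ∀ x, f x ∈ U := fun i f hf x =>
    (le_iSup_of_le i (le_iSup_of_le ⟨f, hf⟩ le_rfl) : LinearMap.range f ≤ U) ⟨x, rfl⟩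
  have mul (a b : A) (v : M.carrier) : M.act a (M.act b v) = M.act (a * b) v := by
    rw [map_mul]; rfl
  have hpow {a : A} {r : k} {v : M.carrier} (h : M.act a v = r • v) (m : ℕ) :
      M.act (a ^ m) v = r ^ m • v := by
    induction m with
    | zero => simp
    | succ m ih => rw [pow_succ, ← mul, h, map_smul, ih, smul_smul, pow_succ']
  have hwp : D.w ^ (2 * n) = 1 := by
    rw [mul_comm, pow_mul, D.rel.w_pow, ← pow_mul, mul_comm, D.rel.h_pow]
  have heig : ∀ (v : M.carrier) (κ μ : k), M.act D.h v = κ • v → M.act D.w v = μ • v → v ∈ U := by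
    intro v κ μ hh hw
    by_cases hv : v = 0
    · rw [hv]; exact zero_mem _
    have inj {r s : k} (h : r • v = s • v) : r = s := smul_left_injective k hv h
    have hκ : κ ^ (2 * N) = 1 := inj (by rw [← hpow hh, D.rel.h_pow, map_one, one_smul]; rfl)
    have hμ : μ ^ (2 * n) = 1 := inj (by rw [← hpow hw, hwp, map_one, one_smul]; rfl)
    have hκμ : κ ^ N = μ ^ n := inj (by rw [← hpow hh, ← hpow hw, D.rel.w_pow])
    obtain ⟨i, hi, rfl⟩ := (IsPrimitiveRoot.coe_units_iff.2 hω).eq_pow_of_pow_eq_one hμ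
    -- With μ = ω^i the relation κ^N = μⁿ = (−1)^i and `N` odd show that κ is an `N`-th root of
    -- unity up to the sign (−1)^i. This is the form of `hPlane`.
    have hγ : ((-1) ^ i * κ) ^ N = 1 := by
      rw [mul_pow, hκμ, pow_right_comm (E.ω : k), ← Units.val_pow_eq_pow_val E.ω n,
        E.ω_pow, pow_right_comm, E.odd.neg_one_pow]
      simp [← mul_pow]
    obtain ⟨j, hj, hjκ⟩ := (IsPrimitiveRoot.coe_units_iff.2 hζ).eq_pow_of_pow_eq_one hγ
    have hκ' : κ = (E.hPlane j i : k) := by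
      rw [DihedralRoots.hPlane]
      simp only [zpow_natCast, Units.val_mul, Units.val_pow_eq_pow_val, hjκ]
      rw [mul_right_comm]
      simp [← mul_pow]
    have hchar : ∀ β : ℤˣ, M.act D.w v = (sgn k β : k) • v →
        M.act D.h v = (E.hChar j β : k) • v → v ∈ U := by
      intro β hw hh
      -- If `w` acts on `v` by a sign, it acts on `tv` by the same sign. Then `v ± tv` are common
      -- eigenvectors of `h`, `t`, `w`, and `v` is half their sum.
      have hsplit : ∀ τ : ℤˣ, v + (sgn k τ : k) • M.act D.t v ∈ U := by
        intro τ
        have hτ : (sgn k τ : k) * sgn k τ = 1 := by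
          rw [← Units.val_mul, ← sq, sgn_sq, Units.val_one]
        have h1 : M.act D.w (M.act D.t v) = (sgn k β : k) • M.act D.t v := by
          have hβ : (sgn k β : k) * sgn k β = 1 := by
            rw [← Units.val_mul, ← sq, sgn_sq, Units.val_one]
          have h2 : M.act D.t v = (sgn k β : k) • M.act D.w (M.act D.t v) := by
            conv_lhs => rw [← D.rel.w_t_w, ← mul, ← mul, hw, map_smul, map_smul]
          conv_rhs => rw [h2, smul_smul, hβ, one_smul]
        have hf := D.toSpanSingleton_mem_homs_of_eigenvector E (j := j) (β := β) (τ := τ)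
          (v := v + (sgn k τ : k) • M.act D.t v)
          (by rw [map_add, map_smul, mul, D.rel.h_t, ← mul, hh, map_smul, smul_add,
                smul_comm (sgn k τ : k)])
          (by rw [map_add, map_smul, h1, hw, smul_add, smul_comm (sgn k τ : k)])
          (by rw [map_add, map_smul, mul, ← sq, D.rel.t_sq, map_one, Module.End.one_apply,
                smul_add, smul_smul, hτ, one_smul, add_comm])
        have hx := hle (⟨j, hj⟩, .inl (β, τ)) _ hf (1 : k)
        change (1 : k) • (v + (sgn k τ : k) • M.act D.t v) ∈ U at hx
        rwa [one_smul] at hx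
      have h3 := U.smul_mem (2 : k)⁻¹ (add_mem (hsplit 1) (hsplit (-1)))
      have h4 : v + (sgn k 1 : k) • M.act D.t v + (v + (sgn k (-1) : k) • M.act D.t v) =
          (2 : k) • v := by
        rw [map_one, sgn_neg_one, Units.val_neg, Units.val_one, neg_smul, two_smul, one_smul]
        abel
      rwa [h4, smul_smul, inv_mul_cancel₀ h2, one_smul] at h3
    have hplane : ∀ (v : M.carrier) (i : ℤ), 0 < i → i < n →
        M.act D.h v = (E.hPlane j i : k) • v → M.act D.w v = ((E.ω ^ i : kˣ) : k) • v →
        v ∈ U ∧ M.act D.t v ∈ U := by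
      intro v i h0 hn hh hw
      have hf := D.pairMap_mem_homs_of_eigenvector E hh hw
      obtain ⟨m, rfl⟩ : ∃ m : ℕ, i = ((m + 1 : ℕ) : ℤ) := ⟨i.toNat - 1, by omega⟩
      have hx := hle (⟨j, hj⟩, .inr ⟨m, by omega⟩) _ hf
      have hx1 := hx ((1, 0) : k × k)
      have hx2 := hx ((0, 1) : k × k)
      change (1 : k) • v + (0 : k) • M.act D.t v ∈ U at hx1
      change (0 : k) • v + (1 : k) • M.act D.t v ∈ U at hx2
      rw [one_smul, zero_smul, add_zero] at hx1
      rw [one_smul, zero_smul, zero_add] at hx2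
      exact ⟨hx1, hx2⟩
    -- For i = 0 and i = n the eigenvalue ω^i is 1 and −1, which gives characters. For 0 < i < n the
    -- vector `v` generates a plane.
    rcases Nat.lt_trichotomy i n with hin | hin | hin
    · rcases Nat.eq_zero_or_pos i with rfl | h0
      · refine hchar 1 (by simpa using hw) ?_
        rw [hh, hκ', DihedralRoots.hPlane, DihedralRoots.hChar]
        simp
      · exact (hplane v i (by omega) (by omega) (hκ' ▸ hh) (by simpa using hw)).1
    · subst hin
      refine hchar (-1) ?_ ?_
      · rw [hw, ← Units.val_pow_eq_pow_val, E.ω_pow, sgn_neg_one]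
      · rw [hh, hκ', DihedralRoots.hPlane, DihedralRoots.hChar, sgn_neg_one, zpow_natCast,
          zpow_natCast]
    -- Beyond `n`, the vector `tv` has `w`-eigenvalue ω^{2n−i} with 0 < 2n − i < n, so the plane
    -- case applies to `tv`, and `v = t(tv)`.
    · have h4 : ((E.ω ^ (2 * n - i : ℤ) : kˣ) : k) * (E.ω : k) ^ i = 1 := by
        rw [← Units.val_pow_eq_pow_val, ← Units.val_mul, ← zpow_natCast, ← zpow_add, sub_add_cancel,
          ← Units.val_one, mul_comm, zpow_mul, zpow_natCast, E.ω_pow]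
        simp
      have h5 := hplane (M.act D.t v) (2 * n - i) (by omega) (by omega) (by
        rw [mul, D.rel.h_t, ← mul, hh, hκ', map_smul, DihedralRoots.hPlane, DihedralRoots.hPlane,
          zpow_sub, zpow_mul]
        simp [← inv_pow, inv_neg]) (by
        have h2 : M.act D.t v = (E.ω : k) ^ i • M.act D.w (M.act D.t v) := by
          conv_lhs => rw [← D.rel.w_t_w, ← mul, ← mul, hw, map_smul, map_smul]
        conv_rhs => rw [h2, smul_smul, h4, one_smul])
      have h6 := h5.2
      rwa [mul, ← sq, D.rel.t_sq, map_one, Module.End.one_apply] at h6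
  have hwe : ∀ κ : k, Module.End.eigenspace (M.act D.h) κ ≤ U := by
    intro κ
    refine le_of_forall_eigenvector (IsPrimitiveRoot.coe_units_iff.2 hω)
      (T := M.act D.w) (by rw [← map_pow, hwp, map_one]) ?_ ?_
    · intro v hv
      rw [Module.End.mem_eigenspace_iff] at hv ⊢
      rw [mul, D.rel.h_w, ← mul, hv, map_smul]
    · intro v hv i _ hw
      exact heig v κ _ (Module.End.mem_eigenspace_iff.1 hv) hw
  rw [eq_top_iff]
  refine le_of_forall_eigenvector hξ (T := M.act D.h) (by rw [← map_pow, D.rel.h_pow, map_one])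
    (fun _ _ => Submodule.mem_top) ?_
  intro v _ i _ hv
  exact hwe _ (Module.End.mem_eigenspace_iff.2 hv)

end DihedralPresentation

/-- The classes of the irreducible modules form a basis of the representation ring. -/
theorem DihedralPresentation.exists_basis {k : Type u} {A : Type v} [Field k] [Ring A]
    [Bialgebra k A] {N n : ℕ} [NeZero N] [NeZero n] (D : DihedralPresentation k A N n)
    {E : DihedralRoots k N n} (hζ : IsPrimitiveRoot E.ζ N) (hω : IsPrimitiveRoot E.ω (2 * n))
    (h2 : (2 : k) ≠ 0) (hξ : ∃ ξ : k, IsPrimitiveRoot ξ (2 * N)) :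
    ∃ b : Module.Basis (DihedralIndex N n) ℤ (RepRing k A), ∀ i, b i = RepRing.cls (D.irr E i) :=
  RepRing.exists_basis D.nontrivial_irr (D.homs_irr_eq_bot hζ hω h2) fun M =>
    FDModule.mk_mem_closure (D.isSimple_irr hω) (D.iSup_range_eq_top hζ hω h2 hξ M)

end

/-! ### The fusion rules and the structure of the representation ring -/

noncomputable section

/-- A commutative ring with an additive involution that is generated like the representation ring
of the product of a cyclic group of order `N` and a dihedral group of order `4n`. -/
structure DihedralFusionRing (N n : ℕ) (R : Type*) [CommRing R] (star : R →+ R) where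
  /-- the character with `t = -1` -/
  a : R
  /-- the character with `w = -1` -/
  b : R
  /-- a generator of the cyclic group of characters of order `N` -/
  c : Rˣ
  /-- the two-dimensional classes -/
  X : ℤ → R
  a_sq : a ^ 2 = 1
  b_sq : b ^ 2 = 1
  c_pow : c ^ N = 1
  a_mul : ∀ i, a * X i = X i
  b_mul : ∀ i, b * X i = X (i + n)
  X_neg : ∀ i, X (-i) = X i
  X_zero : X 0 = 1 + a
  X_mul : ∀ i j, X i * X j = X (i + j) + X (i - j)
  star_char : ∀ (j : ℤ) (r s : ℕ),
    star ((c ^ j : Rˣ) * (a ^ r * b ^ s)) = (c ^ (-j) : Rˣ) * (a ^ r * b ^ s)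
  star_X : ∀ j i : ℤ, star ((c ^ j : Rˣ) * X i) = (c ^ (-j) : Rˣ) * X i
  basis : Module.Basis (DihedralIndex N n) ℤ R
  adjoin_eq_top : Algebra.adjoin ℤ ({a, b, (c : R)} ∪ (fun i : ℕ => X i) '' Set.Ico 1 n) = ⊤

namespace DihedralPresentation

open FDModule

section Algebra

variable {k : Type u} {A : Type v} [Field k] [Ring A] [Algebra k A] {N n : ℕ}
  (D : DihedralPresentation k A N n) (E : DihedralRoots k N n)

theorem isIso_plane_neg (j i : ℤ) : IsIso (D.plane E j (-i)) (D.plane E j i) := by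
  refine ⟨LinearEquiv.prodComm k k k, fun a v => ?_⟩
  refine mem_homs_of_adjoin (L := D.plane E j (-i)) (M := D.plane E j i)
    (f := (LinearEquiv.prodComm k k k).toLinearMap) D.adjoin_eq_top ?_ a v
  intro a ha v
  rcases ha with rfl | rfl | rfl
  · simp [planeRep_h, DihedralRoots.hPlane, ← inv_zpow, inv_neg]
  · simp [planeRep_t]
  · simp [planeRep_w]

theorem isIso_char_period (β τ : ℤˣ) : IsIso (D.char E N β τ) (D.char E 0 β τ) := by
  have h : E.hChar N β = E.hChar 0 β := by
    rw [DihedralRoots.hChar, DihedralRoots.hChar, zpow_natCast, E.ζ_pow, zpow_zero]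
  refine ⟨LinearEquiv.refl k k, fun a v => ?_⟩
  refine mem_homs_of_adjoin (L := D.char E N β τ) (M := D.char E 0 β τ)
    (f := LinearMap.id) D.adjoin_eq_top ?_ a v
  intro a ha v
  rcases ha with rfl | rfl | rfl
  · simp [charRep_h, h]
  · simp [charRep_t]
  · simp [charRep_w]

/-- For i = 0 both `h` and `w` act by scalars, so the `t`-eigenvectors (1, 1) and (1, −1) split the
plane. -/
theorem isIso_plane_zero (h2 : (2 : k) ≠ 0) (j : ℤ) :
    IsIso (directSum (D.char E j 1 1) (D.char E j 1 (-1))) (D.plane E j 0) := by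
  have h1 := D.toSpanSingleton_mem_homs_of_eigenvector E (j := j) (β := 1) (τ := 1)
    (M := D.plane E j 0) (v := (1, 1))
    (by simp [planeRep_h, DihedralRoots.hPlane, DihedralRoots.hChar])
    (by simp [planeRep_w]) (by simp [planeRep_t])
  have h2 := D.toSpanSingleton_mem_homs_of_eigenvector E (j := j) (β := 1) (τ := -1)
    (M := D.plane E j 0) (v := (1, -1))
    (by simp [planeRep_h, DihedralRoots.hPlane, DihedralRoots.hChar])
    (by simp [planeRep_w]) (by simp [planeRep_t])
  refine isIso_of_surjective (coprod_mem_homs h1 h2) (fun v => ?_) ?_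
  · refine ⟨((v.1 + v.2) / 2, (v.1 - v.2) / 2), Prod.ext ?_ ?_⟩
    · simp [LinearMap.toSpanSingleton_apply]; field_simp; ring
    · simp [LinearMap.toSpanSingleton_apply]; field_simp; ring
  · rfl

end Algebra

variable {k : Type u} {A : Type v} [Field k] [Ring A] [HopfAlgebra k A] {N n : ℕ}
  (D : DihedralPresentation k A N n) (E : DihedralRoots k N n)

/-- Tensor products and duals of the modules `char` and `plane`. -/
structure FusionRules : Prop where
  trivial : IsIso (trivialModule k A) (D.char E 0 1 1)
  char_char : ∀ (j j' : ℤ) (β β' τ τ' : ℤˣ), IsIso (tensor (D.char E j β τ) (D.char E j' β' τ'))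
    (D.char E (j + j') (β * β') (τ * τ'))
  char_plane : ∀ (j j' i : ℤ) (s : ℕ) (τ : ℤˣ),
    IsIso (tensor (D.char E j ((-1) ^ s) τ) (D.plane E j' i)) (D.plane E (j + j') (i + s * n))
  plane_char : ∀ (j j' i : ℤ) (s : ℕ) (τ : ℤˣ),
    IsIso (tensor (D.plane E j' i) (D.char E j ((-1) ^ s) τ)) (D.plane E (j + j') (i + s * n))
  plane_plane : ∀ i j : ℤ, IsIso (tensor (D.plane E 0 i) (D.plane E 0 j))
    (directSum (D.plane E 0 (i + j)) (D.plane E 0 (i - j)))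
  dual_char : ∀ (j : ℤ) (β τ : ℤˣ), IsIso (dual (D.char E j β τ)) (D.char E (-j) β τ)
  dual_plane : ∀ j i : ℤ, IsIso (dual (D.plane E j i)) (D.plane E (-j) i)

namespace FusionRules

open RepRing

variable {D E} (F : FusionRules D E)
include F

theorem char_mul (j j' : ℤ) (β β' τ τ' : ℤˣ) : cls (D.char E j β τ) * cls (D.char E j' β' τ') =
    cls (D.char E (j + j') (β * β') (τ * τ')) := by
  rw [← cls_tensor, cls_congr (F.char_char j j' β β' τ τ')]

theorem char_mul_plane (j j' i : ℤ) (τ : ℤˣ) :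
    cls (D.char E j 1 τ) * cls (D.plane E j' i) = cls (D.plane E (j + j') i) := by
  rw [← cls_tensor, ← pow_zero (-1 : ℤˣ), cls_congr (F.char_plane j j' i 0 τ)]
  simp

theorem char_mul_plane' (β τ : ℤˣ) (j j' i : ℤ) :
    cls (D.char E j β τ) * cls (D.plane E j' i) = cls (D.plane E j' i) * cls (D.char E j β τ) := by
  obtain ⟨s, rfl⟩ : ∃ s : ℕ, β = (-1) ^ s := by
    rcases Int.units_eq_one_or β with rfl | rfl
    exacts [⟨0, rfl⟩, ⟨1, rfl⟩]
  rw [← cls_tensor, ← cls_tensor, cls_congr (F.char_plane j j' i s τ),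
    cls_congr (F.plane_char j j' i s τ)]

theorem plane_mul (i j : ℤ) : cls (D.plane E 0 i) * cls (D.plane E 0 j) =
    cls (D.plane E 0 (i + j)) + cls (D.plane E 0 (i - j)) := by
  rw [← cls_tensor, cls_congr (F.plane_plane i j), cls_directSum]

/-- The characters with `w = t = 1` account for the cyclic index, so that products of planes are
needed only for index 0. -/
theorem cls_plane (j i : ℤ) :
    cls (D.plane E j i) = cls (D.char E j 1 1) * cls (D.plane E 0 i) := by
  rw [F.char_mul_plane, add_zero]

/-- Commutativity is not automatic for a Hopf algebra, which is why the fusion rules treat char ⊗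
plane and plane ⊗ char separately. For two planes it comes from X_{i−j} = X_{j−i}, after the cyclic
characters are split off. -/
theorem mul_comm_irr (x y : DihedralIndex N n) :
    cls (D.irr E x) * cls (D.irr E y) = cls (D.irr E y) * cls (D.irr E x) := by
  obtain ⟨j, ⟨β, τ⟩ | i⟩ := x <;> obtain ⟨j', ⟨β', τ'⟩ | i'⟩ := y
  · simp only [irr]
    rw [F.char_mul, F.char_mul, add_comm, mul_comm β, mul_comm τ]
  · exact F.char_mul_plane' _ _ _ _ _
  · exact (F.char_mul_plane' _ _ _ _ _).symm
  · simp only [irr]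
    rw [F.cls_plane, F.cls_plane (j' : ℕ)]
    have h1 (j j' : ℤ) : Commute (cls (D.char E j 1 1)) (cls (D.char E j' 1 1)) := by
      rw [Commute, SemiconjBy, F.char_mul, F.char_mul, add_comm]
    have h2 (i i' : ℤ) : Commute (cls (D.plane E 0 i)) (cls (D.plane E 0 i')) := by
      rw [Commute, SemiconjBy, F.plane_mul, F.plane_mul, add_comm i,
        ← cls_congr (D.isIso_plane_neg E 0 (i - i')), neg_sub]
    have h3 (j i : ℤ) : Commute (cls (D.char E j 1 1)) (cls (D.plane E 0 i)) :=
      F.char_mul_plane' _ _ _ _ _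
    exact ((h1 _ _).mul_right (h3 _ _)).mul_left ((h3 _ _).symm.mul_right (h2 _ _))

theorem mul_comm (b : Module.Basis (DihedralIndex N n) ℤ (RepRing k A))
    (hb : ∀ i, b i = cls (D.irr E i)) (x y : RepRing k A) : x * y = y * x := by
  have h (i : DihedralIndex N n) : AddMonoidHom.mulLeft (b i) = AddMonoidHom.mulRight (b i) := by
    refine AddMonoidHom.toIntLinearMap_injective (b.ext fun j => ?_)
    change b i * b j = b j * b i
    rw [hb, hb, F.mul_comm_irr]
  have h' : AddMonoidHom.mulLeft x = AddMonoidHom.mulRight x := by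
    refine AddMonoidHom.toIntLinearMap_injective (b.ext fun j => ?_)
    change x * b j = b j * x
    exact (DFunLike.congr_fun (h j) x).symm
  exact DFunLike.congr_fun h' y

/-- The representation ring is commutative. -/
@[reducible]
def commRing (b : Module.Basis (DihedralIndex N n) ℤ (RepRing k A))
    (hb : ∀ i, b i = cls (D.irr E i)) : CommRing (RepRing k A) :=
  { (inferInstance : Ring (RepRing k A)) with mul_comm := F.mul_comm b hb }

/-- The characters with `w = t = 1`. -/
def cycChar : Multiplicative ℤ →* RepRing k A where
  toFun j := cls (D.char E j.toAdd 1 1)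
  map_one' := (cls_congr F.trivial).symm.trans cls_trivial
  map_mul' i j := by rw [F.char_mul]; rfl

/-- The representation ring of a Hopf algebra with the fusion rules. -/
def fusionRing (b : Module.Basis (DihedralIndex N n) ℤ (RepRing k A))
    (hb : ∀ i, b i = cls (D.irr E i)) (h2 : (2 : k) ≠ 0) :
    letI := F.commRing b hb
    DihedralFusionRing N n (RepRing k A) RepRing.star :=
  letI := F.commRing b hb
  have one : cls (D.char E 0 1 1) = 1 := (cls_congr F.trivial).symm.trans cls_trivial
  have zpow (j : ℤ) : ((F.cycChar.toHomUnits (Multiplicative.ofAdd 1) ^ j : (RepRing k A)ˣ) :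
      RepRing k A) = cls (D.char E j 1 1) := by
    rw [← map_zpow, MonoidHom.coe_toHomUnits, ← ofAdd_zsmul]
    simp [cycChar]
  have hchar (j : ℤ) (r s : ℕ) : cls (D.char E j 1 1) * (cls (D.char E 0 1 (-1)) ^ r *
      cls (D.char E 0 (-1) 1) ^ s) = cls (D.char E j ((-1) ^ s) ((-1) ^ r)) := by
    have h1 : cls (D.char E 0 1 (-1)) ^ r = cls (D.char E 0 1 ((-1) ^ r)) := by
      induction r with
      | zero => rw [pow_zero, pow_zero, one]
      | succ r ih => rw [pow_succ, ih, F.char_mul, pow_succ (-1 : ℤˣ)]; simp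
    have h2 : cls (D.char E 0 (-1) 1) ^ s = cls (D.char E 0 ((-1) ^ s) 1) := by
      induction s with
      | zero => rw [pow_zero, pow_zero, one]
      | succ s ih => rw [pow_succ, ih, F.char_mul, pow_succ (-1 : ℤˣ)]; simp
    rw [h1, h2, F.char_mul, F.char_mul]
    simp
  { a := cls (D.char E 0 1 (-1))
    b := cls (D.char E 0 (-1) 1)
    c := F.cycChar.toHomUnits (Multiplicative.ofAdd 1)
    X := fun i => cls (D.plane E 0 i)
    a_sq := by rw [sq, F.char_mul]; simpa using one
    b_sq := by rw [sq, F.char_mul]; simpa using one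
    c_pow := by
      refine Units.ext ?_
      rw [← zpow_natCast, zpow, cls_congr (D.isIso_char_period E 1 1), one, Units.val_one]
    a_mul := fun i => by rw [F.char_mul_plane, add_zero]
    b_mul := fun i => by
      have := cls_congr (F.char_plane 0 0 i 1 1)
      rw [cls_tensor] at this
      simpa using this
    X_neg := fun i => cls_congr (D.isIso_plane_neg E 0 i)
    X_zero := by rw [← cls_congr (D.isIso_plane_zero E h2 0), cls_directSum, one]
    X_mul := F.plane_mul
    star_char := fun j r s => by
      rw [zpow, zpow, hchar, hchar, star_cls, cls_congr (F.dual_char _ _ _)]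
    star_X := fun j i => by
      rw [zpow, zpow, F.char_mul_plane, F.char_mul_plane, star_cls, add_zero, add_zero,
        cls_congr (F.dual_plane _ _)]
    basis := b
    adjoin_eq_top := by
      -- The cyclic index of a basis element is a natural number, so powers of `c` suffice and `c⁻¹`
      -- need not be adjoined.
      have hc : ∀ j : ℕ, cls (D.char E j 1 1) ∈ Algebra.adjoin ℤ
          ({cls (D.char E 0 1 (-1)), cls (D.char E 0 (-1) 1),
            ((F.cycChar.toHomUnits (Multiplicative.ofAdd 1) : (RepRing k A)ˣ) : RepRing k A)} ∪
            (fun i : ℕ => cls (D.plane E 0 i)) '' Set.Ico 1 n) := by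
        intro j
        rw [← zpow, zpow_natCast, Units.val_pow_eq_pow_val]
        exact pow_mem (Algebra.subset_adjoin (by simp)) j
      suffices h : Submodule.span ℤ (Set.range b) ≤ Subalgebra.toSubmodule (Algebra.adjoin ℤ
          ({cls (D.char E 0 1 (-1)), cls (D.char E 0 (-1) 1),
            ((F.cycChar.toHomUnits (Multiplicative.ofAdd 1) : (RepRing k A)ˣ) : RepRing k A)} ∪
            (fun i : ℕ => cls (D.plane E 0 i)) '' Set.Ico 1 n)) from
        eq_top_iff.2 fun x _ => h (b.mem_span x)
      rw [Submodule.span_le]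
      rintro _ ⟨⟨j, ⟨β, τ⟩ | i⟩, rfl⟩
      · rw [SetLike.mem_coe, Subalgebra.mem_toSubmodule, hb]
        obtain ⟨s, rfl⟩ : ∃ s : ℕ, β = (-1) ^ s := by
          rcases Int.units_eq_one_or β with rfl | rfl
          exacts [⟨0, rfl⟩, ⟨1, rfl⟩]
        obtain ⟨r, rfl⟩ : ∃ r : ℕ, τ = (-1) ^ r := by
          rcases Int.units_eq_one_or τ with rfl | rfl
          exacts [⟨0, rfl⟩, ⟨1, rfl⟩]
        rw [irr, ← hchar]
        exact mul_mem (hc _) (mul_mem (pow_mem (Algebra.subset_adjoin (by simp)) _)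
          (pow_mem (Algebra.subset_adjoin (by simp)) _))
      · rw [SetLike.mem_coe, Subalgebra.mem_toSubmodule, hb, irr, F.cls_plane]
        exact mul_mem (hc _) (Algebra.subset_adjoin (Or.inr
          ⟨(i : ℕ) + 1, ⟨by omega, by omega⟩, rfl⟩)) }

end FusionRules

end DihedralPresentation
end

/-! ### Families with the stated relations and the count of ranks -/

noncomputable section

theorem map_extendX {B C : Type*} [CommRing B] [CommRing C] (f : B →+* C) (n : ℕ) (a b : B)
    (x : ℕ → B) (m : ℕ) : f (extendX n a b x m) = extendX n (f a) (f b) (fun i => f (x i)) m := by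
  unfold extendX
  split_ifs <;> simp

/-- A family that satisfies the relations of `EvenRing` or `OddRing` according to the parity of
`n`, with `c = b²` for odd `n`. -/
structure IsFusionFamily {B : Type*} [CommRing B] (N n : ℕ) (a b c : B) (x : ℕ → B) : Prop where
  a_sq : a ^ 2 = 1
  b_sq : b ^ 2 = c ^ (n % 2)
  c_pow : c ^ N = 1
  a_mul : ∀ i, 1 ≤ i → i < n → a * x i = x i
  b_mul : ∀ i, 1 ≤ i → i < n → b * x i = c ^ (n % 2 * (i % 2)) * x (n - i)
  x_mul : ∀ i j, 1 ≤ i → i < n → 1 ≤ j → j < n → x i * x j =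
    c ^ (i * j % 2) * (extendX n a b x ((i : ℤ) - j).natAbs + extendX n a b x (i + j))

/-- Exponent bookkeeping for u² = c: it says u^{i mod 2}u^{j mod 2} = c^{ij mod 2}u^{(i+j) mod 2},
the source of the factor in the product rule for the x_i. -/
theorem mod_two_add_mod_two (i j : ℕ) : i % 2 + j % 2 = 2 * (i * j % 2) + (i + j) % 2 := by
  rw [Nat.mul_mod, Nat.add_mod]
  rcases Nat.mod_two_eq_zero_or_one i with hi | hi <;>
    rcases Nat.mod_two_eq_zero_or_one j with hj | hj <;> rw [hi, hj]

/-- The analogous bookkeeping for the product of bu^{n mod 2} and u^{i mod 2}X_i, which is to be a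
multiple of u^{(n−i) mod 2}X_{n−i}. -/
theorem mod_two_add_mod_two' {i n : ℕ} (h : i ≤ n) :
    n % 2 + i % 2 = 2 * (n % 2 * (i % 2)) + (n - i) % 2 := by
  rcases Nat.mod_two_eq_zero_or_one n with hn | hn <;>
    rcases Nat.mod_two_eq_zero_or_one i with hi | hi <;> rw [hn, hi] <;> omega

/-- A formula for all `x_m` follows from the formula for `0 ≤ m ≤ n`. -/
theorem extendX_eq {B : Type*} [CommRing B] {n : ℕ} {a b : B} {x : ℕ → B} {y : ℕ → B}
    (h0 : 1 + a = y 0) (hn : b * (1 + a) = y n) (hx : ∀ i, 1 ≤ i → i < n → x i = y i)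
    (hy : ∀ m, n < m → m < 2 * n → y (2 * n - m) = y m) {m : ℕ} (hm : m < 2 * n) :
    extendX n a b x m = y m := by
  unfold extendX
  split_ifs with h1 h2 h3
  · rw [h0, h1]
  · exact hx _ (by omega) h2
  · rw [hn, h3]
  · rw [hx _ (by omega) (by omega), hy m (by omega) hm]

/-- The family `a, b c^{-(n mod 2)}, c⁻¹, c^{-(i mod 2)} x_i`. -/
theorem IsFusionFamily.star {B : Type*} [CommRing B] {N n : ℕ} {a b : B} {c : Bˣ} {x : ℕ → B}
    (H : IsFusionFamily N n a b c x) :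
    IsFusionFamily N n a (b * (c⁻¹ : Bˣ) ^ (n % 2)) (c⁻¹ : Bˣ)
      (fun i => (c⁻¹ : Bˣ) ^ (i % 2) * x i) := by
  have hc : (c : B) * (c⁻¹ : Bˣ) = 1 := c.mul_inv
  generalize hd : ((c⁻¹ : Bˣ) : B) = d at *
  generalize hc' : (c : B) = c' at *
  have hp (e : ℕ) : c' ^ e * d ^ e = 1 := by rw [← mul_pow, hc, one_pow]
  refine ⟨H.a_sq, ?_, ?_, ?_, ?_, ?_⟩
  · rw [mul_pow, H.b_sq]
    linear_combination d ^ (n % 2) * hp (n % 2)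
  · have := hp N
    rwa [H.c_pow, one_mul] at this
  · intro i h1 h2
    rw [mul_left_comm, H.a_mul i h1 h2]
  · intro i h1 h2
    have h3 := H.b_mul i h1 h2
    have h4 : d ^ (n % 2) * d ^ (i % 2) =
        d ^ (n % 2 * (i % 2)) * d ^ (n % 2 * (i % 2)) * d ^ ((n - i) % 2) := by
      rw [← pow_add, ← pow_add, ← pow_add, mod_two_add_mod_two' h2.le, two_mul]
    linear_combination d ^ (n % 2) * d ^ (i % 2) * h3 +
      c' ^ (n % 2 * (i % 2)) * x (n - i) * h4 +
      d ^ (n % 2 * (i % 2)) * d ^ ((n - i) % 2) * x (n - i) * hp (n % 2 * (i % 2))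
  · intro i j hi1 hi2 hj1 hj2
    -- The scaling by the parity of the index extends to x_0, x_n and x_{n+i}, since 2n − l and l
    -- have the same parity.
    have hext {m : ℕ} (hm : m < 2 * n) :
        extendX n a (b * d ^ (n % 2)) (fun i => d ^ (i % 2) * x i) m =
          d ^ (m % 2) * extendX n a b x m := by
      refine extendX_eq (y := fun m => d ^ (m % 2) * extendX n a b x m) ?_ ?_ ?_ ?_ hm
      · simp [extendX]
      · simp only [extendX]
        rw [if_neg (by omega), if_neg (by omega), if_pos trivial]
        ring
      · intro l h1 h2
        simp only [extendX]
        rw [if_neg (by omega), if_pos h2]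
      · intro l h1 h2
        simp only [extendX]
        rw [if_neg (by omega), if_pos (by omega), if_neg (by omega), if_neg (by omega),
          if_neg (by omega), show (2 * n - l) % 2 = l % 2 by omega]
    have h := H.x_mul i j hi1 hi2 hj1 hj2
    rw [hext (by omega), hext (by omega), show ((i : ℤ) - j).natAbs % 2 = (i + j) % 2 by omega]
    have h4 : d ^ (i % 2) * d ^ (j % 2) =
        d ^ (i * j % 2) * d ^ (i * j % 2) * d ^ ((i + j) % 2) := by
      rw [← pow_add, ← pow_add, ← pow_add, mod_two_add_mod_two, two_mul]
    linear_combination d ^ (i % 2) * d ^ (j % 2) * h + (c' ^ (i * j % 2) * h4 +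
      d ^ (i * j % 2) * d ^ ((i + j) % 2) * hp (i * j % 2)) *
      (extendX n a b x ((i : ℤ) - j).natAbs + extendX n a b x (i + j))

/-- The elements `c^j a^r b^s` and `c^j x_i`. -/
def fusionBasis {B : Type*} [CommRing B] (N n : ℕ) (a b c : B) (x : ℕ → B) :
    DihedralIndex N n → B
  | (j, .inl (β, τ)) => c ^ (j : ℕ) * ((if τ = 1 then 1 else a) * if β = 1 then 1 else b)
  | (j, .inr i) => c ^ (j : ℕ) * x (i + 1)

namespace IsFusionFamily

variable {B : Type*} [CommRing B] {N n : ℕ} {a b c : B} {x : ℕ → B}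
  (H : IsFusionFamily N n a b c x)
include H

theorem mem_span_char [NeZero N] (j r s : ℕ) : c ^ j * (a ^ r * b ^ s) ∈
    Submodule.span ℤ (Set.range (fusionBasis N n a b c x)) := by
  have ha : a ^ r = a ^ (r % 2) := by
    conv_lhs => rw [← Nat.div_add_mod r 2, pow_add, pow_mul, H.a_sq, one_pow, one_mul]
  have hb : b ^ s = c ^ (n % 2 * (s / 2)) * b ^ (s % 2) := by
    conv_lhs => rw [← Nat.div_add_mod s 2, pow_add, pow_mul, H.b_sq, ← pow_mul]
  have hc (j : ℕ) : c ^ j = c ^ (j % N) := by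
    conv_lhs => rw [← Nat.div_add_mod j N, pow_add, pow_mul, H.c_pow, one_pow, one_mul]
  rw [ha, hb, mul_left_comm (a ^ _), ← mul_assoc (c ^ j), ← pow_add, hc]
  have hlt := Nat.mod_lt (j + n % 2 * (s / 2)) (NeZero.pos N)
  rcases Nat.mod_two_eq_zero_or_one r with hr | hr <;>
    rcases Nat.mod_two_eq_zero_or_one s with hs | hs <;> rw [hr, hs]
  · exact Submodule.subset_span ⟨(⟨_, hlt⟩, .inl (1, 1)), by simp [fusionBasis]⟩
  · exact Submodule.subset_span ⟨(⟨_, hlt⟩, .inl (-1, 1)), by simp [fusionBasis]⟩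
  · exact Submodule.subset_span ⟨(⟨_, hlt⟩, .inl (1, -1)), by simp [fusionBasis]⟩
  · exact Submodule.subset_span ⟨(⟨_, hlt⟩, .inl (-1, -1)), by simp [fusionBasis]⟩

theorem mem_span_x [NeZero N] (j i : ℕ) (h1 : 1 ≤ i) (h2 : i < n) : c ^ j * x i ∈
    Submodule.span ℤ (Set.range (fusionBasis N n a b c x)) := by
  have hc : c ^ j = c ^ (j % N) := by
    conv_lhs => rw [← Nat.div_add_mod j N, pow_add, pow_mul, H.c_pow, one_pow, one_mul]
  rw [hc]
  exact Submodule.subset_span ⟨(⟨j % N, Nat.mod_lt _ (NeZero.pos N)⟩, .inr ⟨i - 1, by omega⟩), by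
    simp [fusionBasis, Nat.sub_add_cancel h1]⟩

theorem mem_span_extendX [NeZero N] (j m : ℕ) (hm : m < 2 * n) : c ^ j * extendX n a b x m ∈
    Submodule.span ℤ (Set.range (fusionBasis N n a b c x)) := by
  unfold extendX
  split_ifs with h1 h2 h3
  · have h := add_mem (H.mem_span_char j 0 0) (H.mem_span_char j 1 0)
    convert h using 1
    ring
  · exact H.mem_span_x j m (by omega) h2
  · have h := add_mem (H.mem_span_char j 0 1) (H.mem_span_char j 1 1)
    convert h using 1
    ring
  · exact H.mem_span_x j _ (by omega) (by omega)

/-- The span contains 1 and is stable under multiplication by each generator, so it is the whole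
ring. Thus the relations alone bound the number of additive generators by N(n + 3). -/
theorem span_fusionBasis [NeZero N]
    (hgen : Algebra.adjoin ℤ ({a, b, c} ∪ x '' Set.Ico 1 n) = ⊤) :
    Submodule.span ℤ (Set.range (fusionBasis N n a b c x)) = ⊤ := by
  set S := Submodule.span ℤ (Set.range (fusionBasis N n a b c x)) with hS
  have hex (τ : ℤˣ) (y : B) : ∃ r : ℕ, (if τ = 1 then 1 else y) = y ^ r := by
    split_ifs
    exacts [⟨0, (pow_zero y).symm⟩, ⟨1, (pow_one y).symm⟩]
  have hmul : ∀ y ∈ Algebra.adjoin ℤ ({a, b, c} ∪ x '' Set.Ico 1 n), ∀ z ∈ S, y * z ∈ S := by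
    intro y hy
    induction hy using Algebra.adjoin_induction with
    | algebraMap r => intro z hz; simpa using S.smul_mem r hz
    | add y y' _ _ hy hy' => intro z hz; rw [add_mul]; exact add_mem (hy z hz) (hy' z hz)
    | mul y y' _ _ hy hy' => intro z hz; rw [mul_assoc]; exact hy _ (hy' z hz)
    | mem y hy =>
      intro z hz
      induction hz using Submodule.span_induction with
      | zero => rw [mul_zero]; exact zero_mem _
      | add z z' _ _ hz hz' => rw [mul_add]; exact add_mem hz hz'
      | smul r z _ hz => rw [mul_smul_comm]; exact S.smul_mem r hz
      | mem z hz =>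
        obtain ⟨⟨j, ⟨β, τ⟩ | i⟩, rfl⟩ := hz
        · obtain ⟨r, hr⟩ := hex τ a
          obtain ⟨s, hs⟩ := hex β b
          simp only [fusionBasis]
          rw [hr, hs]
          rcases hy with (rfl | rfl | rfl) | ⟨i, ⟨h1, h2⟩, rfl⟩
          · convert H.mem_span_char j (r + 1) s using 1; ring
          · convert H.mem_span_char j r (s + 1) using 1; ring
          · convert H.mem_span_char (j + 1) r s using 1; ring
          · have ha : ∀ r, a ^ r * x i = x i := by
              intro r
              induction r with
              | zero => simp
              | succ r ih => rw [pow_succ, mul_assoc, H.a_mul i h1 h2, ih]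
            -- Multiplication by `b` permutes the x_l up to powers of `c`, so the index and the
            -- exponent are both tracked.
            have hb : ∀ s, ∃ e l, 1 ≤ l ∧ l < n ∧ b ^ s * x i = c ^ e * x l := by
              intro s
              induction s with
              | zero => exact ⟨0, i, h1, h2, by simp⟩
              | succ s ih =>
                obtain ⟨e, l, hl1, hl2, h⟩ := ih
                refine ⟨e + n % 2 * (l % 2), n - l, by omega, by omega, ?_⟩
                rw [pow_succ', mul_assoc, h, mul_left_comm, H.b_mul l hl1 hl2, pow_add, mul_assoc]
            obtain ⟨e, l, hl1, hl2, h⟩ := hb s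
            convert H.mem_span_x (j + e) l hl1 hl2 using 1
            calc x i * (c ^ (j : ℕ) * (a ^ r * b ^ s))
                = c ^ (j : ℕ) * (b ^ s * (a ^ r * x i)) := by ring
              _ = _ := by rw [ha, h]; ring
        · simp only [fusionBasis]
          rcases hy with (rfl | rfl | rfl) | ⟨l, ⟨h1, h2⟩, rfl⟩
          · rw [mul_left_comm, H.a_mul _ (by omega) (by omega)]
            exact H.mem_span_x _ _ (by omega) (by omega)
          · rw [mul_left_comm, H.b_mul _ (by omega) (by omega), ← mul_assoc, ← pow_add]
            exact H.mem_span_x _ _ (by omega) (by omega)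
          · rw [← mul_assoc, ← pow_succ']
            exact H.mem_span_x _ _ (by omega) (by omega)
          · rw [mul_left_comm, H.x_mul _ _ h1 h2 (by omega) (by omega), mul_add, mul_add,
              ← mul_assoc, ← mul_assoc, ← pow_add]
            exact add_mem (H.mem_span_extendX _ _ (by omega)) (H.mem_span_extendX _ _ (by omega))
  refine eq_top_iff.2 fun y _ => ?_
  have h1 : (1 : B) ∈ S := by simpa using H.mem_span_char 0 0 0
  simpa using hmul y (hgen ▸ Algebra.mem_top) 1 h1

end IsFusionFamily

/-- A surjection onto a free module from a module with as many generators is bijective. -/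
theorem bijective_of_span_eq_top {ι E R : Type*} [Finite ι] [AddCommGroup E] [AddCommGroup R]
    (b : Module.Basis ι ℤ R) {y : ι → E} (hy : Submodule.span ℤ (Set.range y) = ⊤)
    (f : E →ₗ[ℤ] R) (hf : Function.Surjective f) : Function.Bijective f := by
  have : Module.Finite ℤ R := Module.Finite.of_basis b
  -- `g` sends the basis to the generators `y` and is onto, so `f ∘ g` is a surjective endomorphism
  -- of a finitely generated module and hence injective. Since `g` is onto, `f` is injective too.
  set g : R →ₗ[ℤ] E := Finsupp.linearCombination ℤ y ∘ₗ b.repr.toLinearMap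
  have hg : Function.Surjective g := by
    refine Function.Surjective.comp (g := Finsupp.linearCombination ℤ y) ?_ b.repr.surjective
    rw [← LinearMap.range_eq_top, Finsupp.range_linearCombination, hy]
  have hfg : Function.Injective (f ∘ₗ g) :=
    OrzechProperty.injective_of_surjective_endomorphism _ (hf.comp hg)
  refine ⟨fun p q hpq => ?_, hf⟩
  obtain ⟨p, rfl⟩ := hg p
  obtain ⟨q, rfl⟩ := hg q
  rw [hfg hpq]

namespace DihedralFusionRing

variable {N n : ℕ} {R : Type*} [CommRing R] {star : R →+ R} (S : DihedralFusionRing N n R star)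

/-- A square root of `c`. -/
def u : Rˣ := S.c ^ ((N + 1) / 2)

/-- N + 1 is even and c^{N+1} = c. -/
theorem u_sq (hN : Odd N) : S.u ^ 2 = S.c := by
  obtain ⟨m, rfl⟩ := hN
  rw [u, ← pow_mul, show (2 * m + 1 + 1) / 2 * 2 = (2 * m + 1) + 1 by omega, pow_succ, S.c_pow,
    one_mul]

/-- Multiplication by `b` shifts the index by `n`, and b² = 1. -/
theorem X_add_two_mul (i : ℤ) : S.X (i + 2 * n) = S.X i := by
  rw [two_mul, ← add_assoc, ← S.b_mul, ← S.b_mul, ← mul_assoc, ← sq, S.b_sq, one_mul]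

/-- Multiplying the X_i of odd index by `u` turns the untwisted rule X_iX_j = X_{i+j} + X_{i−j} into
the one with the factor c^{ij mod 2}. For odd `n` the class X_n = b(1 + a) is scaled as well, so `b`
has to be replaced by `bu`, whose square is `c`. -/
theorem isFusionFamily (hN : Odd N) :
    IsFusionFamily N n S.a (S.b * S.u ^ (n % 2)) S.c (fun i => S.u ^ (i % 2) * S.X i) := by
  have hu : (S.c : R) = (S.u : R) ^ 2 := by rw [← S.u_sq hN, Units.val_pow_eq_pow_val]
  have hXn : S.X n = S.b * (1 + S.a) := by rw [← S.X_zero, S.b_mul, zero_add]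
  refine ⟨S.a_sq, ?_, ?_, ?_, ?_, ?_⟩
  · rw [mul_pow, S.b_sq, hu]
    ring
  · rw [← Units.val_pow_eq_pow_val, S.c_pow, Units.val_one]
  · intro i _ _
    rw [mul_left_comm, S.a_mul]
  · intro i _ h2
    have h3 : S.X (i + n) = S.X ((n - i : ℕ) : ℤ) := by
      rw [← S.X_neg, ← S.X_add_two_mul]
      congr 1
      push_cast [h2.le]
      ring
    have h4 := S.b_mul i
    rw [h3] at h4
    have h5 : (S.u : R) ^ (n % 2) * S.u ^ (i % 2) =
        (S.u ^ 2) ^ (n % 2 * (i % 2)) * S.u ^ ((n - i) % 2) := by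
      rw [← pow_mul, ← pow_add, ← pow_add, mod_two_add_mod_two' h2.le]
    rw [hu]
    linear_combination (S.u : R) ^ (n % 2) * S.u ^ (i % 2) * h4 + S.X ((n - i : ℕ) : ℤ) * h5
  · intro i j hi1 hi2 hj1 hj2
    have hext {m : ℕ} (hm : m < 2 * n) :
        extendX n S.a (S.b * S.u ^ (n % 2)) (fun i => (S.u : R) ^ (i % 2) * S.X i) m =
          (S.u : R) ^ (m % 2) * S.X m := by
      refine extendX_eq (y := fun m => (S.u : R) ^ (m % 2) * S.X m) ?_ ?_ ?_ ?_ hm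
      · simp [S.X_zero]
      · simp only [hXn]; ring
      · exact fun _ _ _ => rfl
      · intro l h1 h2
        have h3 : S.X ((2 * n - l : ℕ) : ℤ) = S.X l := by
          rw [← S.X_neg l, ← S.X_add_two_mul (-l)]
          congr 1
          push_cast [h2.le]
          ring
        simp only [h3]
        rw [show (2 * n - l) % 2 = l % 2 by omega]
    rw [hext (by omega), hext (by omega), show ((i : ℤ) - j).natAbs % 2 = (i + j) % 2 by omega]
    have h1 : S.X (((i : ℤ) - j).natAbs : ℤ) = S.X (i - j) := by
      rcases Int.natAbs_eq ((i : ℤ) - j) with h | h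
      · rw [← h]
      · rw [← S.X_neg, ← h]
    have h5 : (S.u : R) ^ (i % 2) * S.u ^ (j % 2) =
        (S.u ^ 2) ^ (i * j % 2) * S.u ^ ((i + j) % 2) := by
      rw [← pow_mul, ← pow_add, ← pow_add, mod_two_add_mod_two]
    rw [h1, hu, Nat.cast_add]
    linear_combination (S.u : R) ^ (i % 2) * S.u ^ (j % 2) * S.X_mul i j +
      (S.X (i + j) + S.X (i - j)) * h5

theorem surjective {E : Type*} [CommRing E] (hN : Odd N) {a b c : E} {x : ℕ → E} (f : E →+* R)
    (ha : f a = S.a) (hb : f b = S.b * S.u ^ (n % 2)) (hc : f c = S.c)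
    (hx : ∀ i, 1 ≤ i → i < n → f (x i) = S.u ^ (i % 2) * S.X i) : Function.Surjective f := by
  have hu : ∃ y, f y * S.u = 1 := by
    -- This power of `c` maps to u⁻¹ because c^N = 1. With u⁻¹ in the image the rescaling can be
    -- undone, so the image contains all generators.
    refine ⟨c ^ (N - (N + 1) / 2), ?_⟩
    rw [map_pow, hc, u, Units.val_pow_eq_pow_val, ← pow_add,
      Nat.sub_add_cancel (by have := hN.pos; omega), ← Units.val_pow_eq_pow_val, S.c_pow,
      Units.val_one]
  obtain ⟨y, hy⟩ := hu
  have hy' (e : ℕ) : f (y ^ e) * S.u ^ e = 1 := by rw [map_pow, ← mul_pow, hy, one_pow]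
  rw [← RingHom.range_eq_top, eq_top_iff]
  intro r _
  have hr : r ∈ Algebra.adjoin ℤ ({S.a, S.b, (S.c : R)} ∪ (fun i : ℕ => S.X i) '' Set.Ico 1 n) :=
    S.adjoin_eq_top ▸ Algebra.mem_top
  have hle : Algebra.adjoin ℤ ({S.a, S.b, (S.c : R)} ∪ (fun i : ℕ => S.X i) '' Set.Ico 1 n) ≤
      subalgebraOfSubring f.range := by
    rw [Algebra.adjoin_le_iff]
    rintro _ ((rfl | rfl | rfl) | ⟨i, ⟨h1, h2⟩, rfl⟩)
    · exact ⟨a, ha⟩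
    · refine ⟨y ^ (n % 2) * b, ?_⟩
      rw [map_mul, hb]
      linear_combination S.b * hy' (n % 2)
    · exact ⟨c, hc⟩
    · refine ⟨y ^ (i % 2) * x i, ?_⟩
      rw [map_mul, hx i h1 h2]
      linear_combination S.X i * hy' (i % 2)
  exact hle hr

/-- Surjectivity and the count of generators make `f` bijective. The two sides of the compatibility
with the star are additive, so they need to be compared only on the spanning monomials. -/
theorem exists_ringEquiv {E : Type*} [CommRing E] [NeZero N] (hN : Odd N) {a b : E} {c : Eˣ}
    {x : ℕ → E} (H : IsFusionFamily N n a b c x)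
    (hgen : Algebra.adjoin ℤ ({a, b, (c : E)} ∪ x '' Set.Ico 1 n) = ⊤) (f : E →+* R)
    (ha : f a = S.a) (hb : f b = S.b * S.u ^ (n % 2)) (hc : f c = S.c)
    (hx : ∀ i, 1 ≤ i → i < n → f (x i) = S.u ^ (i % 2) * S.X i) (σ : E →+* E)
    (hσa : σ a = a) (hσb : σ b = b * (c⁻¹ : Eˣ) ^ (n % 2)) (hσc : σ c = (c⁻¹ : Eˣ))
    (hσx : ∀ i, 1 ≤ i → i < n → σ (x i) = (c⁻¹ : Eˣ) ^ (i % 2) * x i) :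
    ∃ e : E ≃+* R, ∀ r, e (σ r) = star (e r) := by
  have hbij : Function.Bijective f := bijective_of_span_eq_top S.basis (H.span_fusionBasis hgen)
    f.toAddMonoidHom.toIntLinearMap (S.surjective hN f ha hb hc hx)
  refine ⟨RingEquiv.ofBijective f hbij, fun r => ?_⟩
  change f (σ r) = star (f r)
  have hc' : f (c⁻¹ : Eˣ) = (S.c⁻¹ : Rˣ) := by
    have h : Units.map f.toMonoidHom c = S.c := Units.ext hc
    rw [← h, ← map_inv]
    rfl
  -- The images of the monomials are brought to the form c^m a^r b^s or c^m X_i, on which `star` is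
  -- known.
  have hcu (j l : ℕ) : S.c ^ j * S.u ^ l = S.c ^ ((j + (N + 1) / 2 * l : ℕ) : ℤ) := by
    rw [zpow_natCast, u, ← pow_mul, ← pow_add]
  have hinv (j l : ℕ) : S.c ^ (-((j + (N + 1) / 2 * l : ℕ) : ℤ)) =
      S.c⁻¹ ^ j * (S.u * S.c⁻¹) ^ l := by
    -- The star replaces `u` by u⁻¹ = uc⁻¹; this is the factor c⁻¹ in σ(x_i) for odd `i`.
    have h1 : S.u * S.c⁻¹ = S.u⁻¹ := by
      rw [mul_inv_eq_iff_eq_mul, ← S.u_sq hN, sq, inv_mul_cancel_left]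
    rw [zpow_neg, ← hcu, h1, inv_pow, inv_pow, mul_inv]
  suffices h : (f.comp σ).toAddMonoidHom.toIntLinearMap =
      (star.comp f.toAddMonoidHom).toIntLinearMap from LinearMap.congr_fun h r
  refine LinearMap.ext_on_range (H.span_fusionBasis hgen) ?_
  rintro ⟨j, ⟨β, τ⟩ | i⟩
  · have hex (τ : ℤˣ) (y : E) : ∃ r : ℕ, (if τ = 1 then 1 else y) = y ^ r := by
      split_ifs
      exacts [⟨0, (pow_zero y).symm⟩, ⟨1, (pow_one y).symm⟩]
    obtain ⟨r, hr⟩ := hex τ a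
    obtain ⟨s, hs⟩ := hex β b
    change f (σ (c ^ (j : ℕ) * ((if τ = 1 then 1 else a) * if β = 1 then 1 else b))) =
      star (f (c ^ (j : ℕ) * ((if τ = 1 then 1 else a) * if β = 1 then 1 else b)))
    rw [hr, hs]
    simp only [map_mul, map_pow, hσa, hσb, hσc, ha, hb, hc, hc']
    have h := S.star_char ((j + (N + 1) / 2 * (n % 2 * s) : ℕ) : ℤ) r s
    rw [hinv, ← hcu] at h
    push_cast at h
    convert h.symm using 1
    · ring
    · congr 1; ring
  · change f (σ (c ^ (j : ℕ) * x (i + 1))) = star (f (c ^ (j : ℕ) * x (i + 1)))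
    have h := S.star_X ((j + (N + 1) / 2 * ((i + 1) % 2) : ℕ) : ℤ) ((i + 1 : ℕ) : ℤ)
    rw [hinv, ← hcu] at h
    rw [map_mul, map_mul, map_mul, hσx _ (by omega) (by omega), map_mul, map_pow, map_pow, map_pow,
      map_pow, hσc, hc', hc, hx _ (by omega) (by omega)]
    push_cast at h ⊢
    convert h.symm using 1
    · ring
    · congr 1; ring

end DihedralFusionRing

end

/-! ### The presented rings for even and for odd n -/

noncomputable section

theorem extendX_congr {B : Type*} [CommRing B] {n : ℕ} (a b : B) {x y : ℕ → B}
    (h : ∀ i, 1 ≤ i → i < n → x i = y i) {m : ℕ} (hm : m < 2 * n) :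
    extendX n a b x m = extendX n a b y m := by
  unfold extendX
  split_ifs
  · rfl
  · exact h _ (by omega) (by omega)
  · rfl
  · exact h _ (by omega) (by omega)

/-- The exponent is 0 or −2 according to the parity of `i`. This links the exponent in the theorem
with the one in `IsFusionFamily.star`, where c = b². -/
theorem zpow_neg_one_pow_sub_one {G : Type*} [Group G] (g : G) (i : ℕ) :
    g ^ ((-1 : ℤ) ^ i - 1) = (g ^ 2)⁻¹ ^ (i % 2) := by
  rcases Nat.even_or_odd i with hi | hi
  · rw [hi.neg_one_pow, Nat.even_iff.1 hi, sub_self, zpow_zero, pow_zero]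
  · rw [hi.neg_one_pow, Nat.odd_iff.1 hi, pow_one, show (-1 - 1 : ℤ) = -((2 : ℕ) : ℤ) by norm_num,
      zpow_neg, zpow_natCast]

theorem zpow_half_neg_one_pow_sub_one {G : Type*} [Group G] (g : G) (i : ℕ) :
    g ^ (((-1 : ℤ) ^ i - 1) / 2) = g⁻¹ ^ (i % 2) := by
  rcases Nat.even_or_odd i with hi | hi
  · rw [hi.neg_one_pow, Nat.even_iff.1 hi]; simp
  · rw [hi.neg_one_pow, Nat.odd_iff.1 hi, pow_one, show ((-1 - 1) / 2 : ℤ) = -1 by norm_num,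
      zpow_neg_one]

namespace EvenRing

variable {N n : ℕ}

theorem mk_rel {p q : MvPolynomial (EvenGen n) ℤ} (h : EvenGen.Rel N n p q) :
    (mk p : EvenRing N n) = mk q :=
  RingQuot.mkRingHom_rel h

theorem isFusionFamily (hn : Even n) :
    IsFusionFamily N n (a : EvenRing N n) b (mk (.X .c)) x where
  a_sq := by simpa [a] using mk_rel (N := N) (n := n) .a_sq
  b_sq := by
    rw [Nat.even_iff.1 hn, pow_zero]
    simpa [b] using mk_rel (N := N) (n := n) .b_sq
  c_pow := by simpa using mk_rel (N := N) (n := n) .c_pow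
  a_mul i h₁ h₂ := by simpa [a, x] using mk_rel (N := N) (n := n) (.a_mul i h₁ h₂)
  b_mul i h₁ h₂ := by
    rw [Nat.even_iff.1 hn, zero_mul, pow_zero, one_mul]
    simpa [b, x] using mk_rel (N := N) (n := n) (.b_mul i h₁ h₂)
  x_mul i j h₁ h₂ h₃ h₄ := by
    have h := mk_rel (N := N) (n := n) (.x_mul i j h₁ h₂ h₃ h₄)
    rw [map_mul, map_mul, map_add, map_pow, map_extendX, map_extendX] at h
    exact h

theorem adjoin_eq_top : Algebra.adjoin ℤ
    ({(a : EvenRing N n), b, mk (.X .c)} ∪ x '' Set.Ico 1 n) = ⊤ := by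
  refine eq_top_iff.2 fun y hy => ?_
  clear hy
  obtain ⟨p, rfl⟩ : ∃ p, mk p = y := RingQuot.mkRingHom_surjective _ y
  induction p using MvPolynomial.induction_on with
  | C r => simp
  | add p q hp hq => rw [map_add]; exact add_mem hp hq
  | mul_X p i hp =>
    rw [map_mul]
    refine mul_mem hp (Algebra.subset_adjoin ?_)
    cases i with
    | a => exact Or.inl (Or.inl rfl)
    | b => exact Or.inl (Or.inr (Or.inl rfl))
    | c => exact Or.inl (Or.inr (Or.inr rfl))
    | x i h₁ h₂ => exact Or.inr ⟨i, ⟨h₁, h₂⟩, by rw [x, EvenGen.varX, dif_pos ⟨h₁, h₂⟩]⟩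

theorem exists_lift {B : Type*} [CommRing B] (hn : Even n) {a' b' c' : B} {x' : ℕ → B}
    (H : IsFusionFamily N n a' b' c' x') : ∃ f : EvenRing N n →+* B,
      f a = a' ∧ f b = b' ∧ f (mk (.X .c)) = c' ∧ ∀ i, 1 ≤ i → i < n → f (x i) = x' i := by
  let φ : MvPolynomial (EvenGen n) ℤ →+* B :=
    MvPolynomial.eval₂Hom (Int.castRingHom B) fun g => match g with
      | .a => a'
      | .b => b'
      | .c => c'
      | .x i _ _ => x' i
  have hx (i : ℕ) (h₁ : 1 ≤ i) (h₂ : i < n) : φ (EvenGen.varX n i) = x' i := by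
    rw [EvenGen.varX, dif_pos ⟨h₁, h₂⟩]; simp [φ]
  have ha : φ (.X .a) = a' := by simp [φ]
  have hb : φ (.X .b) = b' := by simp [φ]
  have hc : φ (.X .c) = c' := by simp [φ]
  have hφ : ∀ ⦃p q⦄, EvenGen.Rel N n p q → φ p = φ q := by
    intro p q h
    cases h with
    | a_sq => rw [map_pow, ha, H.a_sq, map_one]
    | b_sq => rw [map_pow, hb, H.b_sq, Nat.even_iff.1 hn, pow_zero, map_one]
    | c_pow => rw [map_pow, hc, H.c_pow, map_one]
    | a_mul i h₁ h₂ => rw [map_mul, ha, hx i h₁ h₂, H.a_mul i h₁ h₂]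
    | b_mul i h₁ h₂ =>
      rw [map_mul, hb, hx i h₁ h₂, H.b_mul i h₁ h₂, Nat.even_iff.1 hn, zero_mul, pow_zero, one_mul,
        hx _ (by omega) (by omega)]
    | x_mul i j h₁ h₂ h₃ h₄ =>
      rw [map_mul, map_mul, map_add, map_pow, map_extendX, map_extendX, ha, hb, hc, hx i h₁ h₂,
        hx j h₃ h₄, H.x_mul i j h₁ h₂ h₃ h₄, extendX_congr _ _ hx (by omega),
        extendX_congr _ _ hx (by omega)]
  refine ⟨RingQuot.lift ⟨φ, hφ⟩, ?_, ?_, ?_, fun i h₁ h₂ => ?_⟩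
  · exact (RingQuot.lift_mkRingHom_apply φ hφ _).trans ha
  · exact (RingQuot.lift_mkRingHom_apply φ hφ _).trans hb
  · exact (RingQuot.lift_mkRingHom_apply φ hφ _).trans hc
  · exact (RingQuot.lift_mkRingHom_apply φ hφ _).trans (hx i h₁ h₂)

/-- The involution of `EvenRing` and its compatibility with fusion rings. -/
theorem exists_star [NeZero N] (hN : Odd N) (hn : Even n) : ∃ σ : EvenRing N n →+* EvenRing N n,
    (σ a = a ∧ σ b = b ∧ σ (c : (EvenRing N n)ˣ) = (c⁻¹ : (EvenRing N n)ˣ) ∧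
      ∀ i : ℕ, 1 ≤ i → i < n → σ (x i) =
        ((c ^ (((-1 : ℤ) ^ i - 1) / 2) : (EvenRing N n)ˣ) : EvenRing N n) * x i) ∧
    ∀ {R : Type w} [CommRing R] {star : R →+ R} (_ : DihedralFusionRing N n R star),
      ∃ f : EvenRing N n ≃+* R, ∀ r, f (σ r) = star (f r) := by
  have H : IsFusionFamily N n a b ((c : (EvenRing N n)ˣ) : EvenRing N n) x := isFusionFamily hn
  -- The prospective images of the generators again satisfy the relations, so the universal property
  -- gives the endomorphism σ.
  obtain ⟨σ, hσa, hσb, hσc, hσx⟩ := exists_lift hn H.star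
  refine ⟨σ, ⟨hσa, ?_, hσc, fun i h₁ h₂ => ?_⟩, fun S => ?_⟩
  · rw [hσb, Nat.even_iff.1 hn, pow_zero, mul_one]
  · rw [hσx i h₁ h₂, zpow_half_neg_one_pow_sub_one, Units.val_pow_eq_pow_val]
  · obtain ⟨f, ha, hb, hc, hx⟩ := exists_lift hn (S.isFusionFamily hN)
    exact S.exists_ringEquiv hN H adjoin_eq_top f ha hb hc hx σ hσa hσb hσc hσx

end EvenRing

namespace OddRing

variable {N n : ℕ}

theorem mk_rel {p q : MvPolynomial (OddGen n) ℤ} (h : OddGen.Rel N n p q) :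
    (mk p : OddRing N n) = mk q :=
  RingQuot.mkRingHom_rel h

theorem isFusionFamily (hn : Odd n) :
    IsFusionFamily N n (a : OddRing N n) (mk (.X .b)) (mk (.X .b) ^ 2) x := by
  have hb : ∀ i, 1 ≤ i → i < n → Even i → mk (.X .b) * x i = (x (n - i) : OddRing N n) := by
    intro i h₁ h₂ h₃
    simpa [x] using mk_rel (N := N) (n := n) (.b_mul i h₁ h₂ h₃)
  refine ⟨?_, ?_, ?_, ?_, ?_, ?_⟩
  · simpa [a] using mk_rel (N := N) (n := n) .a_sq
  · rw [Nat.odd_iff.1 hn, pow_one]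
  · simpa [pow_mul] using mk_rel (N := N) (n := n) .b_pow
  · intro i h₁ h₂
    simpa [a, x] using mk_rel (N := N) (n := n) (.a_mul i h₁ h₂)
  · intro i h₁ h₂
    rcases Nat.even_or_odd i with hi | hi
    · rw [hb i h₁ h₂ hi, Nat.even_iff.1 hi, mul_zero, pow_zero, one_mul]
    -- The rule bx_i = x_{n−i} is imposed for even `i` only. For odd `i` the index n − i is even, so
    -- x_i = bx_{n−i} and bx_i = b²x_{n−i}.
    · have h := hb (n - i) (by omega) (by omega) (Nat.Odd.sub_odd hn hi)
      rw [Nat.sub_sub_self h₂.le] at h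
      rw [← h, Nat.odd_iff.1 hi, Nat.odd_iff.1 hn]
      ring
  · intro i j h₁ h₂ h₃ h₄
    rw [← pow_mul]
    have h := mk_rel (N := N) (n := n) (.x_mul i j h₁ h₂ h₃ h₄)
    rw [map_mul, map_mul, map_add, map_pow, map_extendX, map_extendX] at h
    exact h

theorem adjoin_eq_top : Algebra.adjoin ℤ
    ({(a : OddRing N n), mk (.X .b), mk (.X .b) ^ 2} ∪ x '' Set.Ico 1 n) = ⊤ := by
  refine eq_top_iff.2 fun y hy => ?_
  clear hy
  obtain ⟨p, rfl⟩ : ∃ p, mk p = y := RingQuot.mkRingHom_surjective _ y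
  induction p using MvPolynomial.induction_on with
  | C r => simp
  | add p q hp hq => rw [map_add]; exact add_mem hp hq
  | mul_X p i hp =>
    rw [map_mul]
    refine mul_mem hp (Algebra.subset_adjoin ?_)
    cases i with
    | a => exact Or.inl (Or.inl rfl)
    | b => exact Or.inl (Or.inr (Or.inl rfl))
    | x i h₁ h₂ => exact Or.inr ⟨i, ⟨h₁, h₂⟩, by rw [x, OddGen.varX, dif_pos ⟨h₁, h₂⟩]⟩

theorem exists_lift {B : Type*} [CommRing B] (hn : Odd n) {a' b' c' : B} {x' : ℕ → B}
    (H : IsFusionFamily N n a' b' c' x') : ∃ f : OddRing N n →+* B,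
      f a = a' ∧ f (mk (.X .b)) = b' ∧ f (mk (.X .b) ^ 2) = c' ∧
      ∀ i, 1 ≤ i → i < n → f (x i) = x' i := by
  let φ : MvPolynomial (OddGen n) ℤ →+* B :=
    MvPolynomial.eval₂Hom (Int.castRingHom B) fun g => match g with
      | .a => a'
      | .b => b'
      | .x i _ _ => x' i
  have hx (i : ℕ) (h₁ : 1 ≤ i) (h₂ : i < n) : φ (OddGen.varX n i) = x' i := by
    rw [OddGen.varX, dif_pos ⟨h₁, h₂⟩]; simp [φ]
  have ha : φ (.X .a) = a' := by simp [φ]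
  have hb : φ (.X .b) = b' := by simp [φ]
  -- For odd `n` the element `c'` is no generator: the family relation forces it to be b'², and c'^N
  -- = 1 becomes b'^{2N} = 1.
  have hc : b' ^ 2 = c' := by rw [H.b_sq, Nat.odd_iff.1 hn, pow_one]
  have hφ : ∀ ⦃p q⦄, OddGen.Rel N n p q → φ p = φ q := by
    intro p q h
    cases h with
    | a_sq => rw [map_pow, ha, H.a_sq, map_one]
    | b_pow => rw [map_pow, hb, pow_mul, hc, H.c_pow, map_one]
    | a_mul i h₁ h₂ => rw [map_mul, ha, hx i h₁ h₂, H.a_mul i h₁ h₂]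
    | b_mul i h₁ h₂ h₃ =>
      rw [map_mul, hb, hx i h₁ h₂, H.b_mul i h₁ h₂, Nat.even_iff.1 h₃, mul_zero, pow_zero, one_mul,
        hx _ (by omega) (by omega)]
    | x_mul i j h₁ h₂ h₃ h₄ =>
      rw [map_mul, map_mul, map_add, map_pow, map_extendX, map_extendX, ha, hb, hx i h₁ h₂,
        hx j h₃ h₄, H.x_mul i j h₁ h₂ h₃ h₄, extendX_congr _ _ hx (by omega),
        extendX_congr _ _ hx (by omega), pow_mul, hc]
  refine ⟨RingQuot.lift ⟨φ, hφ⟩, ?_, ?_, ?_, fun i h₁ h₂ => ?_⟩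
  · exact (RingQuot.lift_mkRingHom_apply φ hφ _).trans ha
  · exact (RingQuot.lift_mkRingHom_apply φ hφ _).trans hb
  · rw [map_pow, ← hc]
    exact congrArg (· ^ 2) ((RingQuot.lift_mkRingHom_apply φ hφ _).trans hb)
  · exact (RingQuot.lift_mkRingHom_apply φ hφ _).trans (hx i h₁ h₂)

/-- The involution of `OddRing` and its compatibility with fusion rings. -/
theorem exists_star [NeZero N] (hN : Odd N) (hn : Odd n) : ∃ σ : OddRing N n →+* OddRing N n,
    (σ a = a ∧ σ (b : (OddRing N n)ˣ) = (b⁻¹ : (OddRing N n)ˣ) ∧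
      ∀ i : ℕ, 1 ≤ i → i < n → σ (x i) =
        ((b ^ ((-1 : ℤ) ^ i - 1) : (OddRing N n)ˣ) : OddRing N n) * x i) ∧
    ∀ {R : Type w} [CommRing R] {star : R →+ R} (_ : DihedralFusionRing N n R star),
      ∃ f : OddRing N n ≃+* R, ∀ r, f (σ r) = star (f r) := by
  have H : IsFusionFamily N n a ((b : (OddRing N n)ˣ) : OddRing N n)
      ((b ^ 2 : (OddRing N n)ˣ) : OddRing N n) x := isFusionFamily hn
  obtain ⟨σ, hσa, hσb, hσc, hσx⟩ := exists_lift hn H.star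
  refine ⟨σ, ⟨hσa, hσb.trans ?_, fun i h₁ h₂ => ?_⟩, fun S => ?_⟩
  -- Here c = b², so bc⁻¹ = b⁻¹.
  · rw [Nat.odd_iff.1 hn, pow_one, ← Units.val_mul]
    congr 1
    rw [mul_inv_eq_iff_eq_mul, sq, inv_mul_cancel_left]
  · rw [hσx i h₁ h₂, zpow_neg_one_pow_sub_one, Units.val_pow_eq_pow_val]
  · obtain ⟨f, ha, hb, hc, hx⟩ := exists_lift hn (S.isFusionFamily hN)
    exact S.exists_ringEquiv hN H adjoin_eq_top f ha hb hc hx σ hσa hσb hσc hσx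

end OddRing

end

/-! ### Recognition of characters and planes, and eigenvalue identities -/

noncomputable section

namespace DihedralPresentation

open FDModule

variable {k : Type u} {A : Type v} [Field k] [Ring A] [Algebra k A] {N n : ℕ}
  {D : DihedralPresentation k A N n} {E : DihedralRoots k N n}

/-- A surjective homomorphism between spaces of equal dimension is an isomorphism. In the fusion
rules it therefore suffices to exhibit vectors that transform correctly and span. -/
theorem isIso_char {j : ℤ} {β τ : ℤˣ} {M : FDModule k A} {v : M.carrier}
    (hf : LinearMap.toSpanSingleton k M.carrier v ∈ homs (D.char E j β τ) M)
    (hv : ∀ y, ∃ r : k, r • v = y) (hd : Module.finrank k M.carrier = 1) :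
    IsIso M (D.char E j β τ) :=
  (isIso_of_surjective hf hv ((Module.finrank_self k).trans hd.symm)).symm

theorem isIso_plane {j i : ℤ} {M : FDModule k A} {v v' : M.carrier}
    (hf : pairMap v v' ∈ homs (D.plane E j i) M)
    (hv : ∀ y, y ∈ LinearMap.range (pairMap (k := k) v v'))
    (hd : Module.finrank k M.carrier = 2) : IsIso M (D.plane E j i) :=
  (isIso_of_surjective hf hv (by
    rw [hd]
    exact (Module.finrank_prod).trans (by rw [Module.finrank_self]))).symm

theorem isIso_plane_plane {j i j' i' : ℤ} {M : FDModule k A} {v v' y y' : M.carrier}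
    (hf : pairMap v v' ∈ homs (D.plane E j i) M) (hf' : pairMap y y' ∈ homs (D.plane E j' i') M)
    (hv : ∀ z, z ∈ LinearMap.range (pairMap (k := k) v v') ⊔ LinearMap.range (pairMap (k := k) y y'))
    (hd : Module.finrank k M.carrier = 4) :
    IsIso M (directSum (D.plane E j i) (D.plane E j' i')) := by
  refine (isIso_of_surjective (coprod_mem_homs hf hf') ?_ ?_).symm
  · rw [← LinearMap.range_eq_top, LinearMap.range_coprod]
    exact eq_top_iff.2 fun z _ => hv z
  · rw [hd]
    change Module.finrank k ((k × k) × (k × k)) = 4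
    simp

end DihedralPresentation

namespace DihedralPresentation

open FDModule

variable {k : Type u} {A : Type v} [Field k] [Ring A] [Algebra k A] {N n : ℕ}
  (D : DihedralPresentation k A N n) (E : DihedralRoots k N n)

theorem plane_act_h (j i : ℤ) (x : k × k) :
    (D.plane E j i).act D.h x = (E.hPlane j i : k) • x := D.planeRep_h E j i x

theorem plane_act_w_left (j i : ℤ) :
    (D.plane E j i).act D.w ((1, 0) : k × k) = ((E.ω ^ i : kˣ) : k) • ((1, 0) : k × k) :=
  (D.planeRep_w E j i _).trans (Prod.ext rfl (by simp))

theorem plane_act_w_right (j i : ℤ) :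
    (D.plane E j i).act D.w ((0, 1) : k × k) = ((E.ω ^ (-i) : kˣ) : k) • ((0, 1) : k × k) :=
  (D.planeRep_w E j i _).trans (Prod.ext (by simp) rfl)

/-- The factor 1 is written as a unit so that the formula fits the hypotheses of `GNn.tensor_act`.
-/
theorem plane_act_t (j i : ℤ) (x : k × k) :
    (D.plane E j i).act D.t x = ((1 : kˣ) : k) • (x.2, x.1) :=
  (D.planeRep_t E j i x).trans (one_smul k _).symm

end DihedralPresentation

theorem sgn_pow (k : Type u) [Field k] (s : ℕ) : sgn k ((-1) ^ s) = (-1) ^ s := by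
  rw [map_pow, sgn_neg_one]

namespace DihedralRoots

variable {k : Type u} [Field k] {N n : ℕ} (E : DihedralRoots k N n)

theorem hChar_mul (j j' : ℤ) (β β' : ℤˣ) :
    E.hChar j β * E.hChar j' β' = E.hChar (j + j') (β * β') := by
  rw [hChar, hChar, hChar, zpow_add, map_mul, mul_pow, mul_mul_mul_comm]

theorem hChar_neg_mul (j : ℤ) (β : ℤˣ) : (E.hChar (-j) β : k) * E.hChar j β = 1 := by
  rw [← Units.val_mul, hChar_mul, neg_add_cancel, Int.units_mul_self, hChar, map_one, one_pow,
    zpow_zero, mul_one, Units.val_one]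

theorem hChar_mul_hPlane (j j' i : ℤ) (s : ℕ) :
    E.hChar j ((-1) ^ s) * E.hPlane j' i = E.hPlane (j + j') (i + s * n) := by
  rw [hChar, hPlane, hPlane, sgn_pow, mul_mul_mul_comm, ← zpow_add, add_comm i, zpow_add (-1 : kˣ),
    ← Nat.cast_mul, zpow_natCast, pow_mul]

theorem hPlane_mul (i i' : ℤ) : E.hPlane 0 i * E.hPlane 0 i' = E.hPlane 0 (i + i') := by
  rw [hPlane, hPlane, hPlane, zpow_zero, one_mul, one_mul, one_mul, zpow_add]

theorem hPlane_neg (j i : ℤ) : E.hPlane j (-i) = E.hPlane j i := by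
  rw [hPlane, hPlane, zpow_neg, ← inv_zpow, inv_neg, inv_one]

theorem hPlane_inv (j i : ℤ) : (E.hPlane j i)⁻¹ = E.hPlane (-j) i := by
  rw [← hPlane_neg, hPlane, hPlane, mul_inv, zpow_neg, zpow_neg, inv_inv]

theorem hPlane_neg_mul (j i : ℤ) : (E.hPlane (-j) i : k) * E.hPlane j i = 1 := by
  rw [← E.hPlane_inv, Units.inv_mul]

theorem sgn_mul_ω (i : ℤ) (s : ℕ) : sgn k ((-1) ^ s) * E.ω ^ i = E.ω ^ (i + s * n) := by
  rw [sgn_pow, zpow_add, mul_comm, mul_comm (s : ℤ), zpow_mul, zpow_natCast,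
    zpow_natCast, E.ω_pow]

end DihedralRoots

section

variable {k : Type u} [Field k] {M : Type*} [AddCommGroup M] [Module k M]

theorem left_mem_range_pairMap (v v' : M) : v ∈ LinearMap.range (pairMap (k := k) v v') :=
  ⟨(1, 0), by simp⟩

theorem right_mem_range_pairMap (v : M) {v' y : M} (r : kˣ) (h : v' = (r : k) • y) :
    y ∈ LinearMap.range (pairMap (k := k) v v') :=
  ⟨(0, ((r⁻¹ : kˣ) : k)), by simp [h, smul_smul]⟩

theorem exists_smul_one_tmul_one (y : k ⊗[k] k) : ∃ r : k, r • ((1 : k) ⊗ₜ[k] (1 : k)) = y := by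
  refine ⟨TensorProduct.lid k k y, (TensorProduct.lid k k).injective ?_⟩
  simp

theorem mem_of_one_tmul {U : Submodule k (k ⊗[k] (k × k))} (h1 : (1 : k) ⊗ₜ (1, 0) ∈ U)
    (h2 : (1 : k) ⊗ₜ (0, 1) ∈ U) (y : k ⊗[k] (k × k)) : y ∈ U := by
  induction y with
  | zero => exact zero_mem _
  | add y z hy hz => exact add_mem hy hz
  | tmul x y =>
    have h : x ⊗ₜ[k] y = (x * y.1) • ((1 : k) ⊗ₜ[k] ((1, 0) : k × k)) +
        (x * y.2) • ((1 : k) ⊗ₜ[k] ((0, 1) : k × k)) := by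
      rw [mul_smul, mul_smul, ← smul_add, ← TensorProduct.tmul_smul, ← TensorProduct.tmul_smul,
        ← TensorProduct.tmul_add, TensorProduct.smul_tmul']
      simp
    rw [h]
    exact add_mem (U.smul_mem _ h1) (U.smul_mem _ h2)

theorem mem_of_tmul_one {U : Submodule k ((k × k) ⊗[k] k)} (h1 : (1, 0) ⊗ₜ (1 : k) ∈ U)
    (h2 : (0, 1) ⊗ₜ (1 : k) ∈ U) (y : (k × k) ⊗[k] k) : y ∈ U := by
  have h := mem_of_one_tmul (U := U.comap (TensorProduct.comm k k (k × k)).toLinearMap)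
    (by simpa using h1) (by simpa using h2) (TensorProduct.comm k (k × k) k y)
  simpa using h

theorem mem_of_tmul {U : Submodule k ((k × k) ⊗[k] (k × k))} (h1 : (1, 0) ⊗ₜ (1, 0) ∈ U)
    (h2 : (0, 1) ⊗ₜ (0, 1) ∈ U) (h3 : (1, 0) ⊗ₜ (0, 1) ∈ U) (h4 : (0, 1) ⊗ₜ (1, 0) ∈ U)
    (y : (k × k) ⊗[k] (k × k)) : y ∈ U := by
  induction y with
  | zero => exact zero_mem _
  | add y z hy hz => exact add_mem hy hz
  | tmul x y =>
    have hx (x : k × k) : x = x.1 • (1, 0) + x.2 • (0, 1) := by simp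
    rw [hx x, hx y]
    simp only [TensorProduct.add_tmul, TensorProduct.tmul_add, TensorProduct.tmul_smul,
      ← TensorProduct.smul_tmul']
    exact add_mem (add_mem (U.smul_mem _ (U.smul_mem _ h1)) (U.smul_mem _ (U.smul_mem _ h4)))
      (add_mem (U.smul_mem _ (U.smul_mem _ h3)) (U.smul_mem _ (U.smul_mem _ h2)))

theorem mem_of_fst_snd {U : Submodule k (Module.Dual k (k × k))} (h1 : LinearMap.fst k k k ∈ U)
    (h2 : LinearMap.snd k k k ∈ U) (y : Module.Dual k (k × k)) : y ∈ U := by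
  have h : y = y (1, 0) • LinearMap.fst k k k + y (0, 1) • LinearMap.snd k k k := by
    ext <;> simp
  rw [h]
  exact add_mem (U.smul_mem _ h1) (U.smul_mem _ h2)

end

/-! ### The group algebra -/

namespace GNn

open FDModule DihedralPresentation

variable {N n : ℕ}

theorem isDihedralTriple : IsDihedralTriple N n (PresentedGroup.of GNnGen.h : GNn N n)
    (PresentedGroup.of GNnGen.t) (PresentedGroup.of GNnGen.w) := by
  have h {x : FreeGroup GNnGen} (hx : x ∈ gNnRels N n) : PresentedGroup.mk (gNnRels N n) x = 1 :=
    PresentedGroup.one_of_mem hx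
  have h1 := h (x := FreeGroup.of GNnGen.t ^ 2) (by simp [gNnRels])
  have h2 := h (x := FreeGroup.of GNnGen.h ^ (2 * N)) (by simp [gNnRels])
  have h3 := h (x := FreeGroup.of GNnGen.w ^ n * (FreeGroup.of GNnGen.h ^ N)⁻¹) (by simp [gNnRels])
  have h4 := h (x := FreeGroup.of GNnGen.t * FreeGroup.of GNnGen.w *
    ((FreeGroup.of GNnGen.w)⁻¹ * FreeGroup.of GNnGen.t)⁻¹) (by simp [gNnRels])
  have h5 := h (x := FreeGroup.of GNnGen.h * FreeGroup.of GNnGen.t *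
    (FreeGroup.of GNnGen.t * FreeGroup.of GNnGen.h)⁻¹) (by simp [gNnRels])
  have h6 := h (x := FreeGroup.of GNnGen.h * FreeGroup.of GNnGen.w *
    (FreeGroup.of GNnGen.w * FreeGroup.of GNnGen.h)⁻¹) (by simp [gNnRels])
  simp only [map_mul, map_pow, map_inv, mul_inv_eq_one] at h1 h2 h3 h4 h5 h6
  exact ⟨h1, h2, h3, by
    rw [mul_assoc]
    exact (congrArg (_ * ·) h4).trans (mul_inv_cancel_left _ _), h5, h6⟩

variable {k : Type u} [Field k]

/-- In any monoid the relations force `h`, `t` and `w` to have finite order. They are thus units,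
and the group maps to the units of `B`. -/
theorem toGroup_rels [NeZero N] [NeZero n] {B : Type*} [Monoid B] {h t w : B}
    (H : IsDihedralTriple N n h t w) : ∃ f : GNn N n →* B, f (PresentedGroup.of GNnGen.h) = h ∧
      f (PresentedGroup.of GNnGen.t) = t ∧ f (PresentedGroup.of GNnGen.w) = w := by
  have hN : 2 * N ≠ 0 := mul_ne_zero two_ne_zero (NeZero.ne N)
  have hn : 2 * n ≠ 0 := mul_ne_zero two_ne_zero (NeZero.ne n)
  have hw : w ^ (2 * n) = 1 := by rw [mul_comm, pow_mul, H.w_pow, ← pow_mul, mul_comm, H.h_pow]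
  let g : GNnGen → Bˣ := fun x => match x with
    | .h => Units.ofPowEqOne h _ H.h_pow hN
    | .t => Units.ofPowEqOne t _ H.t_sq two_ne_zero
    | .w => Units.ofPowEqOne w _ hw hn
  have hg : ∀ r ∈ gNnRels N n, FreeGroup.lift g r = 1 := by
    intro r hr
    simp only [gNnRels, Set.mem_insert_iff, Set.mem_singleton_iff] at hr
    rcases hr with rfl | rfl | rfl | rfl | rfl | rfl <;>
      simp only [map_mul, map_pow, map_inv, FreeGroup.lift_apply_of, mul_inv_eq_one]
    · exact Units.ext H.t_sq
    · exact Units.ext H.h_pow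
    · exact Units.ext H.w_pow
    · rw [eq_inv_mul_iff_mul_eq, ← mul_assoc]
      exact Units.ext H.w_t_w
    · exact Units.ext H.h_t
    · exact Units.ext H.h_w
  refine ⟨(Units.coeHom B).comp (PresentedGroup.toGroup hg), ?_, ?_, ?_⟩ <;>
    rw [MonoidHom.comp_apply, PresentedGroup.toGroup.of] <;> rfl

/-- The generators have finite order, so their inverses are positive powers and the subalgebra that
they generate contains every group element. -/
theorem adjoin_eq_top [NeZero N] [NeZero n] : Algebra.adjoin k
    {MonoidAlgebra.of k (GNn N n) (PresentedGroup.of GNnGen.h),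
      MonoidAlgebra.of k (GNn N n) (PresentedGroup.of GNnGen.t),
      MonoidAlgebra.of k (GNn N n) (PresentedGroup.of GNnGen.w)} = ⊤ := by
  set S := Algebra.adjoin k
    {MonoidAlgebra.of k (GNn N n) (PresentedGroup.of GNnGen.h),
      MonoidAlgebra.of k (GNn N n) (PresentedGroup.of GNnGen.t),
      MonoidAlgebra.of k (GNn N n) (PresentedGroup.of GNnGen.w)} with hS
  let K : Subgroup (GNn N n) :=
    { carrier := {g | MonoidAlgebra.of k _ g ∈ S ∧ MonoidAlgebra.of k _ g⁻¹ ∈ S}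
      mul_mem' := fun {a b} ha hb => ⟨by rw [map_mul]; exact mul_mem ha.1 hb.1,
        by rw [mul_inv_rev, map_mul]; exact mul_mem hb.2 ha.2⟩
      one_mem' := ⟨by rw [map_one]; exact one_mem _, by rw [inv_one, map_one]; exact one_mem _⟩
      inv_mem' := fun {a} ha => ⟨ha.2, by rw [inv_inv]; exact ha.1⟩ }
  have H := isDihedralTriple (N := N) (n := n)
  have hK {g : GNn N n} {m : ℕ} (hm : m ≠ 0) (hg : g ^ m = 1)
      (h : MonoidAlgebra.of k _ g ∈ S) : g ∈ K := by
    refine ⟨h, ?_⟩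
    obtain ⟨l, rfl⟩ := Nat.exists_eq_succ_of_ne_zero hm
    rw [inv_eq_of_mul_eq_one_left ((pow_succ g l).symm.trans hg), map_pow]
    exact pow_mem h l
  have hw : (PresentedGroup.of GNnGen.w : GNn N n) ^ (2 * n) = 1 := by
    rw [mul_comm, pow_mul, H.w_pow, ← pow_mul, mul_comm, H.h_pow]
  have hall (g : GNn N n) : g ∈ K := by
    refine PresentedGroup.generated_by _ K (fun x => ?_) g
    cases x with
    | h =>
      exact hK (mul_ne_zero two_ne_zero (NeZero.ne N)) H.h_pow (Algebra.subset_adjoin (by simp))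
    | t => exact hK two_ne_zero H.t_sq (Algebra.subset_adjoin (by simp))
    | w => exact hK (mul_ne_zero two_ne_zero (NeZero.ne n)) hw (Algebra.subset_adjoin (by simp))
  refine eq_top_iff.2 fun x _ => ?_
  induction x using MonoidAlgebra.induction_on with
  | of g => exact (hall g).1
  | add f g hf hg => exact add_mem (hf trivial) (hg trivial)
  | smul r f hf => exact Subalgebra.smul_mem _ (hf trivial) r

/-- The presentation of the group algebra of `G_{Nn}`. -/
def presentation (k : Type u) [Field k] (N n : ℕ) [NeZero N] [NeZero n] :
    DihedralPresentation k (MonoidAlgebra k (GNn N n)) N n where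
  h := MonoidAlgebra.of k _ (PresentedGroup.of GNnGen.h)
  t := MonoidAlgebra.of k _ (PresentedGroup.of GNnGen.t)
  w := MonoidAlgebra.of k _ (PresentedGroup.of GNnGen.w)
  rel := isDihedralTriple.map _
  adjoin_eq_top := adjoin_eq_top
  lift H := MonoidAlgebra.lift k _ _ (toGroup_rels H).choose
  lift_h H := (MonoidAlgebra.lift_of _ _).trans (toGroup_rels H).choose_spec.1
  lift_t H := (MonoidAlgebra.lift_of _ _).trans (toGroup_rels H).choose_spec.2.1
  lift_w H := (MonoidAlgebra.lift_of _ _).trans (toGroup_rels H).choose_spec.2.2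

variable {G : Type*} [Group G] {V W : Type*} [AddCommGroup V] [Module k V] [AddCommGroup W]
  [Module k W]

theorem tensorRep_of (ρ : MonoidAlgebra k G →ₐ[k] Module.End k V)
    (σ : MonoidAlgebra k G →ₐ[k] Module.End k W) (g : G) (x : V) (y : W) :
    tensorRep ρ σ (MonoidAlgebra.of k G g) (x ⊗ₜ y) =
      ρ (MonoidAlgebra.of k G g) x ⊗ₜ σ (MonoidAlgebra.of k G g) y := by
  rw [tensorRep_apply, MonoidAlgebra.of_apply, MonoidAlgebra.comul_single]
  simp

theorem antipode_of (g : G) : HopfAlgebra.antipode k (MonoidAlgebra.of k G g) =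
    MonoidAlgebra.of k G g⁻¹ := by
  simp [MonoidAlgebra.antipode_single]

theorem counit_of (g : G) : Coalgebra.counit (R := k) (MonoidAlgebra.of k G g) = 1 := by
  simp

theorem tensor_act {V M : FDModule k (MonoidAlgebra k (GNn N n))} {g : GNn N n}
    {x x' : V.carrier} {v v' : M.carrier} {r s q : kˣ}
    (hx : V.act (MonoidAlgebra.of k _ g) x = (r : k) • x')
    (hv : M.act (MonoidAlgebra.of k _ g) v = (s : k) • v') (hq : r * s = q) :
    (tensor V M).act (MonoidAlgebra.of k _ g) (x ⊗ₜ v) = (q : k) • (x' ⊗ₜ[k] v') := by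
  change tensorRep V.act M.act _ _ = _
  rw [tensorRep_of, hx, hv, TensorProduct.smul_tmul_smul, ← hq, Units.val_mul]

/-- The hypothesis compares f with f' ∘ g instead of f ∘ g⁻¹ with f', so that no inverse has to be
computed. -/
theorem dual_act {V : FDModule k (MonoidAlgebra k (GNn N n))} {g : GNn N n}
    {f f' : Module.Dual k V.carrier} (h : ∀ x, f x = f' (V.act (MonoidAlgebra.of k _ g) x)) :
    (dual V).act (MonoidAlgebra.of k _ g) f = f' := by
  refine LinearMap.ext fun x => ?_
  change f (V.act (HopfAlgebra.antipode k (MonoidAlgebra.of k _ g)) x) = f' x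
  rw [antipode_of, h, ← Module.End.mul_apply, ← map_mul, ← map_mul, mul_inv_cancel, map_one,
    map_one, Module.End.one_apply]

variable [NeZero N] [NeZero n] (E : DihedralRoots k N n)

/-- Tensor products and duals of the irreducible representations of `G_{Nn}`. -/
theorem fusionRules : (presentation k N n).FusionRules E where
  trivial := by
    have h (g : GNn N n) : (trivialModule k (MonoidAlgebra k (GNn N n))).act
        (MonoidAlgebra.of k _ g) (1 : k) = ((1 : kˣ) : k) • (1 : k) := by
      change Coalgebra.counit (R := k) (MonoidAlgebra.of k _ g) * (1 : k) = _
      rw [counit_of]; simp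
    refine isIso_char (v := (1 : k)) (toSpanSingleton_mem_homs_of_eigenvector _ E
      ((h _).trans ?_) ((h _).trans ?_) ((h _).trans ?_))
      (fun y => ⟨y, mul_one y⟩) (Module.finrank_self k)
    · simp [DihedralRoots.hChar]
    · simp
    · simp
  char_char j j' β β' τ τ' :=
    isIso_char (v := (1 : k) ⊗ₜ (1 : k)) (toSpanSingleton_mem_homs_of_eigenvector _ E
      (tensor_act (charRep_h _ E _ _ _ _) (charRep_h _ E _ _ _ _) (E.hChar_mul _ _ _ _))
      (tensor_act (charRep_w _ E _ _ _ _) (charRep_w _ E _ _ _ _) (map_mul _ _ _).symm)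
      (tensor_act (charRep_t _ E _ _ _ _) (charRep_t _ E _ _ _ _) (map_mul _ _ _).symm))
      exists_smul_one_tmul_one (by
        change Module.finrank k (k ⊗[k] k) = 1
        simp)
  char_plane j j' i s τ := by
    -- The vector 1 ⊗ e₁ has `w`-eigenvalue (−1)^s ω^i = ω^{i+sn}, and `t` maps it to a multiple of
    -- 1 ⊗ e₂.
    refine isIso_plane (v := (1 : k) ⊗ₜ ((1, 0) : k × k)) (pairMap_mem_homs_of_eigenvector _ E
      (tensor_act (charRep_h _ E _ _ _ _) (plane_act_h _ E _ _ _) (E.hChar_mul_hPlane _ _ _ _))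
      (tensor_act (charRep_w _ E _ _ _ _) (plane_act_w_left _ E _ _) (E.sgn_mul_ω _ _)))
      (mem_of_one_tmul (left_mem_range_pairMap _ _) (right_mem_range_pairMap _ _
        (tensor_act (charRep_t _ E _ _ _ _) (plane_act_t _ E _ _ _) rfl))) ?_
    change Module.finrank k (k ⊗[k] (k × k)) = 2
    simp
  plane_char j j' i s τ := by
    refine isIso_plane (v := ((1, 0) : k × k) ⊗ₜ (1 : k)) (pairMap_mem_homs_of_eigenvector _ E
      (tensor_act (plane_act_h _ E _ _ _) (charRep_h _ E _ _ _ _)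
        ((mul_comm _ _).trans (E.hChar_mul_hPlane _ _ _ _)))
      (tensor_act (plane_act_w_left _ E _ _) (charRep_w _ E _ _ _ _)
        ((mul_comm _ _).trans (E.sgn_mul_ω _ _))))
      (mem_of_tmul_one (left_mem_range_pairMap _ _) (right_mem_range_pairMap _ _
        (tensor_act (plane_act_t _ E _ _ _) (charRep_t _ E _ _ _ _) rfl))) ?_
    change Module.finrank k ((k × k) ⊗[k] k) = 2
    simp
  plane_plane i j := by
    -- The vectors e₁ ⊗ e₁ and e₁ ⊗ e₂ have `w`-eigenvalues ω^{i+j} and ω^{i−j}, and `t` maps them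
    -- to e₂ ⊗ e₂ and e₂ ⊗ e₁.
    refine isIso_plane_plane (v := ((1, 0) : k × k) ⊗ₜ ((1, 0) : k × k))
      (y := ((1, 0) : k × k) ⊗ₜ ((0, 1) : k × k))
      (pairMap_mem_homs_of_eigenvector _ E
        (tensor_act (plane_act_h _ E _ _ _) (plane_act_h _ E _ _ _) (E.hPlane_mul _ _))
        (tensor_act (plane_act_w_left _ E _ _) (plane_act_w_left _ E _ _) (zpow_add _ _ _).symm))
      (pairMap_mem_homs_of_eigenvector _ E
        (tensor_act (plane_act_h _ E _ _ _) (plane_act_h _ E _ _ _)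
          (by rw [sub_eq_add_neg, ← E.hPlane_mul, E.hPlane_neg]))
        (tensor_act (plane_act_w_left _ E _ _) (plane_act_w_right _ E _ _)
          (by rw [sub_eq_add_neg, zpow_add])))
      (mem_of_tmul (Submodule.mem_sup_left (left_mem_range_pairMap _ _))
        (Submodule.mem_sup_left (right_mem_range_pairMap _ _
          (tensor_act (plane_act_t _ E _ _ _) (plane_act_t _ E _ _ _) rfl)))
        (Submodule.mem_sup_right (left_mem_range_pairMap _ _))
        (Submodule.mem_sup_right (right_mem_range_pairMap _ _
          (tensor_act (plane_act_t _ E _ _ _) (plane_act_t _ E _ _ _) rfl)))) ?_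
    change Module.finrank k ((k × k) ⊗[k] (k × k)) = 4
    simp
  dual_char j β τ := by
    refine isIso_char (v := (LinearMap.id : k →ₗ[k] k)) (toSpanSingleton_mem_homs_of_eigenvector _ E
      (dual_act fun x => ?_) (dual_act fun x => ?_) (dual_act fun x => ?_))
      (fun y => ⟨y (1 : k), LinearMap.ext_ring (by simp)⟩) ?_
    · change x = _ * ((presentation k N n).charRep E j β τ (presentation k N n).h x)
      rw [charRep_h, ← mul_assoc, E.hChar_neg_mul, one_mul]
    · change x = _ * ((presentation k N n).charRep E j β τ (presentation k N n).w x)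
      rw [charRep_w, ← mul_assoc, ← Units.val_mul, ← sq, sgn_sq, Units.val_one, one_mul]
    · change x = _ * ((presentation k N n).charRep E j β τ (presentation k N n).t x)
      rw [charRep_t, ← mul_assoc, ← Units.val_mul, ← sq, sgn_sq, Units.val_one, one_mul]
    · change Module.finrank k (Module.Dual k k) = 1
      simp
  dual_plane j i := by
    -- Dualising inverts eigenvalues, so the functional with `w`-eigenvalue ω^i is the second
    -- coordinate.
    refine isIso_plane (v := LinearMap.snd k k k) (pairMap_mem_homs_of_eigenvector _ E
      (dual_act fun x => ?_) (dual_act fun x => ?_))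
      (mem_of_fst_snd (right_mem_range_pairMap _ 1
        (dual_act fun x => ?_)) (left_mem_range_pairMap _ _)) ?_
    · change x.2 = _ * ((presentation k N n).planeRep E j i (presentation k N n).h x).2
      rw [planeRep_h, ← mul_assoc, E.hPlane_neg_mul, one_mul]
    · change x.2 = _ * ((presentation k N n).planeRep E j i (presentation k N n).w x).2
      rw [planeRep_w, ← mul_assoc, ← Units.val_mul, ← zpow_add, add_neg_cancel, zpow_zero,
        Units.val_one, one_mul]
    · change x.2 = ((1 : kˣ) : k) *
        ((presentation k N n).planeRep E j i (presentation k N n).t x).1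
      rw [planeRep_t, Units.val_one, one_mul]
    · change Module.finrank k (Module.Dual k (k × k)) = 2
      simp

end GNn

end

noncomputable section

/-! ### The Hopf algebras `A_{Nn}` -/

theorem add_pow_succ_of_mul_eq_zero {B : Type*} [Ring B] {x y : B} (h1 : x * y = 0)
    (h2 : y * x = 0) (m : ℕ) : (x + y) ^ (m + 1) = x ^ (m + 1) + y ^ (m + 1) := by
  induction m with
  | zero => simp
  | succ m ih =>
    rw [pow_succ', ih, add_mul, mul_add, mul_add, pow_succ' x m, pow_succ' y m, ← mul_assoc x y,
      h1, ← mul_assoc y x, h2, zero_mul, zero_mul, add_zero, zero_add, ← pow_succ' x m,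
      ← pow_succ' y m, ← pow_succ', ← pow_succ']

theorem altWord_add {B : Type*} [Ring B] {p q r s : B} (h1 : p * s = 0) (h2 : r * q = 0)
    (h3 : q * r = 0) (h4 : s * p = 0) (m : ℕ) :
    altWord (p + r) (q + s) (m + 1) = altWord p q (m + 1) + altWord r s (m + 1) := by
  induction m generalizing p q r s with
  | zero => simp [altWord]
  | succ m ih =>
    rw [altWord, ih h3 h4 h1 h2]
    have e1 : p * altWord s r (m + 1) = 0 := by rw [altWord, ← mul_assoc, h1, zero_mul]
    have e2 : r * altWord q p (m + 1) = 0 := by rw [altWord, ← mul_assoc, h2, zero_mul]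
    rw [altWord.eq_2 p q (m + 1), altWord.eq_2 r s (m + 1)]
    simp [add_mul, mul_add, e1, e2]

/-- If `TpT = p`, then the two alternating words in `p` and `Tp` differ by a power of `T`. -/
theorem altWord_mul_left {B : Type*} [Monoid B] {T p : B} (h : T * p * T = p) (m : ℕ) :
    altWord (T * p) p m = T ^ m * altWord p (T * p) m := by
  -- Moving a power of `T` past `p` inverts it, which is expressed here without inverses.
  have hm (m : ℕ) : T ^ m * p * T ^ m = p := by
    induction m with
    | zero => simp
    | succ m ih =>
      calc T ^ (m + 1) * p * T ^ (m + 1) = T * (T ^ m * p * T ^ m) * T := by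
            rw [pow_succ' T m]
            nth_rewrite 2 [← pow_succ']
            rw [pow_succ T m]
            simp only [mul_assoc]
        _ = p := by rw [ih, h]
  induction m with
  | zero => simp [altWord]
  | succ m ih =>
    rw [altWord, altWord, ih, mul_assoc T, pow_succ' T m]
    simp only [← mul_assoc]
    rw [mul_assoc T (T ^ m) p, mul_assoc T (T ^ m * p), hm]

/-- Alternating words in `ep` and `eq` for a commuting idempotent `e`. -/
theorem altWord_idempotent_mul {B : Type*} [Monoid B] {e p q : B} (he : e * e = e)
    (hp : Commute e p) (hq : Commute e q) (m : ℕ) :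
    altWord (e * p) (e * q) (m + 1) = e * altWord p q (m + 1) := by
  induction m generalizing p q with
  | zero => simp [altWord]
  | succ m ih =>
    rw [altWord, ih hq hp, altWord.eq_2 p q, mul_assoc, ← mul_assoc p, ← hp.eq]
    simp only [← mul_assoc]
    rw [he]

theorem isUnit_altWord {B : Type*} [Monoid B] {p q : B} (hp : IsUnit p) (hq : IsUnit q) (m : ℕ) :
    IsUnit (altWord p q m) := by
  induction m generalizing p q with
  | zero => exact isUnit_one
  | succ m ih => exact hp.mul (ih hq hp)

section Group

variable {G : Type*} [Group G] {N n : ℕ} {p q g : G}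

/-- As `N` is odd, g^N = g, and 2N divides N(N + 1). -/
theorem mul_pow_succ_pow (hN : Odd N) (hp : p ^ (2 * N) = 1) (hg : g ^ 2 = 1) (hgp : Commute g p) :
    (g * p ^ (N + 1)) ^ N = g := by
  obtain ⟨m, rfl⟩ := hN
  rw [(hgp.pow_right _).mul_pow, ← pow_mul, pow_succ g, pow_mul g, hg, one_pow, one_mul,
    show (2 * m + 1 + 1) * (2 * m + 1) = 2 * (2 * m + 1) * (m + 1) by ring, pow_mul, hp, one_pow,
    mul_one]

/-- Put T = qp⁻¹. From p² = q² one gets TpT = p, and even powers of `p`, such as p^{N+1}, commute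
with `q`. The factor gⁿ in `w` corrects Tⁿ = g^{n+1}: the exponent n² + n + 1 is odd, so wⁿ = g =
h^N. -/
theorem isDihedralTriple_of_sq_eq_sq (hN : Odd N) (hpq : p ^ 2 = q ^ 2) (hp : p ^ (2 * N) = 1)
    (hg : g ^ 2 = 1) (hgp : Commute g p) (hgq : Commute g q) (hT : (q * p⁻¹) ^ n = g ^ (n + 1)) :
    IsDihedralTriple N n (g * p ^ (N + 1)) (p ^ N) (g ^ n * (q * p⁻¹)) := by
  have hgT : Commute g (q * p⁻¹) := hgq.mul_right hgp.inv_right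
  have hTpT : q * p⁻¹ * p * (q * p⁻¹) = p := by
    rw [inv_mul_cancel_right, ← mul_assoc, ← sq, ← hpq, sq, mul_inv_cancel_right]
  have hz : ∀ m, Commute (p ^ (2 * m)) (q * p⁻¹) := by
    intro m
    rw [pow_mul]
    refine Commute.pow_left (Commute.mul_right ?_ ?_) m
    · rw [hpq]; exact Commute.pow_self q 2
    · exact (Commute.pow_self p 2).inv_right
  obtain ⟨m, hm⟩ := hN
  refine ⟨?_, ?_, ?_, ?_, ?_, ?_⟩
  · rw [← pow_mul, mul_comm, hp]
  · rw [mul_comm 2 N, pow_mul, mul_pow_succ_pow ⟨m, hm⟩ hp hg hgp, hg]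
  · rw [mul_pow_succ_pow ⟨m, hm⟩ hp hg hgp, (hgT.pow_left n).mul_pow, hT, ← pow_mul, ← pow_add]
    obtain ⟨l, hl⟩ : ∃ l, n * n + (n + 1) = 2 * l + 1 := by
      obtain ⟨l, hl⟩ := Nat.even_mul_succ_self n
      exact ⟨l, by rw [Nat.mul_succ] at hl; omega⟩
    rw [hl, pow_succ, pow_mul, hg, one_pow, one_mul]
  · have h1 : Commute (g ^ n) (q * p⁻¹ * p ^ N) := (hgT.mul_right (hgp.pow_right N)).pow_left n
    have h2 : q * p⁻¹ * p ^ N * (q * p⁻¹) = p ^ N := by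
      rw [hm, pow_succ', ← mul_assoc (q * p⁻¹), mul_assoc _ _ (q * p⁻¹), (hz m).eq, ← mul_assoc,
        hTpT]
    rw [mul_assoc (g ^ n), ← mul_assoc, mul_assoc (g ^ n), mul_assoc, ← h1.eq, mul_assoc,
      mul_assoc, ← mul_assoc (g ^ n) (g ^ n), ← pow_add, ← two_mul, pow_mul, hg, one_pow, one_mul,
      ← mul_assoc, h2]
  · exact ((hgp.pow_right N).mul_left (Commute.pow_pow_self p _ _)).eq
  · have h1 : p ^ (N + 1) = p ^ (2 * (m + 1)) := by rw [hm]; rfl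
    rw [h1]
    exact (((Commute.refl g).pow_right n).mul_right hgT).mul_left
      (((hgp.pow_right _).symm.pow_right n).mul_right (hz _))

end Group

/-- The sign `λ` in the definition of `A_{Nn}`. -/
abbrev suzukiSign (n : ℕ) : ℤˣ := if Odd n then 1 else -1

namespace IsSuzukiFamily

variable {B : Type*} [Ring B] {N n : ℕ} {x : Fin 2 → Fin 2 → B}

/-- The dihedral triple of a family with the relations of `A_{Nn}`, with `g = x₁₁^{2N} - x₁₂^{2N}`. -/
theorem exists_units [NeZero N] [NeZero n] (hx : IsSuzukiFamily N n (suzukiSign n) x) :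
    ∃ p q g : Bˣ, (p : B) = x 0 0 + x 0 1 ∧ (q : B) = x 1 1 + x 1 0 ∧
      (g : B) = x 0 0 ^ (2 * N) - x 0 1 ^ (2 * N) ∧ p ^ 2 = q ^ 2 ∧ p ^ (2 * N) = 1 ∧ g ^ 2 = 1 ∧
      Commute g p ∧ Commute g q ∧ (q * p⁻¹) ^ n = g ^ (n + 1) ∧
      ((g : B) * p = x 0 0 - x 0 1) ∧ ((g : B) * q = x 1 1 - x 1 0) := by
  obtain ⟨M, hM⟩ : ∃ M, 2 * N = M + 1 :=
    Nat.exists_eq_succ_of_ne_zero (by have := NeZero.ne N; omega)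
  have h01 : x 0 0 * x 0 1 = 0 := hx.mixed _ _ _ _ (by decide)
  have h02 : x 0 0 * x 1 0 = 0 := hx.mixed _ _ _ _ (by decide)
  have h10 : x 0 1 * x 0 0 = 0 := hx.mixed _ _ _ _ (by decide)
  have h13 : x 0 1 * x 1 1 = 0 := hx.mixed _ _ _ _ (by decide)
  have h20 : x 1 0 * x 0 0 = 0 := hx.mixed _ _ _ _ (by decide)
  have h23 : x 1 0 * x 1 1 = 0 := hx.mixed _ _ _ _ (by decide)
  have h31 : x 1 1 * x 0 1 = 0 := hx.mixed _ _ _ _ (by decide)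
  have h32 : x 1 1 * x 1 0 = 0 := hx.mixed _ _ _ _ (by decide)
  set e := x 0 0 ^ (2 * N) with he
  set f := x 0 1 ^ (2 * N) with hf
  have hef : e + f = 1 := hx.unit
  have he' : e = x 1 1 ^ (2 * N) := (hx.pow_x11 N).symm
  have hf' : f = x 1 0 ^ (2 * N) := (hx.pow_x10 N).symm
  have zl {a b : B} (h : a * b = 0) : a ^ (2 * N) * b = 0 := by
    rw [hM, pow_succ, mul_assoc, h, mul_zero]
  have zr {a b : B} (h : a * b = 0) : a * b ^ (2 * N) = 0 := by
    rw [hM, pow_succ', ← mul_assoc, h, zero_mul]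
  have hef0 : e * f = 0 := zl (zr h01)
  have hfe0 : f * e = 0 := zl (zr h10)
  have hee : e * e = e := by
    calc e * e = e * (e + f) := by rw [mul_add, hef0, add_zero]
      _ = e := by rw [hef, mul_one]
  have hff : f * f = f := by
    calc f * f = (e + f) * f := by rw [add_mul, hef0, zero_add]
      _ = f := by rw [hef, one_mul]
  have hP2 : (x 0 0 + x 0 1) ^ 2 = (x 1 1 + x 1 0) ^ 2 := by
    rw [add_pow_succ_of_mul_eq_zero h01 h10 1, add_pow_succ_of_mul_eq_zero h32 h23 1, hx.sq_diag,
      hx.sq_off]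
  have hP : (x 0 0 + x 0 1) ^ (2 * N) = 1 := by
    rw [hM, add_pow_succ_of_mul_eq_zero h01 h10 M, ← hM]
    exact hef
  have hQ : (x 1 1 + x 1 0) ^ (2 * N) = 1 := by rw [pow_mul, ← hP2, ← pow_mul, hP]
  have hg : (e - f) ^ 2 = 1 := by
    rw [sq, sub_mul, mul_sub, mul_sub, hef0, hfe0, hee, hff, ← hef]
    abel
  have hN0 : 2 * N ≠ 0 := by omega
  have hl {a : B} (ha : f * a = 0) : e * a = a := by
    rw [← add_zero (e * a), ← ha, ← add_mul, hef, one_mul]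
  have hl' {a : B} (ha : e * a = 0) : f * a = a := by
    rw [← zero_add (f * a), ← ha, ← add_mul, hef, one_mul]
  have hr {a : B} (ha : a * f = 0) : a * e = a := by
    rw [← add_zero (a * e), ← ha, ← mul_add, hef, mul_one]
  have hr' {a : B} (ha : a * e = 0) : a * f = a := by
    rw [← zero_add (a * f), ← ha, ← mul_add, hef, mul_one]
  -- The idempotents `e` and `f` are the identity on the diagonal and on the off-diagonal generators
  -- respectively, and vanish on the others. Hence g = e − f commutes with `p` and `q` and changes
  -- the sign of the off-diagonal parts.
  have e0 : e * x 0 1 = 0 := zl h01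
  have f0 : f * x 0 0 = 0 := zl h10
  have e1 : e * x 1 0 = 0 := zl h02
  have f1 : f * x 1 1 = 0 := zl h13
  have e0' : x 0 1 * e = 0 := zr h10
  have f0' : x 0 0 * f = 0 := zr h01
  have e1' : x 1 0 * e = 0 := zr h20
  have f1' : x 1 1 * f = 0 := zr h31
  have gp : (e - f) * (x 0 0 + x 0 1) = x 0 0 - x 0 1 := by
    simp [sub_eq_add_neg, add_mul, mul_add, e0, f0, hl f0, hl' e0]
  have gq : (e - f) * (x 1 1 + x 1 0) = x 1 1 - x 1 0 := by
    simp [sub_eq_add_neg, add_mul, mul_add, e1, f1, hl f1, hl' e1]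
  have pg : (x 0 0 + x 0 1) * (e - f) = x 0 0 - x 0 1 := by
    simp only [mul_sub, add_mul, e0', f0', hr f0', hr' e0']
    abel
  have qg : (x 1 1 + x 1 0) * (e - f) = x 1 1 - x 1 0 := by
    simp only [mul_sub, add_mul, e1', f1', hr f1', hr' e1']
    abel
  refine ⟨Units.ofPowEqOne _ _ hP hN0, Units.ofPowEqOne _ _ hQ hN0,
    Units.ofPowEqOne _ _ hg two_ne_zero, rfl, rfl, rfl, Units.ext hP2, Units.ext hP, Units.ext hg,
    Units.ext (gp.trans pg.symm), Units.ext (gq.trans qg.symm), ?_, gp, gq⟩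
  set p := Units.ofPowEqOne _ _ hP hN0 with hp
  set q := Units.ofPowEqOne _ _ hQ hN0 with hq
  set g := Units.ofPowEqOne _ _ hg two_ne_zero with hgu
  have hpq2 : p ^ 2 = q ^ 2 := Units.ext hP2
  have hTpT : q * p⁻¹ * p * (q * p⁻¹) = p := by
    rw [inv_mul_cancel_right, ← mul_assoc, ← sq, ← hpq2, sq, mul_inv_cancel_right]
  -- The words qpq⋯ and pqp⋯ differ by Tⁿ. By the alternating relations they also differ by 1 on the
  -- diagonal part and by λ on the off-diagonal part. The words are units, so Tⁿ = e + λf, which is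
  -- g^{n+1} because λ = (−1)^{n+1}.
  have hw := altWord_mul_left hTpT n
  rw [inv_mul_cancel_right] at hw
  have hw' := congrArg (Units.coeHom B) hw
  rw [map_mul, map_altWord, map_altWord] at hw'
  change altWord (x 1 1 + x 1 0) (x 0 0 + x 0 1) n = (((q * p⁻¹) ^ n : Bˣ) : B) *
    altWord (x 0 0 + x 0 1) (x 1 1 + x 1 0) n at hw'
  have hu : IsUnit (altWord (x 0 0 + x 0 1) (x 1 1 + x 1 0) n) :=
    isUnit_altWord p.isUnit q.isUnit n
  refine Units.ext (hu.mul_right_cancel (hw'.symm.trans ?_))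
  obtain ⟨m, hm⟩ := Nat.exists_eq_succ_of_ne_zero (NeZero.ne n)
  have a1 : altWord (x 1 1 + x 1 0) (x 0 0 + x 0 1) n =
      altWord (x 0 0) (x 1 1) n + ((suzukiSign n : ℤˣ) : ℤ) • altWord (x 0 1) (x 1 0) n := by
    rw [← hx.alt_off, hx.alt_diag, hm]
    exact altWord_add h31 h20 h02 h13 m
  have a2 : altWord (x 0 0 + x 0 1) (x 1 1 + x 1 0) n =
      altWord (x 0 0) (x 1 1) n + altWord (x 0 1) (x 1 0) n := by
    rw [hm]
    exact altWord_add h02 h13 h31 h20 m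
  rw [a1, a2]
  by_cases hn : Odd n
  · have h1 : g ^ (n + 1) = 1 := by
      obtain ⟨l, hl⟩ := hn.add_one
      rw [hl, ← two_mul, pow_mul, show g ^ 2 = 1 from Units.ext hg, one_pow]
    rw [h1, suzukiSign, if_pos hn]
    simp
  · have h1 : ((g ^ (n + 1) : Bˣ) : B) = e - f := by
      obtain ⟨l, hl⟩ := Nat.not_odd_iff_even.1 hn
      rw [hl, ← two_mul, pow_succ, pow_mul, show g ^ 2 = 1 from Units.ext hg, one_pow, one_mul]
      rfl
    rw [h1, suzukiSign, if_neg hn, hm, altWord, altWord, mul_add, sub_mul, sub_mul, ← mul_assoc,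
      ← mul_assoc, ← mul_assoc, ← mul_assoc, e0, f0, hl f0, hl' e0]
    simp [sub_eq_add_neg]

end IsSuzukiFamily

/-- A dihedral triple gives a family with the relations of `A_{Nn}`. -/
theorem IsDihedralTriple.isSuzukiFamily {B : Type*} [Ring B] {N n : ℕ} [NeZero n] {h t w e f : B}
    (hN : Odd N) (H : IsDihedralTriple N n h t w) (hef : e + f = 1) (heg : e - f = h ^ N)
    (hee : e * e = e) (hff : f * f = f) (he : ∀ x, Commute h x → Commute e x)
    (hf : ∀ x, Commute h x → Commute f x) :
    IsSuzukiFamily N n (suzukiSign n) fun i j => (if i = j then e else f) *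
      (if i = 0 then t * h ^ (N + 1) else (h ^ N) ^ n * w * (t * h ^ (N + 1))) := by
  set P := t * h ^ (N + 1) with hP
  set g := h ^ N with hg
  set T := g ^ n * w with hT
  have hht : Commute h t := H.h_t
  have hhw : Commute h w := H.h_w
  have hhP : Commute h P := hht.mul_right (Commute.self_pow h _)
  have hhT : Commute h T := ((Commute.self_pow h N).pow_right n).mul_right hhw
  have hg2 : g ^ 2 = 1 := by rw [hg, ← pow_mul, mul_comm, H.h_pow]
  have hef0 : e * f = 0 := by
    calc e * f = e * (e + f) - e * e := by rw [mul_add]; abel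
      _ = 0 := by rw [hef, hee, mul_one, sub_self]
  have hfe0 : f * e = 0 := by
    calc f * e = f * (e + f) - f * f := by rw [mul_add]; abel
      _ = 0 := by rw [hef, hff, mul_one, sub_self]
  -- The idempotents `e` and `f` project to the parts where `h^N` is 1 and −1; they cut P and Q = TP
  -- into the diagonal and off-diagonal generators.
  have hfg : f * g = -f := by rw [← heg, mul_sub, hfe0, hff, zero_sub]
  have heg' : e * g = e := by rw [← heg, mul_sub, hef0, hee, sub_zero]
  have hTPT : T * P * T = P := by
    have h1 : Commute (h ^ (N + 1)) w := hhw.pow_left _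
    have h2 : Commute (g ^ n) (w * P) := ((hhw.mul_right hhP).pow_left N).pow_left n
    calc T * P * T = g ^ n * (w * P) * (g ^ n * w) := by rw [hT]; simp only [mul_assoc]
      _ = g ^ n * g ^ n * (w * P * w) := by
        rw [mul_assoc, ← mul_assoc (w * P), ← h2.eq]; simp only [mul_assoc]
      _ = w * t * w * h ^ (N + 1) := by
        rw [← pow_add, ← two_mul, pow_mul, hg2, one_pow, one_mul, hP, mul_assoc, mul_assoc t, h1.eq]
        simp only [mul_assoc]
      _ = P := by rw [H.w_t_w]
  -- By wⁿ = g the left side is g^{n²+1}, and n² + n is even.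
  have hTn : T ^ n = g ^ (n + 1) := by
    have h1 : Commute (g ^ n) w := (hhw.pow_left N).pow_left n
    obtain ⟨l, hl⟩ : ∃ l, n * n + n = 2 * l := by
      obtain ⟨l, hl⟩ := Nat.even_mul_succ_self n
      exact ⟨l, by rw [Nat.mul_succ] at hl; omega⟩
    calc T ^ n = g ^ (n * n) * g := by rw [hT, h1.mul_pow, H.w_pow, ← pow_mul]
      _ = g ^ (n * n) * g * (g ^ 2) ^ n := by rw [hg2, one_pow, mul_one]
      _ = g ^ (n * n + n) * g ^ (n + 1) := by
        rw [← pow_succ, ← pow_mul g, ← pow_add, ← pow_add]; congr 1; ring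
      _ = g ^ (n + 1) := by rw [hl, pow_mul, hg2, one_pow, one_mul]
  have hQ2 : (T * P) ^ 2 = P ^ 2 := by rw [sq, ← mul_assoc, hTPT, sq]
  have hP2 : P ^ (2 * N) = 1 := by
    rw [hP, (hht.symm.pow_right _).mul_pow, pow_mul, H.t_sq, one_pow, one_mul, ← pow_mul, mul_comm,
      pow_mul, H.h_pow, one_pow]
  have hhQ : Commute h (T * P) := hhT.mul_right hhP
  have hw : altWord (T * P) P n = g ^ (n + 1) * altWord P (T * P) n := by
    rw [altWord_mul_left hTPT, hTn]
  obtain ⟨m, hm⟩ := Nat.exists_eq_succ_of_ne_zero (NeZero.ne n)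
  have zero {a b p q : B} (hab : a * b = 0) (hb : Commute b p) : a * p * (b * q) = 0 := by
    rw [mul_assoc, ← mul_assoc p, ← hb.eq, ← mul_assoc, ← mul_assoc, hab, zero_mul, zero_mul]
  refine ⟨?_, ?_, ?_, ?_, ?_, ?_⟩
  · simp [(he _ hhP).mul_pow, (he _ hhQ).mul_pow, hQ2]
  · simp [(hf _ hhP).mul_pow, (hf _ hhQ).mul_pow, hQ2]
  · intro i j l m hij
    have hc : ∀ i : Fin 2, Commute h (if i = 0 then P else T * P) := fun i => by
      split_ifs
      exacts [hhP, hhQ]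
    by_cases h1 : i = j
    · have h2 : l ≠ m := by rintro rfl; simp [h1] at hij
      simp only [h1, h2, if_true, if_false]
      exact zero hef0 (hf _ (hc _))
    · have h2 : l = m := by revert h1 hij; revert i j l m; decide
      simp only [h1, h2, if_true, if_false]
      exact zero hfe0 (he _ (hc _))
  · have h1 : (2 * N) ≠ 0 := by obtain ⟨l, rfl⟩ := hN; omega
    have h2 {a : B} (ha : a * a = a) : a ^ (2 * N) = a :=
      (show IsIdempotentElem a from ha).pow_eq h1
    simp [(he _ hhP).mul_pow, (hf _ hhP).mul_pow, hP2, h2 hee, h2 hff, hef]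
  · have h1 := altWord_idempotent_mul hee (he _ hhP) (he _ hhQ) m
    have h2 := altWord_idempotent_mul hee (he _ hhQ) (he _ hhP) m
    rw [← Nat.succ_eq_add_one, ← hm] at h1 h2
    have h3 (m : ℕ) : e * g ^ m = e := by
      induction m with
      | zero => simp
      | succ m ih => rw [pow_succ, ← mul_assoc, ih, heg']
    simp only [if_true, Fin.one_eq_zero_iff, OfNat.ofNat_ne_one, if_false]
    rw [h1, h2, hw, ← mul_assoc e, h3]
  · have h1 := altWord_idempotent_mul hff (hf _ hhP) (hf _ hhQ) m
    have h2 := altWord_idempotent_mul hff (hf _ hhQ) (hf _ hhP) m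
    rw [← Nat.succ_eq_add_one, ← hm] at h1 h2
    simp only [if_true, Fin.zero_eq_one_iff, Fin.one_eq_zero_iff, OfNat.ofNat_ne_one, if_false]
    rw [h1, h2, hw, ← mul_assoc f]
    -- On the part cut out by `f`, the element `g^{n+1}` acts by (−1)^{n+1}, which is the sign λ.
    by_cases hn : Odd n
    · obtain ⟨l, hl⟩ := hn.add_one
      rw [suzukiSign, if_pos hn, hl, ← two_mul, pow_mul, hg2, one_pow]
      simp
    · obtain ⟨l, hl⟩ := Nat.not_odd_iff_even.1 hn
      rw [suzukiSign, if_neg hn, pow_succ, hl, ← two_mul, pow_mul, hg2, one_pow, one_mul, hfg]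
      simp

end

/-! ### A_{Nn} as an algebra presented by a dihedral triple -/

noncomputable section

namespace ANn

variable {k : Type u} [Field k] {N n : ℕ}

/-- The generators `x_{ij}` of `A_{Nn}`. -/
abbrev x (i j : Fin 2) : ANn k N n := SuzukiAlgebra.x i j

theorem isSuzukiFamily : IsSuzukiFamily N n (suzukiSign n) (x (k := k) (N := N) (n := n)) :=
  SuzukiAlgebra.isSuzukiFamily_x

theorem adjoin_x : Algebra.adjoin k {a : ANn k N n | ∃ i j, a = x i j} = ⊤ := by
  refine eq_top_iff.2 fun a _ => ?_
  induction a using SuzukiAlgebra.induction with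
  | hx i j => exact Algebra.subset_adjoin ⟨i, j, rfl⟩
  | hr r => exact Subalgebra.algebraMap_mem _ r
  | hadd a b ha hb => exact add_mem (ha trivial) (hb trivial)
  | hmul a b ha hb => exact mul_mem (ha trivial) (hb trivial)

variable [NeZero N] [NeZero n]

/-- The unit `x₁₁ + x₁₂`. -/
def p : (ANn k N n)ˣ := isSuzukiFamily.exists_units.choose

/-- The unit `x₂₂ + x₂₁`. -/
def q : (ANn k N n)ˣ := isSuzukiFamily.exists_units.choose_spec.choose

/-- The central involution `x₁₁^{2N} - x₁₂^{2N}`. -/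
def g : (ANn k N n)ˣ := isSuzukiFamily.exists_units.choose_spec.choose_spec.choose

theorem units_spec : ((p : (ANn k N n)ˣ) : ANn k N n) = x 0 0 + x 0 1 ∧
    ((q : (ANn k N n)ˣ) : ANn k N n) = x 1 1 + x 1 0 ∧
    ((g : (ANn k N n)ˣ) : ANn k N n) = x 0 0 ^ (2 * N) - x 0 1 ^ (2 * N) ∧
    (p : (ANn k N n)ˣ) ^ 2 = q ^ 2 ∧ (p : (ANn k N n)ˣ) ^ (2 * N) = 1 ∧
    (g : (ANn k N n)ˣ) ^ 2 = 1 ∧ Commute (g : (ANn k N n)ˣ) p ∧ Commute (g : (ANn k N n)ˣ) q ∧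
    ((q : (ANn k N n)ˣ) * p⁻¹) ^ n = g ^ (n + 1) ∧
    ((g : (ANn k N n)ˣ) : ANn k N n) * ((p : (ANn k N n)ˣ) : ANn k N n) = x 0 0 - x 0 1 ∧
    ((g : (ANn k N n)ˣ) : ANn k N n) * ((q : (ANn k N n)ˣ) : ANn k N n) = x 1 1 - x 1 0 :=
  isSuzukiFamily.exists_units.choose_spec.choose_spec.choose_spec

variable (k N n) in
theorem isDihedralTriple (hN : Odd N) : IsDihedralTriple N n (g * p ^ (N + 1) : (ANn k N n)ˣ)
    (p ^ N) (g ^ n * (q * p⁻¹)) :=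
  isDihedralTriple_of_sq_eq_sq hN units_spec.2.2.2.1 units_spec.2.2.2.2.1 units_spec.2.2.2.2.2.1
    units_spec.2.2.2.2.2.2.1 units_spec.2.2.2.2.2.2.2.1 units_spec.2.2.2.2.2.2.2.2.1

variable (k N n) in
theorem mul_pow_succ_pow (hN : Odd N) : ((g : (ANn k N n)ˣ) * p ^ (N + 1)) ^ N = g :=
  _root_.mul_pow_succ_pow hN units_spec.2.2.2.2.1 units_spec.2.2.2.2.2.1
    units_spec.2.2.2.2.2.2.1

/-- This recovers p as th^{N+1}: from h^N = g one gets h^{N+1} = g²p^{N+1} = p^{N+1}, and p^{2N+1} =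
p. -/
theorem p_eq (hN : Odd N) : (p : (ANn k N n)ˣ) = p ^ N * (g * p ^ (N + 1)) ^ (N + 1) := by
  rw [pow_succ (g * p ^ (N + 1)), mul_pow_succ_pow k N n hN, ← mul_assoc g, ← sq,
    units_spec.2.2.2.2.2.1, one_mul, ← pow_add, ← add_assoc, ← two_mul, pow_succ,
    units_spec.2.2.2.2.1, one_mul]

theorem q_eq : (q : (ANn k N n)ˣ) = g ^ n * (g ^ n * (q * p⁻¹)) * p := by
  rw [← mul_assoc, ← pow_add, ← two_mul, pow_mul, units_spec.2.2.2.2.2.1, one_pow, one_mul,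
    inv_mul_cancel_right]

-- The triple yields g = h^N, then p and q. Multiplication by g flips the sign of the off-diagonal
-- generators, so the x_{ij} are half the sums and differences of p, gp and of q, gq.
variable (k N n) in
theorem adjoin_eq_top (h2 : (2 : k) ≠ 0) (hN : Odd N) : Algebra.adjoin k
    {((g * p ^ (N + 1) : (ANn k N n)ˣ) : ANn k N n), ((p ^ N : (ANn k N n)ˣ) : ANn k N n),
      ((g ^ n * (q * p⁻¹) : (ANn k N n)ˣ) : ANn k N n)} = ⊤ := by
  rw [← top_le_iff, ← adjoin_x, Algebra.adjoin_le_iff]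
  set S := Algebra.adjoin k
    {((g * p ^ (N + 1) : (ANn k N n)ˣ) : ANn k N n), ((p ^ N : (ANn k N n)ˣ) : ANn k N n),
      ((g ^ n * (q * p⁻¹) : (ANn k N n)ˣ) : ANn k N n)} with hS
  have hh : ((g * p ^ (N + 1) : (ANn k N n)ˣ) : ANn k N n) ∈ S := Algebra.subset_adjoin (by simp)
  have ht : ((p ^ N : (ANn k N n)ˣ) : ANn k N n) ∈ S := Algebra.subset_adjoin (by simp)
  have hw : ((g ^ n * (q * p⁻¹) : (ANn k N n)ˣ) : ANn k N n) ∈ S :=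
    Algebra.subset_adjoin (by simp)
  have hp : ((p : (ANn k N n)ˣ) : ANn k N n) ∈ S := by
    rw [p_eq hN, Units.val_mul, Units.val_pow_eq_pow_val (g * p ^ (N + 1))]
    exact mul_mem ht (pow_mem hh _)
  have hg : ((g : (ANn k N n)ˣ) : ANn k N n) ∈ S := by
    rw [← mul_pow_succ_pow k N n hN, Units.val_pow_eq_pow_val (g * p ^ (N + 1))]
    exact pow_mem hh _
  have hq : ((q : (ANn k N n)ˣ) : ANn k N n) ∈ S := by
    rw [q_eq, Units.val_mul, Units.val_mul, Units.val_pow_eq_pow_val]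
    exact mul_mem (mul_mem (pow_mem hg _) hw) hp
  obtain ⟨hP, hQ, -, -, -, -, -, -, -, hgP, hgQ⟩ := units_spec (k := k) (N := N) (n := n)
  have half {a b : ANn k N n} (hab : a + b ∈ S) (hab' : a - b ∈ S) : a ∈ S ∧ b ∈ S := by
    have ha : a = (2 : k)⁻¹ • ((a + b) + (a - b)) := by
      rw [add_add_sub_cancel, ← two_smul k a, smul_smul, inv_mul_cancel₀ h2, one_smul]
    have haS : a ∈ S := ha ▸ S.smul_mem (add_mem hab hab') _
    exact ⟨haS, by simpa using sub_mem hab haS⟩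
  obtain ⟨h00, h01⟩ := half (hP ▸ hp) (hgP ▸ mul_mem hg hp)
  obtain ⟨h11, h10⟩ := half (hQ ▸ hq) (hgQ ▸ mul_mem hg hq)
  rintro a ⟨i, j, rfl⟩
  fin_cases i <;> fin_cases j
  exacts [h00, h01, h10, h11]

/-- The idempotents (1 ± h^N)/2 turn the triple into a family with the relations of A_{Nn}. The
induced map sends g to h^N, p to th^{N+1} and q to h^{Nn}w times the image of p, from which the
images of the three generators follow. -/
theorem exists_lift (h2 : (2 : k) ≠ 0) (hN : Odd N) {B : Type*} [Ring B] [Algebra k B]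
    {h t w : B} (H : IsDihedralTriple N n h t w) : ∃ f : ANn k N n →ₐ[k] B,
      f (g * p ^ (N + 1) : (ANn k N n)ˣ) = h ∧ f (p ^ N : (ANn k N n)ˣ) = t ∧
      f (g ^ n * (q * p⁻¹) : (ANn k N n)ˣ) = w := by
  have hs (a : B) : (2 : k)⁻¹ • a + (2 : k)⁻¹ • a = a := by
    rw [← two_smul k, smul_smul, mul_inv_cancel₀ h2, one_smul]
  set c := h ^ N with hc
  have hc2 : c * c = 1 := by rw [← sq, hc, ← pow_mul, mul_comm, H.h_pow]
  set e := (2 : k)⁻¹ • (1 + c) with he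
  set f := (2 : k)⁻¹ • (1 - c) with hf
  have hef : e + f = 1 := by
    rw [he, hf, ← smul_add, add_add_sub_cancel, smul_add, hs]
  have hec : e - f = c := by
    rw [he, hf, ← smul_sub, add_sub_sub_cancel, smul_add, hs]
  have hee : e * e = e := by
    rw [he, smul_mul_smul_comm, add_mul, one_mul, mul_add, mul_one, hc2, add_comm c 1, ← two_smul k,
      smul_smul, mul_assoc, inv_mul_cancel₀ h2, mul_one]
  have hff : f * f = f := by
    rw [hf, smul_mul_smul_comm, sub_mul, one_mul, mul_sub, mul_one, hc2,
      show 1 - c - (c - 1) = (1 - c) + (1 - c) by abel, ← two_smul k,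
      smul_smul, mul_assoc, inv_mul_cancel₀ h2, mul_one]
  have hfam := H.isSuzukiFamily hN hef hec hee hff
    (fun x hx => ((Commute.one_left x).add_left (hx.pow_left N)).smul_left _)
    (fun x hx => ((Commute.one_left x).sub_left (hx.pow_left N)).smul_left _)
  let F : ANn k N n →ₐ[k] B := SuzukiAlgebra.lift _ hfam
  have hF (i j : Fin 2) : F (x i j) = (if i = j then e else f) *
      (if i = 0 then t * h ^ (N + 1) else c ^ n * w * (t * h ^ (N + 1))) :=
    SuzukiAlgebra.lift_x _ _ _ _
  obtain ⟨hP, hQ, hG, -⟩ := units_spec (k := k) (N := N) (n := n)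
  have hht : Commute h t := H.h_t
  have hFp : F (p : (ANn k N n)ˣ) = t * h ^ (N + 1) := by
    rw [hP, map_add, hF, hF]
    simp [← add_mul, hef]
  have hFq : F (q : (ANn k N n)ˣ) = c ^ n * w * (t * h ^ (N + 1)) := by
    rw [hQ, map_add, hF, hF]
    simp [← add_mul, hef]
  have hP2 : (t * h ^ (N + 1)) ^ (2 * N) = 1 := by
    rw [(hht.symm.pow_right _).mul_pow, pow_mul, H.t_sq, one_pow, one_mul, ← pow_mul, mul_comm,
      pow_mul, H.h_pow, one_pow]
  have hhP : Commute h (t * h ^ (N + 1)) := hht.mul_right (Commute.self_pow h _)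
  have hN0 : 2 * N ≠ 0 := mul_ne_zero two_ne_zero (NeZero.ne N)
  have hFg : F (g : (ANn k N n)ˣ) = c := by
    have he1 : Commute e (t * h ^ (N + 1)) :=
      ((Commute.one_left _).add_left (hhP.pow_left N)).smul_left _
    have hf1 : Commute f (t * h ^ (N + 1)) :=
      ((Commute.one_left _).sub_left (hhP.pow_left N)).smul_left _
    have h3 {a : B} (ha : a * a = a) : a ^ (2 * N) = a :=
      (show IsIdempotentElem a from ha).pow_eq hN0
    rw [hG, map_sub, map_pow, map_pow, hF, hF]
    simp [he1.mul_pow, hf1.mul_pow, hP2, h3 hee, h3 hff, hec]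
  refine ⟨F, ?_, ?_, ?_⟩
  · obtain ⟨l, hl⟩ := hN
    have h1 : t ^ (N + 1) = 1 := by
      rw [hl, show 2 * l + 1 + 1 = 2 * (l + 1) by ring, pow_mul, H.t_sq, one_pow]
    rw [Units.val_mul, Units.val_pow_eq_pow_val, map_mul, map_pow, hFg, hFp,
      (hht.symm.pow_right _).mul_pow, h1, one_mul, hc, ← pow_mul, ← pow_add,
      show N + (N + 1) * (N + 1) = 2 * N * (l + 2) + 1 by rw [hl]; ring, pow_succ, pow_mul,
      H.h_pow, one_pow, one_mul]
  · obtain ⟨l, hl⟩ := hN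
    rw [Units.val_pow_eq_pow_val, map_pow, hFp, (hht.symm.pow_right _).mul_pow, ← pow_mul,
      show (N + 1) * N = 2 * N * (l + 1) by rw [hl]; ring, pow_mul, H.h_pow, one_pow, mul_one]
    conv_lhs => rw [hl, pow_succ, pow_mul, H.t_sq, one_pow, one_mul]
  -- The image of `p` is a unit, so the image of `w` can be read off from that of `gⁿq` by
  -- cancellation.
  · have hu : IsUnit (t * h ^ (N + 1)) := IsUnit.of_pow_eq_one hP2 hN0
    refine hu.mul_right_cancel ?_
    conv_lhs => rw [← hFp]
    rw [← map_mul, ← Units.val_mul, mul_assoc, inv_mul_cancel_right, Units.val_mul,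
      Units.val_pow_eq_pow_val, map_mul, map_pow, hFg, hFq, ← mul_assoc, ← mul_assoc (c ^ n) (c ^ n),
      ← pow_add, ← two_mul, pow_mul, sq c, hc2, one_pow, one_mul]

/-- The presentation of `A_{Nn}` by a dihedral triple. -/
def presentation (h2 : (2 : k) ≠ 0) (hN : Odd N) : DihedralPresentation k (ANn k N n) N n where
  h := (g * p ^ (N + 1) : (ANn k N n)ˣ)
  t := (p ^ N : (ANn k N n)ˣ)
  w := (g ^ n * (q * p⁻¹) : (ANn k N n)ˣ)
  rel := (isDihedralTriple k N n hN).map (Units.coeHom _)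
  adjoin_eq_top := adjoin_eq_top k N n h2 hN
  lift H := (exists_lift h2 hN H).choose
  lift_h H := (exists_lift h2 hN H).choose_spec.1
  lift_t H := (exists_lift h2 hN H).choose_spec.2.1
  lift_w H := (exists_lift h2 hN H).choose_spec.2.2

end ANn

end

/-! ### The action of the generators x_{ij} on the irreducible modules -/

noncomputable section

theorem exists_neg_one_zpow_eq {G : Type*} [Group G] [HasDistribNeg G] (i : ℤ) :
    ∃ d : Fin 2, (-1 : G) ^ i = (-1) ^ (d : ℕ) := by
  rcases Int.even_or_odd i with hi | hi
  · exact ⟨0, by simp [hi.neg_one_zpow]⟩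
  · exact ⟨1, by simp [hi.neg_one_zpow]⟩

theorem neg_one_pow_fin_add {G : Type*} [Monoid G] [HasDistribNeg G] (d e : Fin 2) :
    (-1 : G) ^ ((d + e : Fin 2) : ℕ) = (-1) ^ (d : ℕ) * (-1) ^ (e : ℕ) := by
  fin_cases d <;> fin_cases e <;> simp

theorem eq_add_or_eq_add_add_one (l m d : Fin 2) : m = l + d ∨ m = l + d + 1 := by decide +revert

theorem sub_add_add_one_ne (l d : Fin 2) : l - (l + d + 1) ≠ 0 - d := by decide +revert

theorem neg_one_zpow_pow {G : Type*} [Group G] [HasDistribNeg G] (i : ℤ) (n : ℕ) :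
    ((-1 : G) ^ i) ^ n = ((-1) ^ n) ^ i := by
  rw [← zpow_natCast, zpow_comm, zpow_natCast]

theorem pow_apply_of_eigen {k A V : Type*} [Field k] [Ring A] [Algebra k A] [AddCommGroup V]
    [Module k V] {ρ : A →ₐ[k] Module.End k V} {a : A} {η : kˣ} (h : ∀ v, ρ a v = (η : k) • v)
    (m : ℕ) (v : V) : ρ (a ^ m) v = ((η ^ m : kˣ) : k) • v := by
  induction m generalizing v with
  | zero => simp
  | succ m ih =>
    rw [pow_succ, map_mul, Module.End.mul_apply, h, map_smul, ih, smul_smul, pow_succ,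
      Units.val_mul, mul_comm]

/-- `h^N` contributes the sign once more, and it cancels. Hence p = th^{N+1} acts as ζ^j t. -/
theorem DihedralRoots.hPlane_pow_succ {k : Type*} [Field k] {N n : ℕ} (E : DihedralRoots k N n)
    (j i : ℤ) : E.hPlane j i ^ (N + 1) = E.ζ ^ j := by
  rw [pow_succ, E.hPlane_pow, hPlane, mul_left_comm, ← sq, neg_one_zpow_sq, mul_one]

theorem DihedralRoots.hChar_pow_succ {k : Type*} [Field k] {N n : ℕ} (E : DihedralRoots k N n)
    (j : ℤ) (β : ℤˣ) : E.hChar j β ^ (N + 1) = E.ζ ^ j := by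
  rw [pow_succ, E.hChar_pow, hChar, mul_left_comm, ← sq, pow_right_comm, sgn_sq, one_pow, mul_one]

namespace DihedralRoots

variable {k : Type u} [Field k] {N n : ℕ}

/-- The `i`-th power of `(-1)ⁿω`. -/
def theta (E : DihedralRoots k N n) (i : ℤ) : kˣ := ((-1) ^ n * E.ω) ^ i

theorem theta_add (E : DihedralRoots k N n) (i j : ℤ) : E.theta (i + j) = E.theta i * E.theta j := zpow_add _ _ _

theorem theta_sub (E : DihedralRoots k N n) (i j : ℤ) : E.theta (i - j) = E.theta i * (E.theta j)⁻¹ := zpow_sub _ _ _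

/-- The `n`-th power of (−1)ⁿω is (−1)^{n²+1} = (−1)^{n+1}. -/
theorem theta_add_mul (E : DihedralRoots k N n) (i : ℤ) (s : ℕ) :
    E.theta (i + s * n) = sgn k ((-1) ^ s) ^ (n + 1) * E.theta i := by
  have h : ((-1 : kˣ) ^ n * E.ω) ^ n = (-1) ^ (n + 1) := by
    rw [mul_pow, E.ω_pow, ← pow_mul, pow_succ]
    rcases Nat.even_or_odd n with hn | hn
    · rw [(hn.mul_left n).neg_one_pow, hn.neg_one_pow]
    · rw [(hn.mul hn).neg_one_pow, hn.neg_one_pow]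
  rw [theta_add, mul_comm, sgn_pow, theta, mul_comm (s : ℤ), zpow_mul, zpow_natCast, zpow_natCast,
    h, pow_right_comm]

end DihedralRoots

namespace ANn

open FDModule DihedralPresentation

theorem pow_add_pow {k : Type u} [Field k] {N n : ℕ} (i j : Fin 2) :
    x j i ^ (2 * N) + x j (i + 1) ^ (2 * N) = (1 : ANn k N n) := by
  have hx := isSuzukiFamily (k := k) (N := N) (n := n)
  have h1 := hx.pow_x11 N
  have h0 := hx.pow_x10 N
  have hu := hx.unit
  fin_cases i <;> fin_cases j
  · exact hu
  · exact (congrArg₂ _ h0 h1).trans ((add_comm _ _).trans hu)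
  · exact (add_comm _ _).trans hu
  · exact (congrArg₂ _ h1 h0).trans hu

variable {k : Type u} [Field k] {N n : ℕ} [NeZero N] [NeZero n] (h2 : (2 : k) ≠ 0) (hN : Odd N)

/-- The action of the generators `x_{ij}` on a module on which `h` acts by a scalar. -/
theorem act_x {V : Type*} [AddCommGroup V] [Module k V] (ρ : ANn k N n →ₐ[k] Module.End k V)
    {η : kˣ} {d : Fin 2} (hη : ∀ v, ρ (presentation h2 hN).h v = (η : k) • v)
    (hd : η ^ N = (-1) ^ (d : ℕ)) (v : V) :
    (∀ i, ρ (x i (i + d + 1)) v = 0) ∧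
    ρ (x 0 d) v = ((η ^ (N + 1) : kˣ) : k) • ρ (presentation h2 hN).t v ∧
    ρ (x 1 (1 + d)) v = ((η ^ (N + 1) * (η ^ N) ^ n : kˣ) : k) •
      ρ (presentation h2 hN).w (ρ (presentation h2 hN).t v) := by
  have hpow := pow_apply_of_eigen hη
  have hg (v : V) : ρ (g : (ANn k N n)ˣ) v = ((η ^ N : kˣ) : k) • v := by
    rw [← hpow, ← mul_pow_succ_pow k N n hN, Units.val_pow_eq_pow_val]
    rfl
  have hgpow := pow_apply_of_eigen hg
  have hp (v : V) : ρ (p : (ANn k N n)ˣ) v =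
      ((η ^ (N + 1) : kˣ) : k) • ρ (presentation h2 hN).t v := by
    rw [p_eq hN, Units.val_mul, Units.val_pow_eq_pow_val (g * p ^ (N + 1)), map_mul,
      Module.End.mul_apply, ← map_smul, ← hpow]
    rfl
  have hq (v : V) : ρ (q : (ANn k N n)ˣ) v = ((η ^ (N + 1) * (η ^ N) ^ n : kˣ) : k) •
      ρ (presentation h2 hN).w (ρ (presentation h2 hN).t v) := by
    rw [q_eq, Units.val_mul, Units.val_mul, map_mul, map_mul, Module.End.mul_apply,
      Module.End.mul_apply, hp, map_smul, map_smul, Units.val_pow_eq_pow_val g, hgpow, smul_smul,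
      ← Units.val_mul]
    rfl
  obtain ⟨hP, hQ, -, -, -, -, -, -, -, hgP, hgQ⟩ := units_spec (k := k) (N := N) (n := n)
  -- Since g acts by ±1, comparing gp = x₁₁ − x₁₂ with p = x₁₁ + x₁₂ kills one of the two generators
  -- in the row, and the other acts as p. The second row works in the same way with q.
  have hgP' : ρ (x 0 0) v - ρ (x 0 1) v = ((η ^ N : kˣ) : k) • (ρ (x 0 0) v + ρ (x 0 1) v) := by
    rw [← LinearMap.sub_apply, ← map_sub, ← hgP, map_mul, Module.End.mul_apply, hg, hP, map_add]
    rfl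
  have hgQ' : ρ (x 1 1) v - ρ (x 1 0) v = ((η ^ N : kˣ) : k) • (ρ (x 1 1) v + ρ (x 1 0) v) := by
    rw [← LinearMap.sub_apply, ← map_sub, ← hgQ, map_mul, Module.End.mul_apply, hg, hQ, map_add]
    rfl
  rw [← hp, ← hq, hP, hQ, map_add, map_add, LinearMap.add_apply, LinearMap.add_apply]
  rw [hd] at hgP' hgQ'
  have z {a : V} (ha : a + a = 0) : a = 0 := by
    rw [← two_smul k] at ha
    exact (smul_eq_zero.1 ha).resolve_left h2
  have z1 {a b : V} (h : a - b = a + b) : b = 0 := z (by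
    rw [sub_eq_add_neg, add_right_inj] at h
    exact add_eq_zero_iff_neg_eq.2 h)
  have z2 {a b : V} (h : a - b = -(a + b)) : a = 0 := z (by
    rw [neg_add, sub_eq_add_neg, add_left_inj] at h
    exact add_eq_zero_iff_eq_neg.2 h)
  fin_cases d
  · have h1 := z1 (hgP'.trans (by simp))
    have h3 := z1 (hgQ'.trans (by simp))
    rw [h1, h3, add_zero, add_zero]
    refine ⟨fun i => ?_, rfl, rfl⟩
    fin_cases i
    exacts [h1, h3]
  · have h1 := z2 (hgP'.trans (by rw [← neg_one_smul k]; simp))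
    have h3 := z2 (hgQ'.trans (by rw [← neg_one_smul k]; simp))
    rw [h1, h3, zero_add, zero_add]
    refine ⟨fun i => ?_, rfl, rfl⟩
    fin_cases i
    exacts [h1, h3]

variable {E : DihedralRoots k N n}

section Plane

variable {i : ℤ} {d : Fin 2} (hd : (-1 : kˣ) ^ i = (-1) ^ (d : ℕ)) (j : ℤ)
include hd

theorem plane_act_zero (y : k × k) (l : Fin 2) :
    ((presentation h2 hN).plane E j i).act (x l (l + d + 1)) y = 0 :=
  (act_x h2 hN _ ((presentation h2 hN).plane_act_h E j i) ((E.hPlane_pow j i).trans hd) y).1 l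

theorem plane_act_p (y : k × k) : ((presentation h2 hN).plane E j i).act (x 0 d) y =
    ((E.ζ ^ j : kˣ) : k) • (y.2, y.1) := by
  refine (act_x h2 hN _ ((presentation h2 hN).plane_act_h E j i)
    ((E.hPlane_pow j i).trans hd) y).2.1.trans ?_
  rw [planeRep_t, E.hPlane_pow_succ]

/-- The surviving generator of the second row acts as ζ^j(−1)^{in}wt. The sign and the eigenvalue of
`w` combine to a power of (−1)ⁿω, whence `theta`. -/
theorem plane_act_q_left : ((presentation h2 hN).plane E j i).act (x 1 (1 + d)) ((1, 0) : k × k) =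
    ((E.ζ ^ j * (E.theta i)⁻¹ : kˣ) : k) • ((0, 1) : k × k) := by
  refine (act_x h2 hN _ ((presentation h2 hN).plane_act_h E j i)
    ((E.hPlane_pow j i).trans hd) _).2.2.trans ?_
  rw [planeRep_t, plane_act_w_right, smul_smul, ← Units.val_mul, E.hPlane_pow_succ, E.hPlane_pow,
    DihedralRoots.theta, mul_zpow, mul_inv, ← zpow_neg, ← zpow_neg, mul_assoc]
  rw [neg_one_zpow_pow, zpow_neg ((-1) ^ n), ← inv_zpow ((-1) ^ n), ← inv_pow, inv_neg, inv_one,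
    zpow_neg]

theorem plane_act_q_right : ((presentation h2 hN).plane E j i).act (x 1 (1 + d)) ((0, 1) : k × k) =
    ((E.ζ ^ j * E.theta i : kˣ) : k) • ((1, 0) : k × k) := by
  refine (act_x h2 hN _ ((presentation h2 hN).plane_act_h E j i)
    ((E.hPlane_pow j i).trans hd) _).2.2.trans ?_
  rw [planeRep_t, plane_act_w_left, smul_smul, ← Units.val_mul, E.hPlane_pow_succ, E.hPlane_pow,
    DihedralRoots.theta, mul_zpow, mul_assoc]
  rw [neg_one_zpow_pow]

/-- Three values determine the module structure. The fourth follows from the equality of the squares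
of `x 0 d` and `x 1 (1 + d)`, and the mixed relations make the other two generators vanish on the
images of `x 0 d`, which include `v` and `v'`. The scalar `c` absorbs the normalisation of the
basis. -/
theorem pairMap_smul_mem_homs {M : FDModule k (ANn k N n)} {v v' : M.carrier} {c : kˣ}
    (h0 : M.act (x 0 d) v = ((E.ζ ^ j * c : kˣ) : k) • v')
    (h0' : M.act (x 0 d) v' = ((E.ζ ^ j * c⁻¹ : kˣ) : k) • v)
    (h1 : M.act (x 1 (1 + d)) v' = ((E.ζ ^ j * (E.theta i * c⁻¹) : kˣ) : k) • v) :
    pairMap v ((c : k) • v') ∈ homs ((presentation h2 hN).plane E j i) M := by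
  have mul (a b : ANn k N n) (v : M.carrier) : M.act a (M.act b v) = M.act (a * b) v := by
    rw [map_mul]; rfl
  have hx := isSuzukiFamily (k := k) (N := N) (n := n)
  have hsq : x 1 (1 + d) * x 1 (1 + d) = (x 0 d * x 0 d : ANn k N n) := by
    rw [← sq, ← sq]
    fin_cases d
    exacts [hx.sq_diag.symm, hx.sq_off.symm]
  have hz (l : Fin 2) : x l (l + d + 1) * x 0 d = (0 : ANn k N n) :=
    hx.mixed _ _ _ _ (sub_add_add_one_ne l d)
  have z {l : Fin 2} {u u' : M.carrier} {r : kˣ} (h : M.act (x 0 d) u = (r : k) • u') :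
      M.act (x l (l + d + 1)) u' = 0 := by
    have h' : u' = ((r⁻¹ : kˣ) : k) • M.act (x 0 d) u := by
      rw [h, smul_smul, Units.inv_mul, one_smul]
    rw [h', map_smul, mul, hz, map_zero, LinearMap.zero_apply, smul_zero]
  have h1' : M.act (x 1 (1 + d)) v = ((E.ζ ^ j * ((E.theta i)⁻¹ * c) : kˣ) : k) • v' := by
    have h : v = (((E.ζ ^ j * (E.theta i * c⁻¹))⁻¹ : kˣ) : k) • M.act (x 1 (1 + d)) v' := by
      rw [h1, smul_smul, Units.inv_mul, one_smul]
    rw [h, map_smul, mul, hsq, ← mul, h0', map_smul, h0, smul_smul, smul_smul, ← Units.val_mul,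
      ← Units.val_mul]
    congr 2
    ext
    push_cast
    field_simp
  refine (presentation h2 hN).pairMap_mem_homs E adjoin_x ?_
  rintro a ⟨l, m, rfl⟩
  have hP := plane_act_p h2 hN hd (E := E) j
  have hQ := plane_act_q_left h2 hN hd (E := E) j
  have hQ' := plane_act_q_right h2 hN hd (E := E) j
  have hZ := plane_act_zero h2 hN hd (E := E) j
  have hc : (c : k) * ((c⁻¹ : kˣ) : k) = 1 := Units.mul_inv c
  obtain rfl | rfl : m = l + d ∨ m = l + d + 1 := eq_add_or_eq_add_add_one l m d
  · obtain rfl | rfl : l = 0 ∨ l = 1 := by revert l; decide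
    · rw [zero_add, hP, hP, map_smul, map_smul, map_smul (M.act _), h0, h0']
      simp only [pairMap_apply, Units.val_mul, smul_smul, zero_smul, one_smul, zero_add, one_mul,
        zero_mul, add_zero, true_and]
      rw [mul_left_comm, hc, mul_one]
    · rw [hQ, hQ', map_smul, map_smul, map_smul (M.act _), h1, h1']
      simp only [pairMap_apply, Units.val_mul, smul_smul, zero_smul, one_smul, zero_add, add_zero,
        mul_assoc, one_mul, zero_mul, true_and]
      rw [mul_left_comm (c : k), mul_left_comm (c : k), hc, mul_one]
  · rw [hZ, hZ, map_zero, map_smul, z h0, z h0', smul_zero]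
    exact ⟨rfl, rfl⟩

end Plane

section Char

variable {β : ℤˣ} {d : Fin 2} (hd : sgn k β ^ n = (-1) ^ (d : ℕ)) (j : ℤ) (τ : ℤˣ)
include hd

theorem char_act_zero (y : k) (l : Fin 2) :
    ((presentation h2 hN).char E j β τ).act (x l (l + d + 1)) y = 0 :=
  (act_x h2 hN _ ((presentation h2 hN).charRep_h E j β τ) ((E.hChar_pow j β).trans hd) y).1 l

theorem char_act_p (y : k) : ((presentation h2 hN).char E j β τ).act (x 0 d) y =
    ((E.ζ ^ j * sgn k τ : kˣ) : k) • y := by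
  refine (act_x h2 hN _ ((presentation h2 hN).charRep_h E j β τ)
    ((E.hChar_pow j β).trans hd) y).2.1.trans ?_
  rw [charRep_t, E.hChar_pow_succ, smul_eq_mul, smul_eq_mul, ← mul_assoc, Units.val_mul]

theorem char_act_q (y : k) : ((presentation h2 hN).char E j β τ).act (x 1 (1 + d)) y =
    ((E.ζ ^ j * sgn k τ * sgn k β ^ (n + 1) : kˣ) : k) • y := by
  refine (act_x h2 hN _ ((presentation h2 hN).charRep_h E j β τ)
    ((E.hChar_pow j β).trans hd) y).2.2.trans ?_
  -- n² and n have the same parity; with the eigenvalue β of `w` this gives βⁿ⁺¹.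
  have h : (sgn k β ^ n) ^ n = sgn k β ^ n := by
    rcases Int.units_eq_one_or β with rfl | rfl
    · simp
    · rw [sgn_neg_one, ← pow_mul]
      rcases Nat.even_or_odd n with hn | hn
      · rw [(hn.mul_left n).neg_one_pow, hn.neg_one_pow]
      · rw [(hn.mul hn).neg_one_pow, hn.neg_one_pow]
  rw [charRep_t, charRep_w, E.hChar_pow_succ, E.hChar_pow, h, smul_eq_mul, smul_eq_mul, pow_succ]
  simp only [Units.val_mul]
  ring

theorem toSpanSingleton_mem_homs_of_act {M : FDModule k (ANn k N n)} {v : M.carrier}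
    (h0 : M.act (x 0 d) v = ((E.ζ ^ j * sgn k τ : kˣ) : k) • v)
    (h1 : M.act (x 1 (1 + d)) v = ((E.ζ ^ j * sgn k τ * sgn k β ^ (n + 1) : kˣ) : k) • v) :
    LinearMap.toSpanSingleton k M.carrier v ∈ homs ((presentation h2 hN).char E j β τ) M := by
  have hx := isSuzukiFamily (k := k) (N := N) (n := n)
  have hz (l : Fin 2) : M.act (x l (l + d + 1)) v = 0 := by
    have h : v = (((E.ζ ^ j * sgn k τ)⁻¹ : kˣ) : k) • M.act (x 0 d) v := by
      rw [h0, smul_smul, Units.inv_mul, one_smul]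
    rw [h, map_smul, ← Module.End.mul_apply, ← map_mul,
      hx.mixed _ _ _ _ (sub_add_add_one_ne l d), map_zero, LinearMap.zero_apply, smul_zero]
  refine (presentation h2 hN).toSpanSingleton_mem_homs E adjoin_x ?_
  rintro a ⟨l, m, rfl⟩
  have hP := char_act_p h2 hN hd (E := E) j τ
  have hQ := char_act_q h2 hN hd (E := E) j τ
  have hZ := char_act_zero h2 hN hd (E := E) j τ
  obtain rfl | rfl : m = l + d ∨ m = l + d + 1 := eq_add_or_eq_add_add_one l m d
  · obtain rfl | rfl : l = 0 ∨ l = 1 := by revert l; decide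
    · rw [zero_add, hP, h0, smul_eq_mul, mul_one]
    · rw [hQ, h1, smul_eq_mul, mul_one]
  · rw [hZ, hz, zero_smul]

end Char

/-- In Δ(x_{ij}) = Σ x_{il} ⊗ x_{lj} only the index `l` whose x_{il} survives on the left factor
contributes, so the generator acts by a pure tensor of operators. -/
theorem tensor_act {V M : FDModule k (ANn k N n)} {i j l : Fin 2} {y y' : V.carrier}
    {v v' : M.carrier} {r s q : kˣ} (hy0 : V.act (x i (l + 1)) y = 0)
    (hy : V.act (x i l) y = (r : k) • y') (hv : M.act (x l j) v = (s : k) • v') (hq : r * s = q) :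
    (tensor V M).act (x i j) (y ⊗ₜ v) = (q : k) • (y' ⊗ₜ[k] v') := by
  change tensorRep V.act M.act _ _ = _
  rw [tensorRep_apply, SuzukiAlgebra.comul_eq, SuzukiAlgebra.comulHom_x, map_add,
    LinearMap.add_apply, tensorAct_tmul, tensorAct_tmul, ← hq, Units.val_mul]
  fin_cases l
  · rw [show V.act (x i 1) y = 0 from hy0, TensorProduct.zero_tmul, add_zero,
      ← TensorProduct.smul_tmul_smul]
    exact congrArg₂ _ hy hv
  · rw [show V.act (x i 0) y = 0 from hy0, TensorProduct.zero_tmul, zero_add,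
      ← TensorProduct.smul_tmul_smul]
    exact congrArg₂ _ hy hv

/-- If the other generator in the row of x_{ji} vanishes on `V`, then x_{ji}^{2N} acts as 1 and
S(x_{ij}) = x_{ji}^{2N−1} is the inverse of x_{ji} there. -/
theorem dual_act {V : FDModule k (ANn k N n)} {i j : Fin 2} {f f' : Module.Dual k V.carrier}
    (h0 : ∀ y, V.act (x j (i + 1)) y = 0) (h : ∀ y, f y = f' (V.act (x j i) y)) :
    (dual V).act (x i j) f = f' := by
  refine LinearMap.ext fun y => ?_
  change f (V.act (SuzukiAlgebra.antipodeLin (x i j)) y) = f' y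
  have hN : 2 * N ≠ 0 := mul_ne_zero two_ne_zero (NeZero.ne N)
  have h1 : V.act (x j (i + 1) ^ (2 * N)) y = 0 := by
    rw [← Nat.succ_pred_eq_of_ne_zero hN, pow_succ, map_mul, Module.End.mul_apply, h0, map_zero]
  have h2 : V.act (x j i ^ (2 * N)) y = y := by
    have h3 := congrArg (V.act · y) (pow_add_pow (k := k) (N := N) (n := n) i j)
    simpa only [map_add, LinearMap.add_apply, h1, add_zero, map_one, Module.End.one_apply] using h3
  rw [SuzukiAlgebra.antipodeLin_x, h, ← Module.End.mul_apply, ← map_mul, ← pow_succ',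
    Nat.sub_add_cancel (Nat.one_le_iff_ne_zero.2 hN), h2]

end ANn

end

/-! ### The fusion rules of A_{Nn} -/

noncomputable section

theorem sgn_inv (k : Type u) [Field k] (β : ℤˣ) : (sgn k β)⁻¹ = sgn k β := by
  rw [← map_inv, Int.units_inv_eq_self]

/-- The parity of `βⁿ`. -/
theorem exists_sgn_pow_eq (k : Type u) [Field k] (β : ℤˣ) (n : ℕ) :
    ∃ d : Fin 2, sgn k β ^ n = (-1) ^ (d : ℕ) ∧ (d = 1 → ∀ β' : ℤˣ, sgn k β' ^ (n + 1) = 1) := by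
  rcases Nat.even_or_odd n with hn | hn
  · refine ⟨0, ?_, by simp⟩
    obtain ⟨l, rfl⟩ := hn
    rw [← two_mul, pow_mul, sgn_sq, one_pow, Fin.val_zero, pow_zero]
  -- The parity can be 1 only for odd `n`. Then n + 1 is even, so the factors βⁿ⁺¹ disappear.
  · have h (β' : ℤˣ) : sgn k β' ^ (n + 1) = 1 := by
      obtain ⟨l, hl⟩ := hn.add_one
      rw [hl, ← two_mul, pow_mul, sgn_sq, one_pow]
    rcases Int.units_eq_one_or β with rfl | rfl
    · exact ⟨0, by simp, fun _ => h⟩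
    · exact ⟨1, by simp [hn.neg_one_pow], fun _ => h⟩

theorem neg_one_zpow_add_mul {k : Type u} [Field k] {n : ℕ} {i : ℤ} {s : ℕ} {d e : Fin 2}
    (hd : sgn k ((-1) ^ s) ^ n = (-1) ^ (d : ℕ)) (he : (-1 : kˣ) ^ i = (-1) ^ (e : ℕ)) :
    (-1 : kˣ) ^ (i + s * n) = (-1) ^ ((d + e : Fin 2) : ℕ) := by
  rw [neg_one_pow_fin_add, ← hd, ← he, sgn_pow, zpow_add, mul_comm, ← Nat.cast_mul, zpow_natCast,
    pow_mul]

namespace ANn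

open FDModule DihedralPresentation

variable {k : Type u} [Field k] {N n : ℕ} [NeZero N] [NeZero n] (h2 : (2 : k) ≠ 0) (hN : Odd N)
  (E : DihedralRoots k N n)

theorem isIso_trivialModule :
    IsIso (trivialModule k (ANn k N n)) ((presentation h2 hN).char E 0 1 1) := by
  have h : sgn k 1 ^ n = (-1) ^ ((0 : Fin 2) : ℕ) := by simp
  have hx (i : Fin 2) : (trivialModule k (ANn k N n)).act (x i i : ANn k N n) (1 : k) = (1 : k) := by
    change Coalgebra.counit (R := k) (x i i : ANn k N n) * (1 : k) = 1
    rw [SuzukiAlgebra.counit_eq, SuzukiAlgebra.counitHom_x, if_pos rfl, one_mul]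
  exact isIso_char (M := trivialModule k (ANn k N n)) (v := (1 : k))
    (toSpanSingleton_mem_homs_of_act h2 hN h _ _ ((hx 0).trans (by simp))
      ((hx 1).trans (by simp))) (fun y => ⟨y, mul_one y⟩) (Module.finrank_self k)

/-- The parity d of the left factor decides how the rows act: as p ⊗ p and q ⊗ q for d = 0, as p ⊗ q
and q ⊗ p for d = 1. In the second case `n` is odd and the factors βⁿ⁺¹ by which p and q differ are
1. -/
theorem isIso_char_tensor_char (j j' : ℤ) (β β' τ τ' : ℤˣ) :
    IsIso (tensor ((presentation h2 hN).char E j β τ) ((presentation h2 hN).char E j' β' τ'))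
      ((presentation h2 hN).char E (j + j') (β * β') (τ * τ')) := by
  obtain ⟨d, hd, hn⟩ := exists_sgn_pow_eq k β n
  obtain ⟨e, he, -⟩ := exists_sgn_pow_eq k β' n
  have hde : sgn k (β * β') ^ n = (-1) ^ ((d + e : Fin 2) : ℕ) := by
    rw [map_mul, mul_pow, hd, he, neg_one_pow_fin_add]
  have hz := char_act_zero h2 hN hd (E := E) j τ
  have hp := char_act_p h2 hN hd (E := E) j τ
  have hq := char_act_q h2 hN hd (E := E) j τ
  have hp' := char_act_p h2 hN he (E := E) j' τ'
  have hq' := char_act_q h2 hN he (E := E) j' τ'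
  refine isIso_char (v := (1 : k) ⊗ₜ (1 : k)) (toSpanSingleton_mem_homs_of_act h2 hN hde _ _ ?_ ?_)
    exists_smul_one_tmul_one (by change Module.finrank k (k ⊗[k] k) = 1; simp)
  all_goals
    rw [zpow_add, map_mul _ τ]
    obtain rfl | rfl : d = 0 ∨ d = 1 := by clear hde hd hz hp hq hn; revert d; decide
  · rw [zero_add]
    exact tensor_act (hz _ 0) (hp _) (hp' _) (mul_mul_mul_comm _ _ _ _)
  · refine tensor_act (hz _ 0) (hp _) (hq' _) ?_
    rw [hn rfl, mul_one]
    exact mul_mul_mul_comm _ _ _ _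
  · rw [zero_add]
    refine tensor_act (hz _ 1) (hq _) (hq' _) ?_
    rw [map_mul, mul_pow]
    ac_rfl
  · rw [show 1 + (1 + e) = e by clear hde he hp' hq'; revert e; decide]
    refine tensor_act (hz _ 1) (hq _) (hp' _) ?_
    rw [hn rfl, hn rfl, mul_one, mul_one]
    exact mul_mul_mul_comm _ _ _ _

theorem isIso_char_tensor_plane (j j' i : ℤ) (s : ℕ) (τ : ℤˣ) :
    IsIso (tensor ((presentation h2 hN).char E j ((-1) ^ s) τ) ((presentation h2 hN).plane E j' i))
      ((presentation h2 hN).plane E (j + j') (i + s * n)) := by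
  obtain ⟨d, hd, hn⟩ := exists_sgn_pow_eq k ((-1) ^ s) n
  obtain ⟨e, he⟩ := exists_neg_one_zpow_eq (G := kˣ) i
  have hde := neg_one_zpow_add_mul hd he
  have hz := char_act_zero h2 hN hd (E := E) j τ
  have hp := char_act_p h2 hN hd (E := E) j τ
  have hq := char_act_q h2 hN hd (E := E) j τ
  have hp' := plane_act_p h2 hN he (E := E) j'
  have hql := plane_act_q_left h2 hN he (E := E) j'
  have hqr := plane_act_q_right h2 hN he (E := E) j'
  have hf : Module.finrank k (k ⊗[k] (k × k)) = 2 := by simp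
  obtain rfl | rfl : d = 0 ∨ d = 1 := by clear hde hd hz hp hq hn; revert d; decide
  · rw [zero_add] at hde
    refine isIso_plane (pairMap_smul_mem_homs h2 hN hde _ (c := sgn k τ)
      (tensor_act (hz _ 0) (hp 1) (hp' (1, 0)) ?_) (tensor_act (hz _ 0) (hp 1) (hp' (0, 1)) ?_)
      (tensor_act (hz _ 1) (hq 1) hqr ?_))
      (mem_of_one_tmul (left_mem_range_pairMap _ _) (right_mem_range_pairMap _ _ rfl)) hf
    · rw [zpow_add]; ac_rfl
    · rw [zpow_add, sgn_inv]; ac_rfl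
    · rw [zpow_add, sgn_inv, E.theta_add_mul]; ac_rfl
  -- Here the first row acts as p ⊗ q, which carries a power of θ on the plane. The roles of 1 ⊗ e₁
  -- and 1 ⊗ e₂ are exchanged and the scalar θ_i is put into the basis.
  · refine isIso_plane (pairMap_smul_mem_homs h2 hN hde _ (c := sgn k τ * E.theta i)
      (tensor_act (hz _ 0) (hp 1) hqr ?_) (tensor_act (hz _ 0) (hp 1) hql ?_) ?_)
      (mem_of_one_tmul (right_mem_range_pairMap _ _ rfl) (left_mem_range_pairMap _ _)) hf
    · rw [zpow_add]; ac_rfl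
    · rw [zpow_add, mul_inv, sgn_inv]; ac_rfl
    · rw [show 1 + (1 + e) = e by clear hde he hp' hql hqr; revert e; decide]
      refine tensor_act (hz _ 1) (hq 1) (hp' (1, 0)) ?_
      rw [zpow_add, mul_inv, sgn_inv, E.theta_add_mul, hn rfl, one_mul, mul_one,
        mul_left_comm (E.theta i), mul_inv_cancel, mul_one]
      ac_rfl

theorem isIso_plane_tensor_char (j j' i : ℤ) (s : ℕ) (τ : ℤˣ) :
    IsIso (tensor ((presentation h2 hN).plane E j' i) ((presentation h2 hN).char E j ((-1) ^ s) τ))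
      ((presentation h2 hN).plane E (j + j') (i + s * n)) := by
  obtain ⟨e, he, hn⟩ := exists_sgn_pow_eq k ((-1) ^ s) n
  obtain ⟨d, hd⟩ := exists_neg_one_zpow_eq (G := kˣ) i
  have hde := neg_one_zpow_add_mul he hd
  rw [add_comm e] at hde
  have hz := plane_act_zero h2 hN hd (E := E) j'
  have hp := plane_act_p h2 hN hd (E := E) j'
  have hql := plane_act_q_left h2 hN hd (E := E) j'
  have hqr := plane_act_q_right h2 hN hd (E := E) j'
  have hp' := char_act_p h2 hN he (E := E) j τ
  have hq' := char_act_q h2 hN he (E := E) j τ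
  have hf : Module.finrank k ((k × k) ⊗[k] k) = 2 := by simp
  have hm : (sgn k ((-1) ^ s) ^ (n + 1))⁻¹ = sgn k ((-1) ^ s) ^ (n + 1) := by
    rw [← map_pow, sgn_inv]
  obtain rfl | rfl : d = 0 ∨ d = 1 := by clear hde hd hz hp hql hqr; revert d; decide
  · rw [zero_add] at hde
    refine isIso_plane (pairMap_smul_mem_homs h2 hN hde _ (c := sgn k τ)
      (tensor_act (hz _ 0) (hp (1, 0)) (hp' 1) ?_) (tensor_act (hz _ 0) (hp (0, 1)) (hp' 1) ?_)
      (tensor_act (hz _ 1) hqr (hq' 1) ?_))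
      (mem_of_tmul_one (left_mem_range_pairMap _ _) (right_mem_range_pairMap _ _ rfl)) hf
    · rw [zpow_add]; ac_rfl
    · rw [zpow_add, sgn_inv]; ac_rfl
    · rw [zpow_add, sgn_inv, E.theta_add_mul]; ac_rfl
  · refine isIso_plane (pairMap_smul_mem_homs h2 hN hde _
      (c := sgn k τ * sgn k ((-1) ^ s) ^ (n + 1))
      (tensor_act (hz _ 0) (hp (1, 0)) (hq' 1) ?_) (tensor_act (hz _ 0) (hp (0, 1)) (hq' 1) ?_) ?_)
      (mem_of_tmul_one (left_mem_range_pairMap _ _) (right_mem_range_pairMap _ _ rfl)) hf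
    · rw [zpow_add]; ac_rfl
    · rw [zpow_add, mul_inv, sgn_inv, hm]; ac_rfl
    · rw [show 1 + (1 + e) = e by clear hde he hp' hq' hn; revert e; decide]
      refine tensor_act (hz _ 1) hqr (hp' 1) ?_
      rw [zpow_add, mul_inv, sgn_inv, E.theta_add_mul, mul_comm (sgn k τ),
        mul_mul_mul_comm (_ ^ (n + 1)), mul_inv_cancel, one_mul]
      ac_rfl

theorem isIso_plane_tensor_plane (i j : ℤ) :
    IsIso (tensor ((presentation h2 hN).plane E 0 i) ((presentation h2 hN).plane E 0 j))
      (directSum ((presentation h2 hN).plane E 0 (i + j))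
        ((presentation h2 hN).plane E 0 (i - j))) := by
  obtain ⟨d, hd⟩ := exists_neg_one_zpow_eq (G := kˣ) i
  obtain ⟨e, he⟩ := exists_neg_one_zpow_eq (G := kˣ) j
  have hde : (-1 : kˣ) ^ (i + j) = (-1) ^ ((d + e : Fin 2) : ℕ) := by
    rw [neg_one_pow_fin_add, ← hd, ← he, zpow_add]
  have hde' : (-1 : kˣ) ^ (i - j) = (-1) ^ ((d + e : Fin 2) : ℕ) := by
    rw [← hde, zpow_add, zpow_sub, ← inv_zpow, inv_neg, inv_one]
  have hz := plane_act_zero h2 hN hd (E := E) 0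
  have hp := plane_act_p h2 hN hd (E := E) 0
  have hql := plane_act_q_left h2 hN hd (E := E) 0
  have hqr := plane_act_q_right h2 hN hd (E := E) 0
  have hp' := plane_act_p h2 hN he (E := E) 0
  have hql' := plane_act_q_left h2 hN he (E := E) 0
  have hqr' := plane_act_q_right h2 hN he (E := E) 0
  have hf : Module.finrank k ((k × k) ⊗[k] (k × k)) = 4 := by simp
  obtain rfl | rfl : d = 0 ∨ d = 1 := by clear hde hde' hd hz hp hql hqr; revert d; decide
  · rw [zero_add] at hde hde'
    refine isIso_plane_plane (pairMap_smul_mem_homs h2 hN hde _ (c := 1)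
      (tensor_act (hz _ 0) (hp (1, 0)) (hp' (1, 0)) ?_)
      (tensor_act (hz _ 0) (hp (0, 1)) (hp' (0, 1)) ?_) (tensor_act (hz _ 1) hqr hqr' ?_))
      (pairMap_smul_mem_homs h2 hN hde' _ (c := 1)
      (tensor_act (hz _ 0) (hp (1, 0)) (hp' (0, 1)) ?_)
      (tensor_act (hz _ 0) (hp (0, 1)) (hp' (1, 0)) ?_) (tensor_act (hz _ 1) hqr hql' ?_))
      (mem_of_tmul (Submodule.mem_sup_left (left_mem_range_pairMap _ _))
        (Submodule.mem_sup_left (right_mem_range_pairMap _ _ rfl))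
        (Submodule.mem_sup_right (left_mem_range_pairMap _ _))
        (Submodule.mem_sup_right (right_mem_range_pairMap _ _ rfl))) hf
    all_goals simp [E.theta_add, E.theta_sub]
  -- For an odd left factor the rows act as p ⊗ q and q ⊗ p. The mixed tensors e₁ ⊗ e₂ and e₂ ⊗ e₁
  -- now span the summand of index i + j, and e₁ ⊗ e₁ and e₂ ⊗ e₂ that of index i − j, opposite to
  -- the even case.
  · have hee : 1 + (1 + e) = e := by clear hde hde' he hp' hql' hqr'; revert e; decide
    refine isIso_plane_plane (pairMap_smul_mem_homs h2 hN hde _ (c := E.theta j)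
      (tensor_act (hz _ 0) (hp (1, 0)) hqr' ?_)
      (tensor_act (hz _ 0) (hp (0, 1)) hql' ?_) ?_)
      (pairMap_smul_mem_homs h2 hN hde' _ (c := (E.theta j)⁻¹)
      (tensor_act (hz _ 0) (hp (1, 0)) hql' ?_)
      (tensor_act (hz _ 0) (hp (0, 1)) hqr' ?_) ?_)
      (mem_of_tmul (Submodule.mem_sup_right (left_mem_range_pairMap _ _))
        (Submodule.mem_sup_right (right_mem_range_pairMap _ _ rfl))
        (Submodule.mem_sup_left (left_mem_range_pairMap _ _))
        (Submodule.mem_sup_left (right_mem_range_pairMap _ _ rfl))) hf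
    · simp
    · simp
    · rw [hee]
      exact tensor_act (hz _ 1) hqr (hp' (1, 0)) (by simp [E.theta_add])
    · simp
    · simp
    · rw [hee]
      exact tensor_act (hz _ 1) hqr (hp' (0, 1)) (by simp [E.theta_sub])

/-- The antipode transposes indices: for parity 0 the generators stay in their rows, for parity 1
the dual action of each row is the inverse transpose of that of the other row. Since n is odd in the
latter case, both rows act by the same scalar. -/
theorem isIso_dual_char (j : ℤ) (β τ : ℤˣ) : IsIso (dual ((presentation h2 hN).char E j β τ))
    ((presentation h2 hN).char E (-j) β τ) := by
  obtain ⟨d, hd, hn⟩ := exists_sgn_pow_eq k β n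
  have hz := char_act_zero h2 hN hd (E := E) j τ
  have hp := char_act_p h2 hN hd (E := E) j τ
  have hq := char_act_q h2 hN hd (E := E) j τ
  have hm : (sgn k β ^ (n + 1))⁻¹ = sgn k β ^ (n + 1) := by rw [← map_pow, sgn_inv]
  have hd1 : Module.finrank k (Module.Dual k k) = 1 := by simp
  have hs {r s : kˣ} (h : r * s = 1) (y : k) : y = ((r : kˣ) : k) • ((s : k) • y) := by
    rw [smul_smul, ← Units.val_mul, h, Units.val_one, one_smul]
  refine isIso_char (v := (LinearMap.id : k →ₗ[k] k)) (toSpanSingleton_mem_homs_of_act h2 hN hd _ _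
    ?_ ?_) (fun y => ⟨y (1 : k), LinearMap.ext_ring (by simp)⟩) hd1
  all_goals
    rw [zpow_neg]
    obtain rfl | rfl : d = 0 ∨ d = 1 := by clear hd hz hp hq hn; revert d; decide
  · refine dual_act (fun y => hz y 0) fun y => (hs ?_ y).trans
      (congrArg (((_ : kˣ) : k) • ·) (hp y).symm)
    rw [← sgn_inv k τ, ← mul_inv, sgn_inv, inv_mul_cancel]
  · refine dual_act (fun y => hz y 1) fun y => (hs ?_ y).trans
      (congrArg (((_ : kˣ) : k) • ·) (hq y).symm)
    rw [hn rfl, mul_one, ← sgn_inv k τ, ← mul_inv, sgn_inv, inv_mul_cancel]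
  · refine dual_act (fun y => hz y 1) fun y => (hs ?_ y).trans
      (congrArg (((_ : kˣ) : k) • ·) (hq y).symm)
    rw [← sgn_inv k τ, ← hm, ← mul_inv, ← mul_inv, hm, sgn_inv, inv_mul_cancel]
  · refine dual_act (fun y => hz y 0) fun y => (hs ?_ y).trans
      (congrArg (((_ : kˣ) : k) • ·) (hp y).symm)
    rw [hn rfl, mul_one, ← sgn_inv k τ, ← mul_inv, sgn_inv, inv_mul_cancel]

theorem isIso_dual_plane (j i : ℤ) : IsIso (dual ((presentation h2 hN).plane E j i))
    ((presentation h2 hN).plane E (-j) i) := by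
  obtain ⟨d, hd⟩ := exists_neg_one_zpow_eq (G := kˣ) i
  have hz := plane_act_zero h2 hN hd (E := E) j
  have hp := plane_act_p h2 hN hd (E := E) j
  have hq (y : k × k) : ((presentation h2 hN).plane E j i).act (x 1 (1 + d)) y =
      (((E.ζ ^ j * E.theta i : kˣ) : k) * y.2, ((E.ζ ^ j * (E.theta i)⁻¹ : kˣ) : k) * y.1) := by
    have hy : y = y.1 • (1, 0) + y.2 • (0, 1) := by simp
    conv_lhs => rw [hy]
    rw [map_add, map_smul, map_smul, plane_act_q_left h2 hN hd, plane_act_q_right h2 hN hd]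
    simp [mul_comm]
  have hf : Module.finrank k (Module.Dual k (k × k)) = 2 := by simp
  have hs {r s : kˣ} (h : r * s = 1) (y : k) : y = ((r : kˣ) : k) * ((s : k) * y) := by
    rw [← mul_assoc, ← Units.val_mul, h, Units.val_one, one_mul]
  obtain rfl | rfl : d = 0 ∨ d = 1 := by clear hd hz hp hq; revert d; decide
  · refine isIso_plane (pairMap_smul_mem_homs h2 hN hd _ (c := 1) (v := LinearMap.snd k k k)
      (v' := LinearMap.fst k k k) (dual_act (fun y => hz y 0) fun y => ?_)
      (dual_act (fun y => hz y 0) fun y => ?_) (dual_act (fun y => hz y 1) fun y => ?_))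
      (mem_of_fst_snd (right_mem_range_pairMap _ _ rfl) (left_mem_range_pairMap _ _)) hf
    · rw [hp]
      exact hs (by simp) _
    · rw [hp]
      exact hs (by simp) _
    · refine Eq.trans ?_ (congrArg _ (hq y).symm)
      exact hs (by rw [inv_one, mul_one, zpow_neg, mul_mul_mul_comm]; simp) _
  -- For odd parity the first row acts on the dual through the inverse of q, which brings in θ_i and
  -- exchanges the two coordinate functionals.
  · refine isIso_plane (pairMap_smul_mem_homs h2 hN hd _ (c := E.theta i)
      (v := LinearMap.fst k k k) (v' := LinearMap.snd k k k)
      (dual_act (fun y => hz y 1) fun y => Eq.trans ?_ (congrArg _ (hq y).symm))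
      (dual_act (fun y => hz y 1) fun y => Eq.trans ?_ (congrArg _ (hq y).symm))
      (dual_act (fun y => hz y 0) fun y => Eq.trans ?_ (congrArg _ (hp y).symm)))
      (mem_of_fst_snd (left_mem_range_pairMap _ _) (right_mem_range_pairMap _ _ rfl)) hf
    · exact hs (by simp [mul_comm]) _
    · exact hs (by rw [zpow_neg, mul_mul_mul_comm]; simp) _
    · exact hs (by simp) _

/-- Tensor products and duals of the irreducible representations of `A_{Nn}`. -/
theorem fusionRules : (presentation h2 hN).FusionRules E where
  trivial := isIso_trivialModule h2 hN E
  char_char := isIso_char_tensor_char h2 hN E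
  char_plane := isIso_char_tensor_plane h2 hN E
  plane_char := isIso_plane_tensor_char h2 hN E
  plane_plane := isIso_plane_tensor_plane h2 hN E
  dual_char := isIso_dual_char h2 hN E
  dual_plane := isIso_dual_plane h2 hN E

end ANn

end

/-! ### Roots of unity and conclusion -/

noncomputable section

/-- Two rings with `∗`-structure that are isomorphic to a third one are isomorphic. -/
theorem RingEquiv.exists_comm_of_comm {R S T : Type*} [Mul R] [Mul S] [Mul T] [Add R] [Add S]
    [Add T] {σ : R → R} {star : S → S} {star' : T → T} {f : R ≃+* S} {g : R ≃+* T}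
    (hf : ∀ r, f (σ r) = star (f r)) (hg : ∀ r, g (σ r) = star' (g r)) :
    ∃ φ : S ≃+* T, ∀ s, φ (star s) = star' (φ s) := by
  refine ⟨f.symm.trans g, fun s => ?_⟩
  rw [RingEquiv.trans_apply, RingEquiv.trans_apply, ← hg]
  congr 1
  rw [RingEquiv.symm_apply_eq, hf, RingEquiv.apply_symm_apply]

/-- The roots of unity of a field with a primitive `4nN`-th root of unity. -/
theorem DihedralRoots.exists_of_isPrimitiveRoot {k : Type*} [Field k] {N n : ℕ} [NeZero N]
    [NeZero n] (hN : Odd N) {ω : k} (hω : IsPrimitiveRoot ω (4 * n * N)) :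
    ∃ E : DihedralRoots k N n, IsPrimitiveRoot E.ζ N ∧ IsPrimitiveRoot E.ω (2 * n) ∧
      (2 : k) ≠ 0 ∧ ∃ ξ : k, IsPrimitiveRoot ξ (2 * N) := by
  have hN0 := NeZero.ne N
  have hn0 := NeZero.ne n
  have hpos : 0 < 4 * n * N := by positivity
  have hω' := hω.isUnit_unit hpos.ne'
  set u := (hω.isUnit hpos.ne').unit
  -- Powers of the given root of order 4nN provide roots of the orders N, 2n, 2N and 2; the last one
  -- shows 2 ≠ 0.
  have h1 : IsPrimitiveRoot (u ^ (4 * n)) N := hω'.pow hpos rfl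
  have h2 : IsPrimitiveRoot (u ^ (2 * N)) (2 * n) := hω'.pow hpos (by ring)
  have h3 : IsPrimitiveRoot (ω ^ (2 * n)) (2 * N) := hω.pow hpos (by ring)
  have h4 : IsPrimitiveRoot (ω ^ (2 * n * N)) 2 := hω.pow hpos (by ring)
  have h5 : (2 : k) ≠ 0 := by
    have h := h4.neZero'
    simpa using h.out
  refine ⟨⟨u ^ (4 * n), u ^ (2 * N), hN, h1.pow_eq_one, ?_⟩, h1, h2, h5, _, h3⟩
  -- The `n`-th power of the chosen ω has order 2, so it is −1.
  have h6 : IsPrimitiveRoot (u ^ (2 * N * n)) 2 := hω'.pow hpos (by ring)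
  rw [← pow_mul]
  refine Units.ext ?_
  exact (IsPrimitiveRoot.coe_units_iff.2 h6).eq_neg_one_of_two_right

end

theorem proposition5p23 {k : Type*} [Field k] (N n : ℕ) [NeZero N] [NeZero n]
    (hN : Odd N) (hn : 2 ≤ n) (hω : ∃ ω : k, IsPrimitiveRoot ω (4 * n * N)) :
    (∃ φ : RepRing k (ANn k N n) ≃+* RepRing k (MonoidAlgebra k (GNn N n)),
      ∀ r, φ (RepRing.star r) = RepRing.star (φ r)) ∧
    (Even n →
      ∃ σ : EvenRing N n →+* EvenRing N n,
        (σ EvenRing.a = EvenRing.a ∧ σ EvenRing.b = EvenRing.b ∧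
          σ (EvenRing.c : (EvenRing N n)ˣ) = (EvenRing.c⁻¹ : (EvenRing N n)ˣ) ∧
          ∀ i : ℕ, 1 ≤ i → i < n → σ (EvenRing.x i) =
            ((EvenRing.c ^ (((-1 : ℤ) ^ i - 1) / 2) : (EvenRing N n)ˣ) : EvenRing N n) * EvenRing.x i) ∧
        (∃ f : EvenRing N n ≃+* RepRing k (ANn k N n), ∀ r, f (σ r) = RepRing.star (f r)) ∧
        (∃ g : EvenRing N n ≃+* RepRing k (MonoidAlgebra k (GNn N n)),
          ∀ r, g (σ r) = RepRing.star (g r))) ∧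
    (Odd n →
      ∃ σ : OddRing N n →+* OddRing N n,
        (σ OddRing.a = OddRing.a ∧
          σ (OddRing.b : (OddRing N n)ˣ) = (OddRing.b⁻¹ : (OddRing N n)ˣ) ∧
          ∀ i : ℕ, 1 ≤ i → i < n → σ (OddRing.x i) =
            ((OddRing.b ^ ((-1 : ℤ) ^ i - 1) : (OddRing N n)ˣ) : OddRing N n) * OddRing.x i) ∧
        (∃ f : OddRing N n ≃+* RepRing k (ANn k N n), ∀ r, f (σ r) = RepRing.star (f r)) ∧
        (∃ g : OddRing N n ≃+* RepRing k (MonoidAlgebra k (GNn N n)),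
          ∀ r, g (σ r) = RepRing.star (g r))) := by
  obtain ⟨ω, hω⟩ := hω
  obtain ⟨E, h1, h2, h3, h4⟩ := DihedralRoots.exists_of_isPrimitiveRoot hN hω
  obtain ⟨b, hb⟩ := (ANn.presentation (n := n) h3 hN).exists_basis h1 h2 h3 h4
  obtain ⟨b', hb'⟩ := (GNn.presentation k N n).exists_basis h1 h2 h3 h4
  have F := ANn.fusionRules h3 hN E
  have F' := GNn.fusionRules E
  have heven (hn : Even n) : ∃ σ : EvenRing N n →+* EvenRing N n,
        (σ EvenRing.a = EvenRing.a ∧ σ EvenRing.b = EvenRing.b ∧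
          σ (EvenRing.c : (EvenRing N n)ˣ) = (EvenRing.c⁻¹ : (EvenRing N n)ˣ) ∧
          ∀ i : ℕ, 1 ≤ i → i < n → σ (EvenRing.x i) =
            ((EvenRing.c ^ (((-1 : ℤ) ^ i - 1) / 2) : (EvenRing N n)ˣ) : EvenRing N n) * EvenRing.x i) ∧
        (∃ f : EvenRing N n ≃+* RepRing k (ANn k N n), ∀ r, f (σ r) = RepRing.star (f r)) ∧
        (∃ g : EvenRing N n ≃+* RepRing k (MonoidAlgebra k (GNn N n)),
          ∀ r, g (σ r) = RepRing.star (g r)) := by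
    obtain ⟨σ, hσ, H⟩ := EvenRing.exists_star hN hn
    refine ⟨σ, hσ, ?_, ?_⟩
    -- The representation ring carries only a ring structure a priori; commutativity comes from the
    -- fusion rules.
    · let := F.commRing b hb
      exact H (F.fusionRing b hb h3)
    · let := F'.commRing b' hb'
      exact H (F'.fusionRing b' hb' h3)
  have hodd (hn : Odd n) : ∃ σ : OddRing N n →+* OddRing N n,
        (σ OddRing.a = OddRing.a ∧
          σ (OddRing.b : (OddRing N n)ˣ) = (OddRing.b⁻¹ : (OddRing N n)ˣ) ∧
          ∀ i : ℕ, 1 ≤ i → i < n → σ (OddRing.x i) =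
            ((OddRing.b ^ ((-1 : ℤ) ^ i - 1) : (OddRing N n)ˣ) : OddRing N n) * OddRing.x i) ∧
        (∃ f : OddRing N n ≃+* RepRing k (ANn k N n), ∀ r, f (σ r) = RepRing.star (f r)) ∧
        (∃ g : OddRing N n ≃+* RepRing k (MonoidAlgebra k (GNn N n)),
          ∀ r, g (σ r) = RepRing.star (g r)) := by
    obtain ⟨σ, hσ, H⟩ := OddRing.exists_star hN hn
    refine ⟨σ, hσ, ?_, ?_⟩
    · let := F.commRing b hb
      exact H (F.fusionRing b hb h3)
    · let := F'.commRing b' hb'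
      exact H (F'.fusionRing b' hb' h3)
  refine ⟨?_, heven, hodd⟩
  -- The two representation rings are compared through the presented ring for the parity of `n`.
  rcases Nat.even_or_odd n with hn | hn
  · obtain ⟨σ, -, ⟨f, hf⟩, g, hg⟩ := heven hn
    exact RingEquiv.exists_comm_of_comm hf hg
  · obtain ⟨σ, -, ⟨f, hf⟩, g, hg⟩ := hodd hn
    exact RingEquiv.exists_comm_of_comm hf hg
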